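/- Let $(P,\omega)$ be a (finite-dimensional, smooth) symplectic manifold, and let $G$ be a compact Lie group with Lie algebra $\mathfrak g$ acting smoothly and symplectically on $P$, with an $\mathrm{Ad}^*$-equivariant momentum mapping $J:P\to\mathfrak g^*$. Conventions: $\omega(X_H,\cdot)=dH$; $\xi_P=X_{J_\xi}$ for $J_\xi=\langle J,\xi\rangle$, and $\xi p=\xi_P(p)$; $\mathrm{CoAd}_g=(\mathrm{Ad}_{g^{-1}})^*$ and $\mathrm{coad}_\xi=-(\mathrm{ad}_\xi)^*$. Let $H:P\to\mathbb R$ be smooth and $G$-invariant, let $p_e$ be a relative equilibrium with generator $\xi_e$ (the integral curve of $X_H$ at $p_e$ is $t\mapsto\exp(t\xi_e)p_e$) and momentum $\mu_e=J(p_e)$, and suppose that $p_e$ is regular, i.e. $\xi p_e\ne0$ for all $0\neq\xi\in\mathfrak g$. Let $G_{\mu_e}$ be the coadjoint isotropy group of $\mu_e$ and $\mathfrak g_{\mu_e}$ its Lie algebra. Let $(P_{\mu_e},\omega_{\mu_e})$, with projection $\pi$ from $J^{-1}(\mu_e)$, be the Marsden–Weinstein reduced space $J^{-1}(\mu_e)/G_{\mu_e}$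 near $p_e$ ($\pi$ is a submersion near $p_e$ whose fibres are locally the $G_{\mu_e}$-orbits, and $\pi^*\omega_{\mu_e}=\omega|J^{-1}(\mu_e)$), let $H_{\mu_e}$ be a smooth function with $H_{\mu_e}\circ\pi=H$ on $J^{-1}(\mu_e)$ near $p_e$, and put $\bar p_e=\pi(p_e)$. Suppose that $p_e$ is formally stable, i.e. the Hessian $d^2H_{\mu_e}(\bar p_e)$ is (positive or negative) definite. Let $H_{\xi_e}=H-J_{\xi_e}$, and let $dX_{H_{\xi_e}}(p_e)=S+N$ be the Jordan decomposition of the linearization of $X_{H_{\xi_e}}$ at $p_e$, with $S$ semisimple and $N$ nilpotent. (a) There are an $S$-invariant subspace $W$ with $\ker dJ(p_e)=W\oplus\mathfrak g_{\mu_e}p_e$, an $\mathrm{Ad}(G_{\mu_e})$-invariant complement $\mathfrak b$ of $\mathfrak g_{\mu_e}$ in $\mathfrak g$, and an $S$-invariant Lagrangian complement $Z$ of $\mathfrak g_{\mu_e}p_e$ in the symplectic orthogonal $(W\oplus\mathfrak bp_e)^{\omega\perp}$. (b) For every such choice, $T_{p_e}P=W\oplus\mathfrak g_{\mu_e}p_e\oplus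 Z\oplus\mathfrak bp_e$, and $T\pi|W$, $\eta p_e\mapsto\eta$, $dJ(p_e)|Z$ (followed by restriction to $\mathfrak g_{\mu_e}$) and $dJ(p_e)|\mathfrak bp_e$ identify this splitting with $$T_{\bar p_e}P_{\mu_e}\oplus\mathfrak g_{\mu_e}\oplus\mathfrak g_{\mu_e}^*\oplus T_{\mu_e}(G\mu_e),$$ and under this identification $$\omega\bigl((x,\eta,\nu,\tau),(x',\eta',\nu',\tau')\bigr)=\omega_{\mu_e}(x,x')+\langle\nu',\eta\rangle-\langle\nu,\eta'\rangle+\breve\omega(\tau,\tau'),$$ where $\breve\omega(\mathrm{coad}_\xi\mu_e,\mathrm{coad}_\eta\mu_e)=\langle\mu_e,[\xi,\eta]\rangle$ is the Kostant–Souriau form. Moreover: 1. $\mathrm{ad}_{\xi_e}$ preserves $\mathfrak g_{\mu_e}$, $(\mathrm{ad}_{\xi_e})^*$ preserves $T_{\mu_e}(G\mu_e)$, and $$S=\mathrm{diag}\bigl(dX_{H_{\mu_e}}(\bar p_e),\,-\mathrm{ad}_{\xi_e},\,(\mathrm{ad}_{\xi_e})^*,\,(\mathrm{ad}_{\xi_e})^*\bigr).$$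 2. There are linear maps $N^{13}:\mathfrak g_{\mu_e}^*\to T_{\bar p_e}P_{\mu_e}$, $N^{21}:T_{\bar p_e}P_{\mu_e}\to\mathfrak g_{\mu_e}$ and $N^{23}:\mathfrak g_{\mu_e}^*\to\mathfrak g_{\mu_e}$ with $N(x,\eta,\nu,\tau)=(N^{13}\nu,\;N^{21}x+N^{23}\nu,\;0,\;0)$. In particular $N^3=0$. 3. $N^{21}=-(N^{13})^*\omega_{\mu_e}^\flat$ with $\omega_{\mu_e}^\flat(x)=\omega_{\mu_e}(x,\cdot)$, and $(N^{23})^*=N^{23}$. 4. $dX_{H_{\mu_e}}(\bar p_e)N^{13}=-N^{13}\,\mathrm{coad}_{\xi_e}$, $\;N^{21}\,dX_{H_{\mu_e}}(\bar p_e)=-\mathrm{ad}_{\xi_e}N^{21}$, $\;\mathrm{ad}_{\xi_e}N^{23}=N^{23}\,\mathrm{coad}_{\xi_e}$, with $\mathrm{ad}_{\xi_e}$, $\mathrm{coad}_{\xi_e}$ acting on $\mathfrak g_{\mu_e}$, $\mathfrak g_{\mu_e}^*$. -/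

import Mathlib

open scoped Manifold ContDiff Topology

/-! All manifolds are smooth, without boundary, and modelled on a finite-dimensional real vector
space `E`.  Mathlib's tangent space `TangentSpace 𝓘(ℝ, E) x` is a synonym of `E` (through the
preferred chart at `x`), so tangent vectors are written as elements of `E`. -/

noncomputable section

namespace HamMech

section Manifolds

variable {E : Type*} [NormedAddCommGroup E] [NormedSpace ℝ E]
  {M : Type*} [TopologicalSpace M] [ChartedSpace E M]
  {F : Type*} [NormedAddCommGroup F] [NormedSpace ℝ F]
  {N : Type*} [TopologicalSpace N] [ChartedSpace F N]

/-- The tangent map `T_x f : T_x M → T_{f x} N`. -/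
def tangentAt (f : M → N) (x : M) : E →L[ℝ] F := mfderiv 𝓘(ℝ, E) 𝓘(ℝ, F) f x

/-- The expression of a field of bilinear forms in the preferred chart at `p`. -/
def formInChart (Ω : M → E →L[ℝ] E →L[ℝ] ℝ) (p : M) (x : E) : E →L[ℝ] E →L[ℝ] ℝ :=
  (Ω ((extChartAt 𝓘(ℝ, E) p).symm x)).bilinearComp
    (tangentAt (extChartAt 𝓘(ℝ, E) p).symm x) (tangentAt (extChartAt 𝓘(ℝ, E) p).symm x)

variable (E M) in
/-- A symplectic form: a smooth, closed, nondegenerate 2-form. -/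
structure SymplecticForm where
  /-- the bilinear form on each tangent space -/
  form : M → E →L[ℝ] E →L[ℝ] ℝ
  alternating : ∀ p v, form p v v = 0
  nondegenerate : ∀ p v, (∀ w, form p v w = 0) → v = 0
  smooth : ∀ p, ContDiffOn ℝ ∞ (formInChart form p) (extChartAt 𝓘(ℝ, E) p).target
  closed : ∀ p, ∀ x ∈ (extChartAt 𝓘(ℝ, E) p).target, ∀ u v w,
    fderiv ℝ (formInChart form p) x u v w + fderiv ℝ (formInChart form p) x v w u
      + fderiv ℝ (formInChart form p) x w u v = 0

theorem SymplecticForm.exists_form_eq [FiniteDimensional ℝ E] (Ω : SymplecticForm E M) (p : M)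
    (α : E →L[ℝ] ℝ) : ∃ v, Ω.form p v = α := by
  let f : E →ₗ[ℝ] Module.Dual ℝ E :=
    { toFun := fun v => (Ω.form p v).toLinearMap
      map_add' := fun v w => by ext; simp
      map_smul' := fun c v => by ext; simp }
  have hf : Function.Injective f := by
    rw [injective_iff_map_eq_zero]
    intro v hv
    exact Ω.nondegenerate p v fun w => LinearMap.congr_fun hv w
  have hs : Function.Surjective f :=
    (LinearMap.injective_iff_surjective_of_finrank_eq_finrank
      (Subspace.dual_finrank_eq (K := ℝ) (V := E)).symm).1 hf
  obtain ⟨v, hv⟩ := hs α.toLinearMap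
  exact ⟨v, by ext w; exact LinearMap.congr_fun hv w⟩

/-- The Hamiltonian vector field `X_H`, the unique vector field with `Ω(X_H, ·) = dH`. -/
def SymplecticForm.hamVF [FiniteDimensional ℝ E] (Ω : SymplecticForm E M) (H : M → ℝ) (p : M) : E :=
  (Ω.exists_form_eq p (tangentAt H p)).choose

/-- The linearization `dX(p) : T_p M → T_p M` of a vector field `X` at a zero `p` of `X`: the
derivative at `p` of the expression of `X` in the preferred chart at `p`. -/
def linearization (X : M → E) (p : M) : E →ₗ[ℝ] E :=
  (fderiv ℝ (fun x : E => (tangentAt (extChartAt 𝓘(ℝ, E) p) ((extChartAt 𝓘(ℝ, E) p).symm x) :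
    E →L[ℝ] E) (X ((extChartAt 𝓘(ℝ, E) p).symm x))) (extChartAt 𝓘(ℝ, E) p p)).toLinearMap

/-- The Hessian `d²f(p)` of a function `f` at a critical point `p`, computed in the preferred
chart at `p`. -/
def hessian (f : M → ℝ) (p : M) : E →L[ℝ] E →L[ℝ] ℝ :=
  fderiv ℝ (fderiv ℝ (f ∘ (extChartAt 𝓘(ℝ, E) p).symm)) (extChartAt 𝓘(ℝ, E) p p)

/-- A bilinear form is definite if it is positive definite or negative definite. -/
def IsDefinite (B : E →L[ℝ] E →L[ℝ] ℝ) : Prop :=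
  (∀ v, v ≠ 0 → 0 < B v v) ∨ (∀ v, v ≠ 0 → B v v < 0)

/-- The symplectic orthogonal of a subspace of `T_p M`. -/
def SymplecticForm.perp (Ω : SymplecticForm E M) (p : M) (V : Submodule ℝ E) : Submodule ℝ E where
  carrier := {v | ∀ w ∈ V, Ω.form p v w = 0}
  add_mem' := fun ha hb w hw => by simp [ha w hw, hb w hw]
  zero_mem' := fun w _ => by simp
  smul_mem' := fun c v hv w hw => by simp [hv w hw]

end Manifolds

section LieGroups

variable {EG : Type*} [NormedAddCommGroup EG] [NormedSpace ℝ EG]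
  {G : Type*} [TopologicalSpace G] [ChartedSpace EG G] [Group G]

/-! The Lie algebra `𝔤 = T_1 G` is Mathlib's `GroupLieAlgebra 𝓘(ℝ, EG) G`, a synonym of `EG`; its
dual `𝔤*` is the normed space `EG →L[ℝ] ℝ`. -/

/-- The adjoint action `Ad_g`, the derivative at `1` of conjugation by `g`. -/
def Ad (g : G) : EG →L[ℝ] EG := tangentAt (fun x : G => g * x * g⁻¹) 1

/-- The coadjoint action `CoAd_g = (Ad_{g⁻¹})^*` on `𝔤*`. -/
def CoAd (g : G) (α : EG →L[ℝ] ℝ) : EG →L[ℝ] ℝ := α.comp (Ad g⁻¹)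

theorem Ad_one : Ad (1 : G) = ContinuousLinearMap.id ℝ EG := by
  have h : (fun x : G => 1 * x * 1⁻¹) = id := by ext; simp
  unfold Ad tangentAt
  rw [h]
  exact mfderiv_id

variable [LieGroup 𝓘(ℝ, EG) ∞ G]

instance lieGroupMinSmoothness : LieGroup 𝓘(ℝ, EG) (minSmoothness ℝ 3) G := by
  simp only [minSmoothness_of_isRCLikeNormedField]
  infer_instance

theorem Ad_mul (g h : G) : (Ad (g * h) : EG →L[ℝ] EG) = (Ad g).comp (Ad h) := by
  have hd : ∀ k x : G, MDifferentiableAt 𝓘(ℝ, EG) 𝓘(ℝ, EG) (fun x : G => k * x * k⁻¹) x := by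
    intro k x
    have : ContMDiff 𝓘(ℝ, EG) 𝓘(ℝ, EG) ∞ (fun x : G => k * x * k⁻¹) :=
      (contMDiff_const.mul contMDiff_id).mul contMDiff_const
    exact this.mdifferentiableAt (by simp)
  have he : (fun x : G => (g * h) * x * (g * h)⁻¹)
      = (fun x : G => g * x * g⁻¹) ∘ (fun x : G => h * x * h⁻¹) := by
    ext x; simp [mul_assoc]
  have h1 : h * 1 * h⁻¹ = (1 : G) := by simp
  unfold Ad tangentAt
  rw [he, mfderiv_comp (I' := 𝓘(ℝ, EG)) 1 (hd g _) (hd h 1)]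
  have key : ∀ y : G, y = 1 → (mfderiv 𝓘(ℝ, EG) 𝓘(ℝ, EG) (fun x : G => g * x * g⁻¹) y :
      EG →L[ℝ] EG) = mfderiv 𝓘(ℝ, EG) 𝓘(ℝ, EG) (fun x : G => g * x * g⁻¹) (1 : G) := by
    rintro _ rfl; rfl
  exact congrArg (fun T : EG →L[ℝ] EG => T.comp
    (mfderiv 𝓘(ℝ, EG) 𝓘(ℝ, EG) (fun x : G => h * x * h⁻¹) 1 : EG →L[ℝ] EG)) (key _ h1)

variable (G) in
/-- The isotropy group `G_μ` of `μ` for the coadjoint action. -/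
def isotropyGroup (μ : EG →L[ℝ] ℝ) : Subgroup G where
  carrier := {g | CoAd g μ = μ}
  one_mem' := by simp [CoAd, Ad_one]
  mul_mem' := by
    intro a b ha hb
    simp only [Set.mem_ofPred_eq, CoAd] at *
    rw [mul_inv_rev, Ad_mul, ← ContinuousLinearMap.comp_assoc, hb, ha]
  inv_mem' := by
    intro a ha
    simp only [Set.mem_ofPred_eq, CoAd] at *
    conv_lhs => rw [← ha]
    rw [ContinuousLinearMap.comp_assoc, ← Ad_mul]
    simp [Ad_one]

/-- The Lie algebra of a closed subgroup `K` of `G`: the velocities at `1` of the curves in `K`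
through `1`.  (For closed `K` these already form a linear subspace, so the span adds nothing.) -/
def lieAlgebraOf (K : Subgroup G) : Submodule ℝ EG :=
  Submodule.span ℝ {ξ : EG | ∃ γ : ℝ → G, γ 0 = 1 ∧ (∀ t, γ t ∈ K) ∧
    MDifferentiableAt 𝓘(ℝ, ℝ) 𝓘(ℝ, EG) γ 0 ∧ (tangentAt γ 0 : ℝ →L[ℝ] EG) 1 = ξ}

variable (G) in
/-- `𝔤_μ`, the Lie algebra of `G_μ`. -/
abbrev isotropyAlgebra (μ : EG →L[ℝ] ℝ) : Submodule ℝ EG := lieAlgebraOf (isotropyGroup G μ)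

variable (G) in
/-- `T_μ(Gμ)`, the tangent space at `μ` of the coadjoint orbit `Gμ`, i.e. the range of the
derivative at `1` of the orbit map `g ↦ CoAd_g μ`. -/
def orbitTangent (μ : EG →L[ℝ] ℝ) : Submodule ℝ (EG →L[ℝ] ℝ) :=
  LinearMap.range (tangentAt (fun g : G => CoAd g μ) 1 : EG →L[ℝ] EG →L[ℝ] ℝ).toLinearMap

/-- `γ` is the one-parameter subgroup `t ↦ exp (t ξ)`. -/
def IsOneParameterSubgroup (γ : ℝ → G) (ξ : EG) : Prop :=
  (∀ s t, γ (s + t) = γ s * γ t) ∧ ContMDiff 𝓘(ℝ, ℝ) 𝓘(ℝ, EG) ∞ γ ∧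
    (tangentAt γ 0 : ℝ →L[ℝ] EG) 1 = ξ

variable [FiniteDimensional ℝ EG]

variable (G) in
/-- The bracket of the Lie algebra of `G`. -/
def bracket (ξ η : EG) : EG :=
  Bracket.bracket (L := GroupLieAlgebra 𝓘(ℝ, EG) G) (M := GroupLieAlgebra 𝓘(ℝ, EG) G) ξ η

variable (G) in
/-- `ad_ξ = [ξ, ·]` on `𝔤`. -/
def ad (ξ : EG) : EG →L[ℝ] EG :=
  LinearMap.toContinuousLinearMap
    { toFun := fun η => bracket G ξ η
      map_add' := fun η ζ => lie_add (L := GroupLieAlgebra 𝓘(ℝ, EG) G)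
        (M := GroupLieAlgebra 𝓘(ℝ, EG) G) ξ η ζ
      map_smul' := fun c η => lie_smul (R := ℝ) (L := GroupLieAlgebra 𝓘(ℝ, EG) G)
        (M := GroupLieAlgebra 𝓘(ℝ, EG) G) c ξ η }

variable (G) in
/-- The Kostant–Souriau form on `T_μ(Gμ)`: if `τ`, `τ'` are the velocities at `μ` of the orbit
in the directions `ξ`, `η`, then `Ω̆_μ(τ, τ') = ⟨μ, [ξ, η]⟩`. -/
def kostantSouriau (μ : EG →L[ℝ] ℝ) (τ τ' : orbitTangent G μ) : ℝ :=
  μ (bracket G (LinearMap.mem_range.1 τ.2).choose (LinearMap.mem_range.1 τ'.2).choose)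

end LieGroups

section Actions

variable {EG : Type*} [NormedAddCommGroup EG] [NormedSpace ℝ EG]
  {G : Type*} [TopologicalSpace G] [ChartedSpace EG G] [Group G]
  {EP : Type*} [NormedAddCommGroup EP] [NormedSpace ℝ EP]
  {P : Type*} [TopologicalSpace P] [ChartedSpace EP P] [MulAction G P]
  {EQ : Type*} [NormedAddCommGroup EQ] [NormedSpace ℝ EQ]
  {Q : Type*} [TopologicalSpace Q] [ChartedSpace EQ Q]

variable (G) in
/-- The infinitesimal generator map `ξ ↦ ξ p = ξ_P(p)`, i.e. the derivative at `1` of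
`g ↦ g p`. -/
def infGen (p : P) : EG →L[ℝ] EP := tangentAt (fun g : G => g • p) 1

variable (G) in
/-- The action preserves the symplectic form. -/
def IsSymplecticAction (Ω : SymplecticForm EP P) : Prop :=
  ∀ (g : G) (p : P) (v w : EP), Ω.form (g • p) (tangentAt (fun x : P => g • x) p v)
    (tangentAt (fun x : P => g • x) p w) = Ω.form p v w

variable (G) in
/-- `J : P → 𝔤*` is an `Ad*`-equivariant momentum mapping: `ξ_P` is the Hamiltonian vector field
of `J_ξ = ⟨J, ξ⟩`. -/
structure IsMomentumMap (Ω : SymplecticForm EP P) (J : P → EG →L[ℝ] ℝ) : Prop where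
  smooth : ContMDiff 𝓘(ℝ, EP) 𝓘(ℝ, EG →L[ℝ] ℝ) ∞ J
  generates : ∀ (p : P) (ξ : EG) (v : EP),
    Ω.form p (infGen G p ξ) v = (tangentAt J p : EP →L[ℝ] EG →L[ℝ] ℝ) v ξ
  equivariant : ∀ (g : G) (p : P), J (g • p) = CoAd g (J p)

/-- `p` is a relative equilibrium with generator `ξ`: the integral curve of `X_H` at `p` is
`t ↦ exp (t ξ) p`. -/
def IsRelativeEquilibrium [FiniteDimensional ℝ EP] (Ω : SymplecticForm EP P) (H : P → ℝ)
    (p : P) (ξ : EG) : Prop :=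
  ∃ γ : ℝ → G, IsOneParameterSubgroup γ ξ ∧
    IsMIntegralCurve (I := 𝓘(ℝ, EP)) (fun t => γ t • p) (Ω.hamVF H)

variable (G) in
/-- `p` is regular: `ξ p ≠ 0` for all nonzero `ξ ∈ 𝔤`. -/
def IsRegularPoint (p : P) : Prop := ∀ ξ : EG, ξ ≠ 0 → (infGen G p ξ : EP) ≠ 0

/-- `H_ξ = H - J_ξ`. -/
def augmentedHam (H : P → ℝ) (J : P → EG →L[ℝ] ℝ) (ξ : EG) (p : P) : ℝ := H p - J p ξ

variable [LieGroup 𝓘(ℝ, EG) ∞ G]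

variable (G) in
/-- `(Q, ΩQ)`, with the projection `π`, is the Marsden–Weinstein reduced space `J⁻¹(μ)/G_μ`,
`μ = J p`, near the point `p`.  Here `π` is only used on `J⁻¹(μ)`, and near `p`; as usual a map
is smooth on the submanifold `J⁻¹(μ)` near `p` if it extends smoothly to a neighbourhood `U` of
`p` in `P`.  The fibres of `π` are locally the `G_μ`-orbits, `π` is a submersion
on `J⁻¹(μ)` (whose tangent space at `x` is `ker dJ(x)`), and `π^* ΩQ` is the restriction of `Ω` to
`J⁻¹(μ)`.  For a free action of a compact group, the global reduced space is of this kind. -/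
structure IsReducedSpaceNear (Ω : SymplecticForm EP P) (J : P → EG →L[ℝ] ℝ) (p : P)
    (ΩQ : SymplecticForm EQ Q) (U : Set P) (π : P → Q) : Prop where
  isOpen : IsOpen U
  mem : p ∈ U
  smooth : ContMDiffOn 𝓘(ℝ, EP) 𝓘(ℝ, EQ) ∞ π U
  const_on_orbits : ∀ x ∈ U, J x = J p →
    ∀ᶠ g in 𝓝 (1 : G), g ∈ isotropyGroup G (J p) → π (g • x) = π x
  fibre_in_orbit : ∀ x ∈ U, J x = J p →
    ∀ᶠ y in 𝓝 x, J y = J p → π y = π x → ∃ g ∈ isotropyGroup G (J p), g • x = y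
  submersion : ∀ x ∈ U, J x = J p → ∀ u : EQ, ∃ v : EP,
    (tangentAt J x : EP →L[ℝ] EG →L[ℝ] ℝ) v = 0 ∧ tangentAt π x v = u
  pullback : ∀ x ∈ U, J x = J p → ∀ v w : EP,
    (tangentAt J x : EP →L[ℝ] EG →L[ℝ] ℝ) v = 0 → (tangentAt J x : EP →L[ℝ] EG →L[ℝ] ℝ) w = 0 →
    ΩQ.form (π x) (tangentAt π x v) (tangentAt π x w) = Ω.form x v w

variable (G) in
/-- The data of an `S`-invariant Moncrief (Witt) splitting
`T_p P = W ⊕ 𝔤_μ p ⊕ Z ⊕ 𝔟 p`, where `μ = J p`. -/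
structure IsMoncriefSplitting (Ω : SymplecticForm EP P) (J : P → EG →L[ℝ] ℝ) (p : P)
    (S : EP →ₗ[ℝ] EP) (W : Submodule ℝ EP) (𝔟 : Submodule ℝ EG) (Z : Submodule ℝ EP) : Prop where
  W_invariant : ∀ w ∈ W, S w ∈ W
  W_disjoint : Disjoint W ((isotropyAlgebra G (J p)).map (infGen G p).toLinearMap)
  W_sup : W ⊔ (isotropyAlgebra G (J p)).map (infGen G p).toLinearMap
    = LinearMap.ker (tangentAt J p : EP →L[ℝ] EG →L[ℝ] ℝ).toLinearMap
  b_invariant : ∀ g ∈ isotropyGroup G (J p), ∀ η ∈ 𝔟, Ad g η ∈ 𝔟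
  b_isCompl : IsCompl 𝔟 (isotropyAlgebra G (J p))
  Z_invariant : ∀ z ∈ Z, S z ∈ Z
  /-- `Z` is a Lagrangian subspace of `(W ⊕ 𝔟 p)^{Ω⊥}` ... -/
  Z_lagrangian : Z = Ω.perp p Z ⊓ Ω.perp p (W ⊔ 𝔟.map (infGen G p).toLinearMap)
  /-- ... complementary there to the Lagrangian subspace `𝔤_μ p`. -/
  Z_disjoint : Disjoint Z ((isotropyAlgebra G (J p)).map (infGen G p).toLinearMap)
  Z_sup : Z ⊔ (isotropyAlgebra G (J p)).map (infGen G p).toLinearMap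
    = Ω.perp p (W ⊔ 𝔟.map (infGen G p).toLinearMap)

/-- The model `T_{p̄}P_μ ⊕ 𝔤_μ ⊕ 𝔤_μ^* ⊕ T_μ(Gμ)` of `T_p P`. -/
abbrev Model (EQ : Type*) [NormedAddCommGroup EQ] [NormedSpace ℝ EQ]
    (G : Type*) [TopologicalSpace G] [Group G] {EG : Type*} [NormedAddCommGroup EG]
    [NormedSpace ℝ EG] [ChartedSpace EG G] [LieGroup 𝓘(ℝ, EG) ∞ G] (μ : EG →L[ℝ] ℝ) : Type _ :=
  EQ × isotropyAlgebra G μ × Module.Dual ℝ (isotropyAlgebra G μ) × orbitTangent G μ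

variable (G) in
/-- The identification of the splitting `W ⊕ 𝔤_μ p ⊕ Z ⊕ 𝔟 p` of `T_p P` with the model, through
`Tπ` on `W`, `η p ↦ η` on `𝔤_μ p`, `dJ(p)` (restricted to `𝔤_μ`) on `Z`, and `dJ(p)` on `𝔟 p`. -/
structure IsSplittingIdentification (J : P → EG →L[ℝ] ℝ) (p : P) (π : P → Q)
    (W : Submodule ℝ EP) (𝔟 : Submodule ℝ EG) (Z : Submodule ℝ EP)
    (Φ : EP ≃ₗ[ℝ] Model EQ G (J p)) : Prop where
  on_W : ∀ w ∈ W, Φ w = (tangentAt π p w, 0, 0, 0)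
  on_g : ∀ η : isotropyAlgebra G (J p), Φ (infGen G p (η : EG)) = (0, η, 0, 0)
  on_Z : ∀ z ∈ Z, Φ z = (0, 0,
    (tangentAt J p z : EG →L[ℝ] ℝ).toLinearMap.domRestrict (isotropyAlgebra G (J p)), 0)
  on_b : ∀ η ∈ 𝔟, ∃ τ : orbitTangent G (J p),
    (τ : EG →L[ℝ] ℝ) = (tangentAt J p : EP →L[ℝ] EG →L[ℝ] ℝ) (infGen G p η) ∧
      Φ (infGen G p η) = (0, 0, 0, τ)

end Actions

/-- `A = S + N` is the Jordan decomposition of `A`. -/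
structure IsJordanDecomposition {V : Type*} [AddCommGroup V] [Module ℝ V]
    (A S N : Module.End ℝ V) : Prop where
  sum : A = S + N
  semisimple : S.IsSemisimple
  nilpotent : IsNilpotent N
  commute : Commute S N

end HamMech

end

open HamMech

/-!
The splitting and the block forms are a matter of linear algebra, once the following facts about
the linearization `A = dX_{H_ξ}(p)` are known. Let `a : η ↦ η p` be the infinitesimal action at `p`,
which is injective since `p` is regular, let `K = ker dJ(p)`, which is the symplectic orthogonal of
the range of `a`, and let `μ = J p`, so that `𝔤_μ p = K ∩ 𝔤 p` is the radical of `K`.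

* `p` is a critical point of `H_ξ`, so `A` is the Hamiltonian matrix of a symmetric form (the
  Hessian), hence infinitesimally symplectic (`form_linearization_skew`).
* `A (η p) = -[ξ, η] p`: differentiate `dH_ξ(x)(η x) = ⟨J x, [η, ξ]⟩` at `p`
  (`IsRelativeEquilibrium.linearization_infGen`). Since `G` is compact, `ad_ξ` is skew for an
  invariant inner product, hence semisimple (`ad_isSemisimple`).
* On the level set of `J` through `p`, the functions `H_ξ` and `H_μ ∘ π` differ by a constant, so
  their Hessians agree on `K` (`IsReducedSpaceNear.hessian_eq`), and `Tπ` intertwines `A` on `K` with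
  `dX_{H_μ}`. The latter is skew for the definite form `d²H_μ`, hence semisimple
  (`linearization_isSemisimple`).

So `A` is semisimple on `𝔤 p` and on `K / 𝔤_μ p`. The nilpotent part `N`, a polynomial in `A`,
therefore kills `𝔤 p` and maps `K` into `𝔤_μ p`; being infinitesimally symplectic, too, it maps the
whole space into `K`. This is the asserted shape of `N`, and in particular `N ^ 3 = 0`. The symmetry
relations between the blocks of `N` say that `N` is infinitesimally symplectic, the intertwining
relations that it commutes with `S` (`IsLinearizedEquilibrium.normal_form`).

For the existence of the splitting, `W` comes from an `S`-invariant complement of `𝔤_μ p`, by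
semisimplicity of `S`, and `𝔟` is the orthogonal of `𝔤_μ` for an invariant inner product. An
`S`-invariant complement of `𝔤_μ p` in the orthogonal of `W ⊕ 𝔟 p` is made Lagrangian by a shear
along `𝔤_μ p` that commutes with `S` (`IsInfinitesimalAction.exists_lagrangian_complement`).

On the side of Lie groups, two facts are proved for the definition of the bracket through
left-invariant vector fields: the derivative of `Ad` at `1` is `ad` (`exists_hasMFDerivAt_Ad`), and
the Lie algebra of `G_μ`, defined by velocities of curves, is the kernel of `η ↦ coad_η μ`
(`mem_isotropyAlgebra_iff`).
-/

namespace HamMech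

/-! ### Semisimplicity and Jordan decompositions -/

section LinearAlgebra

open Module

variable {V : Type*} [AddCommGroup V] [Module ℝ V]
  {X : Type*} [AddCommGroup X] [Module ℝ X]

/-- An endomorphism that is skew for an anisotropic symmetric form is semisimple: the orthogonal of
an invariant subspace is an invariant complement. -/
theorem isSemisimple_of_skew [FiniteDimensional ℝ V] (B : LinearMap.BilinForm ℝ V)
    (hsymm : ∀ u v, B u v = B v u)
    (hB : ∀ v, B v v = 0 → v = 0) (T : End ℝ V) (hT : ∀ u v, B (T u) v = -B u (T v)) :
    T.IsSemisimple := by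
  rw [End.isSemisimple_iff]
  intro p hp
  refine ⟨B.orthogonal p, ?_, ?_⟩
  · intro v hv w hw
    have h := hT w v
    have h2 : B (T w) v = 0 := hv _ (hp hw)
    change B w (T v) = 0
    linarith
  · rw [LinearMap.BilinForm.isCompl_orthogonal_iff_disjoint]
    · rw [Submodule.disjoint_def]
      intro v hv hv'
      exact hB v (hv' v hv)
    · intro u v h
      rw [hsymm, h]

theorem _root_.Module.End.IsSemisimple.apply_eq_zero_of_pow_apply_eq_zero {M : End ℝ V}
    (hM : M.IsSemisimple) {k : ℕ} {x : V} (h : (M ^ k) x = 0) : M x = 0 := by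
  have hinv : ∀ v ∈ LinearMap.ker (M ^ k), M v ∈ LinearMap.ker (M ^ k) := by
    intro v hv
    simp only [LinearMap.mem_ker] at hv ⊢
    rw [← Module.End.mul_apply, ← pow_succ, pow_succ', Module.End.mul_apply, hv, map_zero]
  have hnil : IsNilpotent (M.restrict hinv) := by
    refine ⟨k, ?_⟩
    rw [Module.End.pow_restrict]
    ext ⟨v, hv⟩
    simpa using hv
  have h0 := End.eq_zero_of_isNilpotent_isSemisimple hnil (hM.restrict hinv)
  have := congrArg Subtype.val (LinearMap.congr_fun h0 ⟨x, h⟩)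
  simpa using this

namespace IsJordanDecomposition

variable [FiniteDimensional ℝ V] {A S N : End ℝ V}

/-- Uniqueness of the Jordan decomposition; commuting with `A` is not assumed of the parts, only
commuting with each other. -/
theorem unique (h : IsJordanDecomposition A S N) {S' N' : End ℝ V}
    (h' : IsJordanDecomposition A S' N') : S = S' ∧ N = N' := by
  have := End.isNilpotent_isSemisimple_unique h.nilpotent h.semisimple h'.nilpotent h'.semisimple
    h.commute.symm h'.commute.symm (by rw [add_comm, ← h.sum, h'.sum, add_comm])
  exact ⟨this.2, this.1⟩

theorem exists_aeval_eq (h : IsJordanDecomposition A S N) :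
    ∃ q : Polynomial ℝ, Polynomial.aeval A q = N := by
  obtain ⟨n, hn, s, hs, hn', hs', hA⟩ := A.exists_isNilpotent_isSemisimple
  have hc : Commute s n := Algebra.commute_of_mem_adjoin_singleton_of_commute hn
    (Algebra.commute_of_mem_adjoin_singleton_of_commute hs (Commute.refl A)).symm
  have := (h.unique ⟨by rw [add_comm]; exact hA, hs', hn', hc⟩).2
  rw [Algebra.adjoin_singleton_eq_range_aeval] at hn
  obtain ⟨q, hq⟩ := hn
  exact ⟨q, by rw [this]; exact hq⟩

theorem nilpotent_mem (h : IsJordanDecomposition A S N) {K : Submodule ℝ V}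
    (hK : ∀ v ∈ K, A v ∈ K) {v : V} (hv : v ∈ K) : N v ∈ K := by
  obtain ⟨q, rfl⟩ := h.exists_aeval_eq
  rw [Polynomial.aeval_eq_sum_range, LinearMap.sum_apply]
  refine K.sum_mem fun n hn => K.smul_mem _ ?_
  clear hn
  induction n with
  | zero => simpa using hv
  | succ n ih => rw [pow_succ', Module.End.mul_apply]; exact hK _ ih

/-- The nilpotent part vanishes on every semisimple subquotient: if `f` intertwines `A`, restricted
to an invariant subspace, with a semisimple map, then `f` kills the values of `N` there. -/
theorem map_nilpotent_eq_zero (h : IsJordanDecomposition A S N) {K : Submodule ℝ V}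
    (hK : ∀ v ∈ K, A v ∈ K) (f : V →ₗ[ℝ] X) [FiniteDimensional ℝ X] {T : End ℝ X}
    (hT : T.IsSemisimple)
    (hf : ∀ v ∈ K, f (A v) = T (f v)) {v : V} (hv : v ∈ K) : f (N v) = 0 := by
  obtain ⟨q, hq⟩ := h.exists_aeval_eq
  have hpow : ∀ n : ℕ, ∀ v ∈ K, (A ^ n) v ∈ K ∧ f ((A ^ n) v) = (T ^ n) (f v) := by
    intro n
    induction n with
    | zero => intro v hv; simpa using hv
    | succ n ih =>
      intro v hv
      obtain ⟨h1, h2⟩ := ih v hv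
      rw [pow_succ', pow_succ', Module.End.mul_apply, Module.End.mul_apply, hf _ h1, h2]
      exact ⟨hK _ h1, rfl⟩
  have hpoly : ∀ v ∈ K, f (N v) = Polynomial.aeval T q (f v) := by
    intro v hv
    rw [← hq, Polynomial.aeval_eq_sum_range, Polynomial.aeval_eq_sum_range]
    simp only [LinearMap.sum_apply, LinearMap.smul_apply, map_sum, map_smul]
    exact Finset.sum_congr rfl fun n _ => by rw [(hpow n v hv).2]
  have hpoly' : ∀ n : ℕ, ∀ v ∈ K, (N ^ n) v ∈ K ∧
      f ((N ^ n) v) = ((Polynomial.aeval T q) ^ n) (f v) := by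
    intro n
    induction n with
    | zero => intro v hv; simpa using hv
    | succ n ih =>
      intro v hv
      obtain ⟨h1, h2⟩ := ih v hv
      rw [pow_succ', pow_succ', Module.End.mul_apply, Module.End.mul_apply, hpoly _ h1, h2]
      exact ⟨h.nilpotent_mem hK h1, rfl⟩
  obtain ⟨k, hk⟩ := h.nilpotent
  rw [hpoly v hv]
  apply (hT.aeval q).apply_eq_zero_of_pow_apply_eq_zero (k := k)
  rw [← (hpoly' k v hv).2, hk]
  simp

/-- If `A` is infinitesimally symplectic, so are its semisimple and nilpotent parts: minus the
adjoints of the two parts form a Jordan decomposition of `A`, too. -/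
theorem skew (h : IsJordanDecomposition A S N) (B : LinearMap.BilinForm ℝ V)
    (hB : B.Nondegenerate) (hA : ∀ u v, B (A u) v = -B u (A v)) :
    (∀ u v, B (S u) v = -B u (S v)) ∧ (∀ u v, B (N u) v = -B u (N v)) := by
  -- `adj T` is the adjoint of `T`: `B (adj T u) v = B u (T v)`
  let e := B.toDual hB
  let adj : End ℝ V → End ℝ V := fun T => e.symm.toLinearMap ∘ₗ T.dualMap ∘ₗ e.toLinearMap
  have hadj : ∀ T u v, B (adj T u) v = B u (T v) := by
    intro T u v
    simp only [adj, LinearMap.comp_apply, LinearEquiv.coe_coe]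
    rw [LinearMap.BilinForm.apply_toDual_symm_apply]
    rfl
  have hext : ∀ T T' : End ℝ V, (∀ u v, B (T u) v = B (T' u) v) → T = T' := by
    intro T T' hT
    ext u
    apply e.injective
    ext v
    exact hT u v
  have hpow : ∀ (T : End ℝ V) (n : ℕ) u v, B ((adj T ^ n) u) v = B u ((T ^ n) v) := by
    intro T n
    induction n with
    | zero => simp
    | succ n ih =>
      intro u v
      rw [pow_succ', pow_succ, Module.End.mul_apply, Module.End.mul_apply, hadj, ih]
  have hpoly : ∀ (T : End ℝ V) (q : Polynomial ℝ) u v,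
      B (Polynomial.aeval (adj T) q u) v = B u (Polynomial.aeval T q v) := by
    intro T q u v
    rw [Polynomial.aeval_eq_sum_range, Polynomial.aeval_eq_sum_range]
    simp only [LinearMap.sum_apply, LinearMap.smul_apply, map_sum, map_smul, hpow]
  have hJ : IsJordanDecomposition A (-adj S) (-adj N) := by
    constructor
    · apply hext
      intro u v
      rw [hA, h.sum]
      simp [hadj]
      ring
    · rw [Module.End.isSemisimple_neg]
      apply Module.End.isSemisimple_of_squarefree_aeval_eq_zero h.semisimple.minpoly_squarefree
      apply hext
      intro u v
      rw [hpoly, minpoly.aeval]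
      simp
    · obtain ⟨k, hk⟩ := h.nilpotent
      refine IsNilpotent.neg ⟨k, ?_⟩
      apply hext
      intro u v
      rw [hpow, hk]
      simp
    · apply Commute.neg_left
      apply Commute.neg_right
      apply hext
      intro u v
      rw [Module.End.mul_apply, Module.End.mul_apply, hadj, hadj, hadj, hadj,
        ← Module.End.mul_apply, ← Module.End.mul_apply, h.commute.eq]
  obtain ⟨h1, h2⟩ := h.unique hJ
  constructor
  · intro u v
    conv_lhs => rw [h1]
    simp [hadj]
  · intro u v
    conv_lhs => rw [h2]
    simp [hadj]

end IsJordanDecomposition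

end LinearAlgebra

/-! ### Witt splittings of a symplectic vector space -/

section WittSplitting

open Module

variable {V : Type*} [AddCommGroup V] [Module ℝ V]
  {𝔤 : Type*} [AddCommGroup 𝔤] [Module ℝ 𝔤]

/-- The linear setting of the splitting: a linear map `a` from `𝔤` to a symplectic vector space
`(V, Ω)` (the infinitesimal action at a point), and the preimage `𝔨` of the radical of `Ω` on the
range of `a` (the isotropy algebra of the momentum). -/
structure IsInfinitesimalAction (Ω : LinearMap.BilinForm ℝ V) (a : 𝔤 →ₗ[ℝ] V)
    (𝔨 : Submodule ℝ 𝔤) : Prop where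
  nondegenerate : Ω.Nondegenerate
  alt : Ω.IsAlt
  injective : Function.Injective a
  mem_iff : ∀ η, η ∈ 𝔨 ↔ ∀ ζ, Ω (a ζ) (a η) = 0

/-- The Witt splitting `V = W ⊕ a 𝔨 ⊕ Z ⊕ a 𝔟` of a symplectic vector space; the orthogonal of the
range of `a` plays the part of `ker dJ`. -/
structure IsWittSplitting (Ω : LinearMap.BilinForm ℝ V) (a : 𝔤 →ₗ[ℝ] V) (𝔨 : Submodule ℝ 𝔤)
    (W : Submodule ℝ V) (𝔟 : Submodule ℝ 𝔤) (Z : Submodule ℝ V) : Prop where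
  W_disjoint : Disjoint W (𝔨.map a)
  W_sup : W ⊔ 𝔨.map a = Ω.orthogonal (LinearMap.range a)
  b_isCompl : IsCompl 𝔟 𝔨
  Z_isotropic : ∀ z ∈ Z, ∀ z' ∈ Z, Ω z z' = 0
  Z_disjoint : Disjoint Z (𝔨.map a)
  Z_sup : Z ⊔ 𝔨.map a = Ω.orthogonal (W ⊔ 𝔟.map a)

namespace IsInfinitesimalAction

variable {Ω : LinearMap.BilinForm ℝ V} {a : 𝔤 →ₗ[ℝ] V} {𝔨 : Submodule ℝ 𝔤}

theorem swap (h : IsInfinitesimalAction Ω a 𝔨) (u v : V) : Ω u v = -Ω v u := by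
  exact (LinearMap.IsAlt.neg h.alt v u).symm

theorem swap_zero (h : IsInfinitesimalAction Ω a 𝔨) {u v : V} (huv : Ω u v = 0) : Ω v u = 0 := by
  rw [h.swap, huv, neg_zero]

theorem map_le (h : IsInfinitesimalAction Ω a 𝔨) :
    𝔨.map a ≤ Ω.orthogonal (LinearMap.range a) := by
  rintro _ ⟨η, hη, rfl⟩ _ ⟨ζ, rfl⟩
  exact (h.mem_iff η).1 hη ζ

theorem map_le_orthogonal (h : IsInfinitesimalAction Ω a 𝔨) {W : Submodule ℝ V}
    {𝔟 : Submodule ℝ 𝔤} (hWs : W ⊔ 𝔨.map a = Ω.orthogonal (LinearMap.range a)) :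
    𝔨.map a ≤ Ω.orthogonal (W ⊔ 𝔟.map a) := by
  rintro _ ⟨η, hη, rfl⟩ v hv
  obtain ⟨w, hw, _, ⟨β, hβ, rfl⟩, rfl⟩ := Submodule.mem_sup.1 hv
  have hw' : w ∈ Ω.orthogonal (LinearMap.range a) := hWs ▸ Submodule.mem_sup_left hw
  have h1 : Ω w (a η) = 0 := h.swap_zero (hw' _ ⟨η, rfl⟩)
  have h2 : Ω (a β) (a η) = 0 := (h.mem_iff η).1 hη β
  change Ω (w + a β) (a η) = 0
  rw [map_add, LinearMap.add_apply, h1, h2, add_zero]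

variable [FiniteDimensional ℝ V]

/-- `W` and `a 𝔟` are symplectic, because `W` complements `a 𝔨` in the orthogonal of the range of
`a` and `𝔟` complements `𝔨`, which are the radicals. They are orthogonal to each other, so `W ⊕ a 𝔟`
is symplectic as well, and complements its orthogonal. -/
theorem isCompl_orthogonal (h : IsInfinitesimalAction Ω a 𝔨) {W : Submodule ℝ V}
    {𝔟 : Submodule ℝ 𝔤} (hWd : Disjoint W (𝔨.map a))
    (hWs : W ⊔ 𝔨.map a = Ω.orthogonal (LinearMap.range a)) (hb : IsCompl 𝔟 𝔨) :
    IsCompl (W ⊔ 𝔟.map a) (Ω.orthogonal (W ⊔ 𝔟.map a)) ∧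
      (∀ w ∈ W, (∀ w' ∈ W, Ω w' w = 0) → w = 0) ∧
      (∀ β ∈ 𝔟, (∀ β' ∈ 𝔟, Ω (a β') (a β) = 0) → β = 0) := by
  have hWK : ∀ w ∈ W, ∀ η, Ω (a η) w = 0 := by
    intro w hw η
    have : w ∈ Ω.orthogonal (LinearMap.range a) := hWs ▸ Submodule.mem_sup_left hw
    exact this _ ⟨η, rfl⟩
  have h1 : ∀ w ∈ W, (∀ w' ∈ W, Ω w' w = 0) → w = 0 := by
    intro w hw hww
    have hw2 : w ∈ Ω.orthogonal (Ω.orthogonal (LinearMap.range a)) := by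
      intro v hv
      rw [← hWs] at hv
      obtain ⟨w', hw', _, ⟨η, hη, rfl⟩, rfl⟩ := Submodule.mem_sup.1 hv
      simp [hww w' hw', hWK w hw η]
    rw [LinearMap.BilinForm.orthogonal_orthogonal h.nondegenerate h.alt.isRefl] at hw2
    obtain ⟨ζ, rfl⟩ := hw2
    have hζ : ζ ∈ 𝔨 := (h.mem_iff ζ).2 fun η => hWK _ hw η
    exact Submodule.disjoint_def.1 hWd _ hw ⟨ζ, hζ, rfl⟩
  have h2 : ∀ β ∈ 𝔟, (∀ β' ∈ 𝔟, Ω (a β') (a β) = 0) → β = 0 := by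
    intro β hβ hββ
    refine Submodule.disjoint_def.1 hb.disjoint _ hβ ((h.mem_iff β).2 fun ζ => ?_)
    obtain ⟨β', hβ', κ, hκ, rfl⟩ := Submodule.mem_sup.1
      (hb.sup_eq_top ▸ Submodule.mem_top : ζ ∈ 𝔟 ⊔ 𝔨)
    simp [hββ β' hβ', h.swap_zero ((h.mem_iff κ).1 hκ β)]
  refine ⟨?_, h1, h2⟩
  rw [LinearMap.BilinForm.isCompl_orthogonal_iff_disjoint h.alt.isRefl, Submodule.disjoint_def]
  intro v hv hv'
  obtain ⟨w, hw, _, ⟨β, hβ, rfl⟩, rfl⟩ := Submodule.mem_sup.1 hv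
  have hw0 : w = 0 := by
    refine h1 w hw fun w' hw' => ?_
    have h3 : Ω w' (w + a β) = 0 := hv' w' (Submodule.mem_sup_left hw')
    rw [map_add, h.swap_zero (hWK w' hw' β), add_zero] at h3
    exact h3
  have hβ0 : β = 0 := by
    refine h2 β hβ fun β' hβ' => ?_
    have h3 : Ω (a β') (w + a β) = 0 := hv' (a β') (Submodule.mem_sup_right ⟨β', hβ', rfl⟩)
    rw [map_add, hWK w hw β', zero_add] at h3
    exact h3
  simp [hw0, hβ0]

/-- An invariant complement of `a 𝔨` in the symplectic space `(W ⊕ a 𝔟)^⊥` is sheared along the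
Lagrangian subspace `a 𝔨` into a Lagrangian one; the shear commutes with `S`. -/
theorem exists_lagrangian_complement (h : IsInfinitesimalAction Ω a 𝔨) {W : Submodule ℝ V}
    {𝔟 : Submodule ℝ 𝔤} (hWd : Disjoint W (𝔨.map a))
    (hWs : W ⊔ 𝔨.map a = Ω.orthogonal (LinearMap.range a)) (hb : IsCompl 𝔟 𝔨)
    {S : End ℝ V} (hS : S.IsSemisimple) (hskew : ∀ u v, Ω (S u) v = -Ω u (S v))
    (hSk : ∀ v ∈ 𝔨.map a, S v ∈ 𝔨.map a) (hSW : ∀ w ∈ W, S w ∈ W)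
    (hSb : ∀ v ∈ 𝔟.map a, S v ∈ 𝔟.map a) :
    ∃ Z, IsWittSplitting Ω a 𝔨 W 𝔟 Z ∧ ∀ z ∈ Z, S z ∈ Z := by
  obtain ⟨hc, hWnd, -⟩ := h.isCompl_orthogonal hWd hWs hb
  have hLY := h.map_le_orthogonal (𝔟 := 𝔟) hWs
  set Y := Ω.orthogonal (W ⊔ 𝔟.map a) with hY
  have hSY : ∀ y ∈ Y, S y ∈ Y := by
    intro y hy v hv
    have hv' : S v ∈ W ⊔ 𝔟.map a := by
      obtain ⟨w, hw, b, hb, rfl⟩ := Submodule.mem_sup.1 hv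
      rw [map_add]
      exact Submodule.add_mem_sup (hSW w hw) (hSb b hb)
    have h1 : Ω (S v) y = 0 := hy _ hv'
    rw [hskew] at h1
    exact neg_eq_zero.1 h1
  obtain ⟨C, hSC, hC⟩ := End.isSemisimple_iff.1 hS (𝔨.map a) hSk
  let Z₀ := C ⊓ Y
  have hSZ₀ : ∀ z ∈ Z₀, S z ∈ Z₀ := fun z hz => ⟨hSC hz.1, hSY z hz.2⟩
  have hYdec : ∀ y ∈ Y, ∃ ℓ ∈ 𝔨.map a, ∃ z ∈ Z₀, ℓ + z = y := by
    intro y hy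
    obtain ⟨ℓ, hℓ, z, hz, rfl⟩ := Submodule.mem_sup.1
      (hC.sup_eq_top ▸ Submodule.mem_top : y ∈ 𝔨.map a ⊔ C)
    exact ⟨ℓ, hℓ, z, ⟨hz, by simpa using Y.sub_mem hy (hLY hℓ)⟩, rfl⟩
  have hLL : ∀ u ∈ 𝔨.map a, ∀ v ∈ 𝔨.map a, Ω u v = 0 := by
    rintro _ ⟨η, hη, rfl⟩ _ ⟨ζ, hζ, rfl⟩
    exact (h.mem_iff ζ).1 hζ η
  -- `Ω` pairs `a 𝔨` and `Z₀` perfectly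
  let φ : (𝔨.map a) →ₗ[ℝ] Dual ℝ Z₀ := (Ω.domRestrict₁₂ (𝔨.map a) Z₀)
  have hφ : ∀ (ℓ : 𝔨.map a) (z : Z₀), φ ℓ z = Ω ℓ z := fun _ _ => rfl
  have hφi : Function.Injective φ := by
    rw [injective_iff_map_eq_zero]
    rintro ⟨ℓ, hℓ⟩ h0
    have : ℓ = 0 := by
      apply h.nondegenerate.1
      intro v
      obtain ⟨v₀, hv₀, y, hy, rfl⟩ := Submodule.mem_sup.1
        (hc.sup_eq_top ▸ Submodule.mem_top : v ∈ _ ⊔ Y)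
      obtain ⟨ℓ', hℓ', z, hz, rfl⟩ := hYdec y hy
      have h1 : Ω ℓ v₀ = 0 := h.swap_zero (hLY hℓ v₀ hv₀)
      have h2 : Ω ℓ z = 0 := LinearMap.congr_fun h0 (⟨z, hz⟩ : Z₀)
      simp [h1, h2, hLL ℓ hℓ ℓ' hℓ']
    simpa using this
  have hφi' : Function.Injective φ.flip := by
    rw [injective_iff_map_eq_zero]
    rintro ⟨z, hz⟩ h0
    have hzL : ∀ ℓ ∈ 𝔨.map a, Ω ℓ z = 0 := fun ℓ hℓ =>
      LinearMap.congr_fun h0 (⟨ℓ, hℓ⟩ : 𝔨.map a)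
    have hzK : z ∈ Ω.orthogonal (LinearMap.range a) := by
      rintro _ ⟨ζ, rfl⟩
      obtain ⟨β, hβ, κ, hκ, rfl⟩ := Submodule.mem_sup.1
        (hb.sup_eq_top ▸ Submodule.mem_top : ζ ∈ 𝔟 ⊔ 𝔨)
      have h1 : Ω (a β) z = 0 := hz.2 _ (Submodule.mem_sup_right ⟨β, hβ, rfl⟩)
      have h2 : Ω (a κ) z = 0 := hzL _ ⟨κ, hκ, rfl⟩
      change Ω (a (β + κ)) z = 0
      simp [h1, h2]
    rw [← hWs] at hzK
    obtain ⟨w, hw, ℓ, hℓ, rfl⟩ := Submodule.mem_sup.1 hzK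
    have hw0 : w = 0 := by
      refine hWnd w hw fun w' hw' => ?_
      have h1 : Ω w' (w + ℓ) = 0 := hz.2 _ (Submodule.mem_sup_left hw')
      have h2 : Ω w' ℓ = 0 := hLY hℓ _ (Submodule.mem_sup_left hw')
      rwa [map_add, h2, add_zero] at h1
    subst hw0
    have : (0 : V) + ℓ = 0 :=
      Submodule.disjoint_def.1 hC.disjoint _ (by simpa using hℓ) hz.1
    simpa using this
  have hfr : finrank ℝ (𝔨.map a) = finrank ℝ (Dual ℝ Z₀) := by
    apply le_antisymm (LinearMap.finrank_le_finrank_of_injective hφi)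
    have := LinearMap.finrank_le_finrank_of_injective hφi'
    rw [Subspace.dual_finrank_eq] at this ⊢
    exact this
  let e : (𝔨.map a) ≃ₗ[ℝ] Dual ℝ Z₀ := LinearEquiv.ofInjectiveOfFinrankEq φ hφi hfr
  have he : ∀ (ν : Dual ℝ Z₀) (z : Z₀), Ω (e.symm ν) z = ν z := by
    intro ν z
    have : e (e.symm ν) = ν := e.apply_symm_apply ν
    exact LinearMap.congr_fun this z
  -- `Ω (T z) z' = -Ω z z' / 2` makes the graph `{z + T z}` isotropic: the terms `Ω (T z) z'` and
  -- `Ω z (T z')` each contribute half of `-Ω z z'`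
  let T : Z₀ →ₗ[ℝ] V := (𝔨.map a).subtype ∘ₗ e.symm.toLinearMap ∘ₗ
    ((-(1 / 2 : ℝ)) • Ω.domRestrict₁₂ Z₀ Z₀)
  have hT : ∀ z z' : Z₀, Ω (T z) z' = -(1 / 2) * Ω z z' := by
    intro z z'
    simp only [T, LinearMap.comp_apply, Submodule.subtype_apply, LinearEquiv.coe_coe, he]
    rfl
  have hTL : ∀ z, T z ∈ 𝔨.map a := fun z => (e.symm _).2
  have hTS : ∀ z : Z₀, S (T z) = T ⟨S z, hSZ₀ z z.2⟩ := by
    intro z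
    have : (⟨S (T z), hSk _ (hTL z)⟩ : 𝔨.map a) = ⟨T ⟨S z, hSZ₀ z z.2⟩, hTL _⟩ := by
      apply hφi
      ext z'
      rw [hφ, hφ]
      change Ω (S (T z)) z' = Ω (T ⟨S z, hSZ₀ z z.2⟩) z'
      have h3 := hT z ⟨S z', hSZ₀ z' z'.2⟩
      rw [hskew, hT]
      rw [h3, hskew]
      ring
    exact congrArg Subtype.val this
  refine ⟨LinearMap.range (Z₀.subtype + T), ⟨hWd, hWs, hb, ?_, ?_, ?_⟩, ?_⟩
  · rintro _ ⟨z, rfl⟩ _ ⟨z', rfl⟩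
    have h1 := hT z z'
    have h2 := hT z' z
    rw [h.swap (T z') z, h.swap z' z] at h2
    simp [h1, hLL _ (hTL z) _ (hTL z')]
    linarith
  · rw [Submodule.disjoint_def]
    rintro _ ⟨z, rfl⟩ hz
    have h1 : (z : V) ∈ 𝔨.map a := by simpa using Submodule.sub_mem _ hz (hTL z)
    have h2 : z = 0 := by
      ext
      exact Submodule.disjoint_def.1 hC.disjoint _ h1 z.2.1
    simp [h2]
  · apply le_antisymm
    · refine sup_le ?_ hLY
      rintro _ ⟨z, rfl⟩
      exact Y.add_mem z.2.2 (hLY (hTL z))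
    · intro y hy
      obtain ⟨ℓ, hℓ, z, hz, rfl⟩ := hYdec y hy
      refine Submodule.mem_sup.2 ⟨_, ⟨⟨z, hz⟩, rfl⟩, _,
        Submodule.sub_mem _ hℓ (hTL ⟨z, hz⟩), ?_⟩
      simp [add_comm]
  · rintro _ ⟨z, rfl⟩
    refine ⟨⟨S z, hSZ₀ z z.2⟩, ?_⟩
    simp [hTS]

end IsInfinitesimalAction

end WittSplitting

section WittDecomposition

open Module

variable {V : Type*} [AddCommGroup V] [Module ℝ V] [FiniteDimensional ℝ V]
  {𝔤 : Type*} [AddCommGroup 𝔤] [Module ℝ 𝔤]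
  {X : Type*} [AddCommGroup X] [Module ℝ X]
  {O : Type*} [AddCommGroup O] [Module ℝ O]

variable {Ω : LinearMap.BilinForm ℝ V} {a : 𝔤 →ₗ[ℝ] V} {𝔨 : Submodule ℝ 𝔤}
  {W : Submodule ℝ V} {𝔟 : Submodule ℝ 𝔤} {Z : Submodule ℝ V}

namespace IsWittSplitting

omit [FiniteDimensional ℝ V]

theorem Ω_W_range (h : IsWittSplitting Ω a 𝔨 W 𝔟 Z) {w : V} (hw : w ∈ W) (η : 𝔤) :
    Ω (a η) w = 0 := by
  have : w ∈ Ω.orthogonal (LinearMap.range a) := h.W_sup ▸ Submodule.mem_sup_left hw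
  exact this _ ⟨η, rfl⟩

theorem Ω_W_Z (h : IsWittSplitting Ω a 𝔨 W 𝔟 Z) {w : V} (hw : w ∈ W) {z : V} (hz : z ∈ Z) :
    Ω w z = 0 := by
  have : z ∈ Ω.orthogonal (W ⊔ 𝔟.map a) := h.Z_sup ▸ Submodule.mem_sup_left hz
  exact this _ (Submodule.mem_sup_left hw)

theorem Ω_b_Z (h : IsWittSplitting Ω a 𝔨 W 𝔟 Z) {β : 𝔤} (hβ : β ∈ 𝔟) {z : V} (hz : z ∈ Z) :
    Ω (a β) z = 0 := by
  have : z ∈ Ω.orthogonal (W ⊔ 𝔟.map a) := h.Z_sup ▸ Submodule.mem_sup_left hz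
  exact this _ (Submodule.mem_sup_right ⟨β, hβ, rfl⟩)

/-- The symplectic form in block form, with respect to a Witt splitting. -/
theorem form_add (h : IsWittSplitting Ω a 𝔨 W 𝔟 Z) (ha : IsInfinitesimalAction Ω a 𝔨)
    {w w' z z' : V} {η η' β β' : 𝔤} (hw : w ∈ W) (hw' : w' ∈ W) (hη : η ∈ 𝔨) (hη' : η' ∈ 𝔨)
    (hz : z ∈ Z) (hz' : z' ∈ Z) (hβ : β ∈ 𝔟) (hβ' : β' ∈ 𝔟) :
    Ω (w + a η + z + a β) (w' + a η' + z' + a β')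
      = Ω w w' + Ω (a η) z' - Ω (a η') z + Ω (a β) (a β') := by
  simp only [map_add, LinearMap.add_apply, h.Ω_W_range hw', h.Ω_W_Z hw hz', h.Ω_b_Z hβ hz',
    ha.swap_zero (h.Ω_W_range hw _), ha.swap_zero (h.Ω_W_Z hw' hz),
    ha.swap_zero (h.Ω_b_Z hβ' hz), h.Z_isotropic z hz z' hz', ha.swap z (a η'),
    (ha.mem_iff η').1 hη' _, ha.swap_zero ((ha.mem_iff η).1 hη _)]
  ring

theorem exists_add_eq (h : IsWittSplitting Ω a 𝔨 W 𝔟 Z) (ha : IsInfinitesimalAction Ω a 𝔨)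
    [FiniteDimensional ℝ V] (v : V) :
    ∃ w ∈ W, ∃ η ∈ 𝔨, ∃ z ∈ Z, ∃ β ∈ 𝔟, w + a η + z + a β = v := by
  have hc := (ha.isCompl_orthogonal h.W_disjoint h.W_sup h.b_isCompl).1
  obtain ⟨v₀, hv₀, y, hy, rfl⟩ := Submodule.mem_sup.1
        (hc.sup_eq_top ▸ Submodule.mem_top :
          v ∈ (W ⊔ 𝔟.map a) ⊔ Ω.orthogonal (W ⊔ 𝔟.map a))
  rw [← h.Z_sup] at hy
  obtain ⟨w, hw, _, ⟨β, hβ, rfl⟩, rfl⟩ := Submodule.mem_sup.1 hv₀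
  obtain ⟨z, hz, _, ⟨η, hη, rfl⟩, rfl⟩ := Submodule.mem_sup.1 hy
  exact ⟨w, hw, η, hη, z, hz, β, hβ, by abel⟩

/-- The four summands of a Witt splitting are independent, and `a` is injective on `𝔨` and `𝔟`. -/
theorem eq_zero_of_add_eq_zero (h : IsWittSplitting Ω a 𝔨 W 𝔟 Z)
    (ha : IsInfinitesimalAction Ω a 𝔨) [FiniteDimensional ℝ V] {w z : V} {η β : 𝔤} (hw : w ∈ W)
    (hη : η ∈ 𝔨) (hz : z ∈ Z) (hβ : β ∈ 𝔟) (h0 : w + a η + z + a β = 0) :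
    w = 0 ∧ η = 0 ∧ z = 0 ∧ β = 0 := by
  obtain ⟨hc, -, -⟩ := ha.isCompl_orthogonal h.W_disjoint h.W_sup h.b_isCompl
  have hy : z + a η ∈ Ω.orthogonal (W ⊔ 𝔟.map a) :=
    h.Z_sup ▸ Submodule.add_mem_sup hz ⟨η, hη, rfl⟩
  have hv : w + a β ∈ W ⊔ 𝔟.map a := Submodule.add_mem_sup hw ⟨β, hβ, rfl⟩
  have h1 : w + a β = 0 := by
    apply Submodule.disjoint_def.1 hc.disjoint _ hv
    have : w + a β = -(z + a η) := by
      rw [eq_neg_iff_add_eq_zero, ← h0]; abel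
    rw [this]
    exact Submodule.neg_mem _ hy
  have h2 : z + a η = 0 := by
    calc z + a η = (w + a η + z + a β) - (w + a β) := by abel
      _ = 0 := by rw [h0, h1, sub_zero]
  have hz0 : z = 0 := by
    apply Submodule.disjoint_def.1 h.Z_disjoint _ hz
    rw [eq_neg_of_add_eq_zero_left h2]
    exact Submodule.neg_mem _ ⟨η, hη, rfl⟩
  have hη0 : η = 0 := by
    apply ha.injective
    rw [map_zero, ← h2, hz0, zero_add]
  have hβ0 : β = 0 := by
    refine Submodule.disjoint_def.1 h.b_isCompl.disjoint _ hβ ((ha.mem_iff β).2 fun ζ => ?_)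
    rw [eq_neg_of_add_eq_zero_right h1, map_neg, h.Ω_W_range hw, neg_zero]
  subst hβ0
  exact ⟨by simpa using h1, hη0, hz0, rfl⟩

theorem isInternal (h : IsWittSplitting Ω a 𝔨 W 𝔟 Z) (ha : IsInfinitesimalAction Ω a 𝔨)
    [FiniteDimensional ℝ V] :
    DirectSum.IsInternal (![W, 𝔨.map a, Z, 𝔟.map a] : Fin 4 → Submodule ℝ V) := by
  classical
  constructor
  · rw [injective_iff_map_eq_zero]
    intro f hf
    have hsum : DirectSum.coeAddMonoidHom (![W, 𝔨.map a, Z, 𝔟.map a]) f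
        = ∑ i, ((f i : V)) := by
      rw [DirectSum.coeAddMonoidHom_eq_dfinsuppSum, DFinsupp.sum_eq_sum_fintype _ (fun i => rfl)]
      rfl
    rw [hsum, Fin.sum_univ_four] at hf
    obtain ⟨η, hη, h1⟩ := (f 1).2
    obtain ⟨β, hβ, h3⟩ := (f 3).2
    rw [← h1, ← h3] at hf
    obtain ⟨e0, e1, e2, e3⟩ := h.eq_zero_of_add_eq_zero ha (f 0).2 hη (f 2).2 hβ hf
    ext i
    fin_cases i
    · exact e0
    · simpa [e1] using h1.symm
    · exact e2
    · simpa [e3] using h3.symm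
  · intro v
    obtain ⟨w, hw, η, hη, z, hz, β, hβ, rfl⟩ := h.exists_add_eq ha v
    let A : Fin 4 → Submodule ℝ V := ![W, 𝔨.map a, Z, 𝔟.map a]
    refine ⟨DirectSum.of (fun i => A i) 0 ⟨w, hw⟩ + DirectSum.of (fun i => A i) 1 ⟨a η, η, hη, rfl⟩
      + DirectSum.of (fun i => A i) 2 ⟨z, hz⟩ + DirectSum.of (fun i => A i) 3 ⟨a β, β, hβ, rfl⟩, ?_⟩
    simp only [map_add]
    erw [DirectSum.coeAddMonoidHom_of, DirectSum.coeAddMonoidHom_of,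
      DirectSum.coeAddMonoidHom_of, DirectSum.coeAddMonoidHom_of]

/-- The normal form of a Witt splitting: `W` is identified with the reduced space `X` through `T`,
`a 𝔨` with `𝔨`, `Z` with the dual of `𝔨` through `Ω`, and `a 𝔟` with the orbit directions `O`. -/
theorem exists_equiv (h : IsWittSplitting Ω a 𝔨 W 𝔟 Z) (ha : IsInfinitesimalAction Ω a 𝔨)
    [FiniteDimensional ℝ V] (T : V →ₗ[ℝ] X) (ΩX : LinearMap.BilinForm ℝ X)
    (hX : ∀ x, (∀ y, ΩX x y = 0) → x = 0)
    (hT : ∀ u ∈ Ω.orthogonal (LinearMap.range a), ∀ v ∈ Ω.orthogonal (LinearMap.range a),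
      ΩX (T u) (T v) = Ω u v)
    (hTs : ∀ x, ∃ v ∈ Ω.orthogonal (LinearMap.range a), T v = x)
    (d : 𝔤 →ₗ[ℝ] O) (hd : Function.Surjective d) (hdk : ∀ η, d η = 0 ↔ η ∈ 𝔨)
    (jk : V →ₗ[ℝ] Dual ℝ 𝔨) (hjk : ∀ v (η : 𝔨), jk v η = Ω (a η) v) :
    ∃ Φ : V ≃ₗ[ℝ] X × 𝔨 × Dual ℝ 𝔨 × O,
      (∀ w ∈ W, Φ w = (T w, 0, 0, 0)) ∧ (∀ η : 𝔨, Φ (a η) = (0, η, 0, 0)) ∧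
      (∀ z ∈ Z, Φ z = (0, 0, jk z, 0)) ∧ (∀ β ∈ 𝔟, Φ (a β) = (0, 0, 0, d β)) := by
  obtain ⟨-, hW, -⟩ := ha.isCompl_orthogonal h.W_disjoint h.W_sup h.b_isCompl
  have hWK : ∀ w ∈ W, w ∈ Ω.orthogonal (LinearMap.range a) := fun w hw =>
    h.W_sup ▸ Submodule.mem_sup_left hw
  have hTk : ∀ η ∈ 𝔨, T (a η) = 0 := by
    intro η hη
    have hη' := ha.map_le ⟨η, hη, rfl⟩
    apply hX
    intro y
    obtain ⟨v, hv, rfl⟩ := hTs y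
    rw [hT _ hη' _ hv]
    exact hv _ ⟨η, rfl⟩
  -- the four identifications
  let eW : W ≃ₗ[ℝ] X := LinearEquiv.ofBijective (T.domRestrict W) (by
    constructor
    · rw [injective_iff_map_eq_zero]
      rintro ⟨w, hw⟩ h0
      have h0' : T w = 0 := h0
      have : w = 0 := hW w hw fun w' hw' => by
        rw [← hT _ (hWK w' hw') _ (hWK w hw), h0', map_zero]
      simpa using this
    · intro x
      obtain ⟨v, hv, rfl⟩ := hTs x
      rw [← h.W_sup] at hv
      obtain ⟨w, hw, _, ⟨η, hη, rfl⟩, rfl⟩ := Submodule.mem_sup.1 hv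
      exact ⟨⟨w, hw⟩, by simp [hTk η hη]⟩)
  let eZ : Z ≃ₗ[ℝ] Dual ℝ 𝔨 := LinearEquiv.ofBijective (jk.domRestrict Z) (by
    constructor
    · rw [injective_iff_map_eq_zero]
      rintro ⟨z, hz⟩ h0
      have h0' : ∀ η ∈ 𝔨, Ω (a η) z = 0 := fun η hη => by
        have := LinearMap.congr_fun h0 ⟨η, hη⟩
        rw [LinearMap.domRestrict_apply, hjk] at this
        simpa using this
      have : z = 0 := by
        apply ha.nondegenerate.2
        intro v
        obtain ⟨w, hw, η, hη, z', hz', β, hβ, rfl⟩ := h.exists_add_eq ha v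
        simp [h.Ω_W_Z hw hz, h0' η hη, h.Z_isotropic z' hz' z hz, h.Ω_b_Z hβ hz]
      simpa using this
    · intro ν
      -- represent an extension of `ν` by a vector `v`; then the `Z`-component of `v` will do
      obtain ⟨g, hg⟩ := LinearMap.exists_leftInverse_of_injective (a ∘ₗ 𝔨.subtype)
        (LinearMap.ker_eq_bot.2 (ha.injective.comp Subtype.val_injective))
      obtain ⟨v, hv⟩ := (Ω.toDual ha.nondegenerate).surjective (-(ν ∘ₗ g))
      have hv' : ∀ η : 𝔨, Ω (a η) v = ν η := by
        intro η
        have h1 := LinearMap.congr_fun hv (a η)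
        have h2 : g (a η) = η := LinearMap.congr_fun hg η
        rw [LinearMap.BilinForm.toDual_def, LinearMap.neg_apply, LinearMap.comp_apply, h2] at h1
        rw [ha.swap, h1, neg_neg]
      obtain ⟨w, hw, η', hη', z, hz, β, hβ, rfl⟩ := h.exists_add_eq ha v
      refine ⟨⟨z, hz⟩, ?_⟩
      ext η
      rw [LinearMap.domRestrict_apply, hjk, ← hv']
      simp [h.Ω_W_range hw, (ha.mem_iff η').1 hη', ha.swap_zero ((ha.mem_iff _).1 η.2 β)])
  let eb : 𝔟 ≃ₗ[ℝ] O := LinearEquiv.ofBijective (d.domRestrict 𝔟) (by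
    constructor
    · rw [injective_iff_map_eq_zero]
      rintro ⟨β, hβ⟩ h0
      have : β = 0 := Submodule.disjoint_def.1 h.b_isCompl.disjoint _ hβ ((hdk β).1 h0)
      simpa using this
    · intro o
      obtain ⟨ζ, rfl⟩ := hd o
      obtain ⟨β, hβ, κ, hκ, rfl⟩ := Submodule.mem_sup.1
        (h.b_isCompl.sup_eq_top ▸ Submodule.mem_top : ζ ∈ 𝔟 ⊔ 𝔨)
      exact ⟨⟨β, hβ⟩, by simp [(hdk κ).2 hκ]⟩)
  let ψ : (W × 𝔨 × Z × 𝔟) →ₗ[ℝ] V := W.subtype.coprod ((a ∘ₗ 𝔨.subtype).coprod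
    (Z.subtype.coprod (a ∘ₗ 𝔟.subtype)))
  have hψ : ∀ w η z β, ψ (w, η, z, β) = w + a η + z + a β := by
    intro w η z β
    simp [ψ, add_assoc]
  let e : (W × 𝔨 × Z × 𝔟) ≃ₗ[ℝ] V := LinearEquiv.ofBijective ψ (by
    constructor
    · rw [injective_iff_map_eq_zero]
      rintro ⟨w, η, z, β⟩ h0
      rw [hψ] at h0
      obtain ⟨e0, e1, e2, e3⟩ := h.eq_zero_of_add_eq_zero ha w.2 η.2 z.2 β.2 h0
      exact Prod.ext (Subtype.ext e0) (Prod.ext (Subtype.ext e1)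
        (Prod.ext (Subtype.ext e2) (Subtype.ext e3)))
    · intro v
      obtain ⟨w, hw, η, hη, z, hz, β, hβ, rfl⟩ := h.exists_add_eq ha v
      exact ⟨(⟨w, hw⟩, ⟨η, hη⟩, ⟨z, hz⟩, ⟨β, hβ⟩), hψ _ _ _ _⟩)
  have he : ∀ (w : W) (η : 𝔨) (z : Z) (β : 𝔟), e.symm (w + a η + z + a β)
      = (w, η, z, β) := fun w η z β => by
    rw [LinearEquiv.symm_apply_eq]
    exact (hψ w η z β).symm
  refine ⟨e.symm.trans (eW.prodCongr ((LinearEquiv.refl ℝ 𝔨).prodCongr (eZ.prodCongr eb))),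
    ?_, ?_, ?_, ?_⟩
  · intro w hw
    have := he ⟨w, hw⟩ 0 0 0
    simp at this
    simp only [LinearEquiv.trans_apply, this, LinearEquiv.prodCongr_apply, map_zero]
    rfl
  · intro η
    have := he 0 η 0 0
    simp at this
    simp [this]
  · intro z hz
    have := he 0 0 ⟨z, hz⟩ 0
    simp at this
    simp only [LinearEquiv.trans_apply, this, LinearEquiv.prodCongr_apply, map_zero]
    rfl
  · intro β hβ
    have := he 0 0 0 ⟨β, hβ⟩
    simp at this
    simp only [LinearEquiv.trans_apply, this, LinearEquiv.prodCongr_apply, map_zero]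
    rfl

end IsWittSplitting

end WittDecomposition

/-! ### The linearization in block form -/

section NormalForm

open Module

variable {V : Type*} [AddCommGroup V] [Module ℝ V] [FiniteDimensional ℝ V]
  {𝔤 : Type*} [AddCommGroup 𝔤] [Module ℝ 𝔤]
  {X : Type*} [AddCommGroup X] [Module ℝ X]
  {O : Type*} [AddCommGroup O] [Module ℝ O]

/-- The linearization at a formally stable relative equilibrium, as linear algebra: `A` is the
linearized Hamiltonian vector field on the tangent space `V`, and `a` the infinitesimal action;
on the range of `a` it acts through `D` (which stands for `ad ξ`), and on the reduced space `X`,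
onto which `T` maps the kernel of the derivative of the momentum, through `AX`. -/
structure IsLinearizedEquilibrium (Ω : LinearMap.BilinForm ℝ V) (a : 𝔤 →ₗ[ℝ] V)
    (𝔨 : Submodule ℝ 𝔤) (A : End ℝ V) (D : End ℝ 𝔤) (T : V →ₗ[ℝ] X)
    (ΩX : LinearMap.BilinForm ℝ X) (AX : End ℝ X) : Prop
    extends IsInfinitesimalAction Ω a 𝔨 where
  skew : ∀ u v, Ω (A u) v = -Ω u (A v)
  A_apply : ∀ η, A (a η) = -a (D η)
  D_semisimple : D.IsSemisimple
  nondegenerate_X : ∀ x, (∀ y, ΩX x y = 0) → x = 0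
  alt_X : ΩX.IsAlt
  pullback : ∀ u ∈ Ω.orthogonal (LinearMap.range a), ∀ v ∈ Ω.orthogonal (LinearMap.range a),
      ΩX (T u) (T v) = Ω u v
  surjective : ∀ x, ∃ v ∈ Ω.orthogonal (LinearMap.range a), T v = x
  T_A : ∀ v ∈ Ω.orthogonal (LinearMap.range a), T (A v) = AX (T v)
  AX_semisimple : AX.IsSemisimple

namespace IsLinearizedEquilibrium

variable {Ω : LinearMap.BilinForm ℝ V} {a : 𝔤 →ₗ[ℝ] V} {𝔨 : Submodule ℝ 𝔤} {A S N : End ℝ V}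
  {D : End ℝ 𝔤} {T : V →ₗ[ℝ] X} {ΩX : LinearMap.BilinForm ℝ X} {AX : End ℝ X}
  {W : Submodule ℝ V} {𝔟 : Submodule ℝ 𝔤} {Z : Submodule ℝ V}

omit [FiniteDimensional ℝ V] in
theorem A_mem (h : IsLinearizedEquilibrium Ω a 𝔨 A D T ΩX AX) {v : V}
    (hv : v ∈ Ω.orthogonal (LinearMap.range a)) : A v ∈ Ω.orthogonal (LinearMap.range a) := by
  rintro _ ⟨η, rfl⟩
  have h1 : Ω (a (D η)) v = 0 := hv _ ⟨_, rfl⟩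
  have h2 := h.skew (a η) v
  rw [h.A_apply, map_neg, LinearMap.neg_apply, h1] at h2
  change Ω (a η) (A v) = 0
  linarith

omit [FiniteDimensional ℝ V] in
theorem D_mem (h : IsLinearizedEquilibrium Ω a 𝔨 A D T ΩX AX) {η : 𝔤} (hη : η ∈ 𝔨) :
    D η ∈ 𝔨 := by
  rw [h.mem_iff] at hη ⊢
  intro ζ
  have h1 := hη (D ζ)
  have h2 := h.skew (a ζ) (a η)
  rw [h.A_apply, h.A_apply, map_neg, map_neg, LinearMap.neg_apply, h1] at h2
  linarith

/-- `A` is semisimple on the range of `a`, where it acts as `-D`, so `N` vanishes there. -/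
theorem N_apply (h : IsLinearizedEquilibrium Ω a 𝔨 A D T ΩX AX)
    (hSN : IsJordanDecomposition A S N) (η : 𝔤) : N (a η) = 0 := by
  obtain ⟨g, hg⟩ := LinearMap.exists_leftInverse_of_injective a
    (LinearMap.ker_eq_bot.2 h.injective)
  have hg' : ∀ ζ, g (a ζ) = ζ := fun ζ => LinearMap.congr_fun hg ζ
  have hinv : ∀ v ∈ LinearMap.range a, A v ∈ LinearMap.range a := by
    rintro _ ⟨ζ, rfl⟩
    rw [h.A_apply]
    exact Submodule.neg_mem _ ⟨_, rfl⟩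
  have : FiniteDimensional ℝ 𝔤 := FiniteDimensional.of_injective a h.injective
  have h1 : g (N (a η)) = 0 := by
    apply hSN.map_nilpotent_eq_zero hinv g (Module.End.isSemisimple_neg.2 h.D_semisimple) _
      ⟨η, rfl⟩
    rintro _ ⟨ζ, rfl⟩
    rw [h.A_apply, map_neg, hg', hg', LinearMap.neg_apply]
  obtain ⟨ζ, hζ⟩ := hSN.nilpotent_mem hinv ⟨η, rfl⟩
  rw [← hζ, hg'] at h1
  rw [← hζ, h1, map_zero]

theorem S_apply (h : IsLinearizedEquilibrium Ω a 𝔨 A D T ΩX AX)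
    (hSN : IsJordanDecomposition A S N) (η : 𝔤) : S (a η) = -a (D η) := by
  rw [← h.A_apply, hSN.sum, LinearMap.add_apply, h.N_apply hSN, add_zero]

/-- `N` is infinitesimally symplectic and kills the range of `a`, so its values are orthogonal to
that range. -/
theorem N_mem (h : IsLinearizedEquilibrium Ω a 𝔨 A D T ΩX AX)
    (hSN : IsJordanDecomposition A S N) (v : V) : N v ∈ Ω.orthogonal (LinearMap.range a) := by
  rintro _ ⟨η, rfl⟩
  have h1 := (hSN.skew Ω h.nondegenerate h.skew).2 (a η) v
  rw [h.N_apply hSN, map_zero, LinearMap.zero_apply] at h1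
  change Ω (a η) (N v) = 0
  linarith

/-- The kernel of `T` on the orthogonal `K` of the range of `a` is the radical `a 𝔨` of `K`. -/
theorem mem_map_of_T_eq_zero (h : IsLinearizedEquilibrium Ω a 𝔨 A D T ΩX AX) {v : V}
    (hv : v ∈ Ω.orthogonal (LinearMap.range a)) (h0 : T v = 0) : v ∈ 𝔨.map a := by
  have h2 : v ∈ Ω.orthogonal (Ω.orthogonal (LinearMap.range a)) := by
    intro u hu
    change Ω u v = 0
    rw [← h.pullback u hu v hv, h0, map_zero]
  rw [LinearMap.BilinForm.orthogonal_orthogonal h.nondegenerate h.alt.isRefl] at h2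
  obtain ⟨η, rfl⟩ := h2
  exact ⟨η, (h.mem_iff η).2 fun ζ => hv _ ⟨ζ, rfl⟩, rfl⟩

/-- On `K / a 𝔨`, where `K` is the orthogonal of the range of `a`, the map `A` is semisimple, because
`T` identifies it with `AX`. So `N` maps `K` into `a 𝔨`. -/
theorem N_mem_map [FiniteDimensional ℝ X] (h : IsLinearizedEquilibrium Ω a 𝔨 A D T ΩX AX)
    (hSN : IsJordanDecomposition A S N) {v : V}
    (hv : v ∈ Ω.orthogonal (LinearMap.range a)) : N v ∈ 𝔨.map a :=
  h.mem_map_of_T_eq_zero (h.N_mem hSN v)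
    (hSN.map_nilpotent_eq_zero (fun _ => h.A_mem) T h.AX_semisimple h.T_A hv)

/-- `N` maps `V` into the orthogonal of the range of `a`, that into `a 𝔨`, and `a 𝔨` to zero. -/
theorem N_pow_three [FiniteDimensional ℝ X] (h : IsLinearizedEquilibrium Ω a 𝔨 A D T ΩX AX)
    (hSN : IsJordanDecomposition A S N) : N ^ 3 = 0 := by
  ext v
  obtain ⟨η, -, hη⟩ := h.N_mem_map hSN (h.N_mem hSN v)
  change N (N (N v)) = 0
  rw [← hη, h.N_apply hSN]

/-- An `S`-invariant Witt splitting exists for any `D`-invariant complement `𝔟` of `𝔨`. -/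
theorem exists_wittSplitting (h : IsLinearizedEquilibrium Ω a 𝔨 A D T ΩX AX)
    (hSN : IsJordanDecomposition A S N) (hb : IsCompl 𝔟 𝔨) (hbD : ∀ β ∈ 𝔟, D β ∈ 𝔟) :
    ∃ W Z, IsWittSplitting Ω a 𝔨 W 𝔟 Z ∧ (∀ w ∈ W, S w ∈ W) ∧ ∀ z ∈ Z, S z ∈ Z := by
  have hSk : ∀ v ∈ 𝔨.map a, S v ∈ 𝔨.map a := by
    rintro _ ⟨η, hη, rfl⟩
    rw [h.S_apply hSN]
    exact Submodule.neg_mem _ ⟨_, h.D_mem hη, rfl⟩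
  have hSb : ∀ v ∈ 𝔟.map a, S v ∈ 𝔟.map a := by
    rintro _ ⟨η, hη, rfl⟩
    rw [h.S_apply hSN]
    exact Submodule.neg_mem _ ⟨_, hbD _ hη, rfl⟩
  have hSK : ∀ v ∈ Ω.orthogonal (LinearMap.range a), S v ∈ Ω.orthogonal (LinearMap.range a) := by
    intro v hv
    have h1 : S v = A v - N v := by rw [hSN.sum]; simp
    rw [h1]
    exact Submodule.sub_mem _ (h.A_mem hv) (h.N_mem hSN v)
  obtain ⟨C, hSC, hC⟩ := End.isSemisimple_iff.1 hSN.semisimple (𝔨.map a) hSk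
  set K := Ω.orthogonal (LinearMap.range a) with hK
  have hd : Disjoint (C ⊓ K) (𝔨.map a) := (hC.symm.disjoint).mono_left inf_le_left
  have hs : C ⊓ K ⊔ 𝔨.map a = K := by
    rw [sup_comm, ← sup_inf_assoc_of_le C h.map_le, hC.sup_eq_top, top_inf_eq]
  have hSW : ∀ w ∈ C ⊓ K, S w ∈ C ⊓ K := fun w hw => ⟨hSC hw.1, hSK w hw.2⟩
  obtain ⟨Z, hZ, hSZ⟩ := h.exists_lagrangian_complement hd hs hb hSN.semisimple
    (hSN.skew Ω h.nondegenerate h.skew).1 hSk hSW hSb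
  exact ⟨C ⊓ K, Z, hZ, hSW, hSZ⟩

/-- The block forms of `Ω`, `S` and `N` in the model `X × 𝔨 × 𝔨^* × O`. The surjection `d` with kernel
`𝔨` identifies `O` with `𝔤 / 𝔨`, on which `Ω` induces `ks`, and `D` induces `-DO`; `Dk` is the
restriction of `D` to `𝔨`, and `jk` maps a vector to the functional it defines on `a 𝔨` through `Ω`.
The block shape of `N` comes from the filtration `a 𝔨 ≤ (range a)^⊥ ≤ V`; the relations between the
blocks express that `N` is infinitesimally symplectic and commutes with `S`. -/
theorem normal_form [FiniteDimensional ℝ X] (h : IsLinearizedEquilibrium Ω a 𝔨 A D T ΩX AX)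
    (hSN : IsJordanDecomposition A S N) (hW : IsWittSplitting Ω a 𝔨 W 𝔟 Z)
    (hSW : ∀ w ∈ W, S w ∈ W) (hSZ : ∀ z ∈ Z, S z ∈ Z) (hbD : ∀ β ∈ 𝔟, D β ∈ 𝔟)
    (d : 𝔤 →ₗ[ℝ] O) (hd : Function.Surjective d) (hdk : ∀ η, d η = 0 ↔ η ∈ 𝔨)
    (jk : V →ₗ[ℝ] Dual ℝ 𝔨) (hjk : ∀ v (η : 𝔨), jk v η = Ω (a η) v)
    (ks : O → O → ℝ) (hks : ∀ η ζ, ks (d η) (d ζ) = Ω (a η) (a ζ))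
    (Dk : 𝔨 →ₗ[ℝ] 𝔨) (hDk : ∀ η, (Dk η : 𝔤) = D η)
    (DO : O →ₗ[ℝ] O) (hDO : ∀ η, DO (d η) = -d (D η)) :
    ∃ Φ : V ≃ₗ[ℝ] X × 𝔨 × Dual ℝ 𝔨 × O,
      ((∀ w ∈ W, Φ w = (T w, 0, 0, 0)) ∧ (∀ η : 𝔨, Φ (a η) = (0, η, 0, 0)) ∧
      (∀ z ∈ Z, Φ z = (0, 0, jk z, 0)) ∧ (∀ β ∈ 𝔟, Φ (a β) = (0, 0, 0, d β))) ∧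
      (∀ u v : X × 𝔨 × Dual ℝ 𝔨 × O, Ω (Φ.symm u) (Φ.symm v) =
        ΩX u.1 v.1 + v.2.2.1 u.2.1 - u.2.2.1 v.2.1 + ks u.2.2.2 v.2.2.2) ∧
      (∀ x η ν τ, Φ (S (Φ.symm (x, η, ν, τ))) = (AX x, -Dk η, Dk.dualMap ν, DO τ)) ∧
      ∃ (N13 : Dual ℝ 𝔨 →ₗ[ℝ] X) (N21 : X →ₗ[ℝ] 𝔨) (N23 : Dual ℝ 𝔨 →ₗ[ℝ] 𝔨),
        (∀ x η ν τ, Φ (N (Φ.symm (x, η, ν, τ))) = (N13 ν, N21 x + N23 ν, 0, 0)) ∧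
        (∀ x ν, ν (N21 x) = -(N13.dualMap (ΩX x)) ν) ∧
        (∀ ν ν' : Dual ℝ 𝔨, ν' (N23 ν) = ν (N23 ν')) ∧
        AX ∘ₗ N13 = -(N13 ∘ₗ (-Dk.dualMap)) ∧
        N21 ∘ₗ AX = -(Dk ∘ₗ N21) ∧
        Dk ∘ₗ N23 = N23 ∘ₗ (-Dk.dualMap) := by
  have ha := h.toIsInfinitesimalAction
  have hWK : ∀ w ∈ W, w ∈ Ω.orthogonal (LinearMap.range a) := fun w hw =>
    hW.W_sup ▸ Submodule.mem_sup_left hw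
  obtain ⟨Φ, hΦW, hΦk, hΦZ, hΦb⟩ := hW.exists_equiv ha T ΩX h.nondegenerate_X h.pullback
    h.surjective d hd hdk jk hjk
  have hrep : ∀ x η ν τ, ∃ w ∈ W, ∃ z ∈ Z, ∃ β ∈ 𝔟,
      Φ.symm (x, η, ν, τ) = w + a η + z + a β ∧ T w = x ∧ jk z = ν ∧ d β = τ := by
    intro x η ν τ
    obtain ⟨w, hw, η', hη', z, hz, β, hβ, hsum⟩ := hW.exists_add_eq ha (Φ.symm (x, η, ν, τ))
    have h1 := congrArg Φ hsum
    rw [LinearEquiv.apply_symm_apply, map_add, map_add, map_add, hΦW w hw, hΦk ⟨η', hη'⟩,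
      hΦZ z hz, hΦb β hβ] at h1
    simp only [Prod.mk_add_mk, add_zero, zero_add, Prod.mk.injEq] at h1
    obtain ⟨h1, h2, h3, h4⟩ := h1
    refine ⟨w, hw, z, hz, β, hβ, ?_, h1, h3, h4⟩
    rw [← hsum, ← h2]
  have hform : ∀ u v : X × 𝔨 × Dual ℝ 𝔨 × O, Ω (Φ.symm u) (Φ.symm v) =
        ΩX u.1 v.1 + v.2.2.1 u.2.1 - u.2.2.1 v.2.1 + ks u.2.2.2 v.2.2.2 := by
    rintro ⟨x, η, ν, τ⟩ ⟨x', η', ν', τ'⟩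
    obtain ⟨w, hw, z, hz, β, hβ, e, rfl, rfl, rfl⟩ := hrep x η ν τ
    obtain ⟨w', hw', z', hz', β', hβ', e', rfl, rfl, rfl⟩ := hrep x' η' ν' τ'
    rw [e, e', hW.form_add ha hw hw' η.2 η'.2 hz hz' hβ hβ']
    simp only [hjk, hks, h.pullback w (hWK w hw) w' (hWK w' hw')]
  have hSb : ∀ β ∈ 𝔟, Φ (S (a β)) = (0, 0, 0, DO (d β)) := by
    intro β hβ
    rw [h.S_apply hSN, map_neg, hΦb _ (hbD β hβ), hDO]
    simp
  have hSk : ∀ η : 𝔨, Φ (S (a η)) = (0, -Dk η, 0, 0) := by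
    intro η
    rw [h.S_apply hSN, map_neg, ← hDk, hΦk]
    simp
  have hTS : ∀ w ∈ W, T (S w) = AX (T w) := by
    intro w hw
    have h1 : S w = A w - N w := by rw [hSN.sum]; simp
    rw [h1, map_sub, h.T_A w (hWK w hw),
      hSN.map_nilpotent_eq_zero (fun _ => h.A_mem) T h.AX_semisimple h.T_A (hWK w hw), sub_zero]
  have hjS : ∀ z, jk (S z) = Dk.dualMap (jk z) := by
    intro z
    ext η
    rw [LinearMap.dualMap_apply, hjk, hjk, hDk]
    have h1 := (hSN.skew Ω h.nondegenerate h.skew).1 (a η) z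
    rw [h.S_apply hSN, map_neg, LinearMap.neg_apply] at h1
    linarith
  have hS : ∀ x η ν τ, Φ (S (Φ.symm (x, η, ν, τ))) = (AX x, -Dk η, Dk.dualMap ν, DO τ) := by
    intro x η ν τ
    obtain ⟨w, hw, z, hz, β, hβ, e, rfl, rfl, rfl⟩ := hrep x η ν τ
    rw [e]
    simp only [map_add]
    rw [hΦW _ (hSW w hw), hSk, hΦZ _ (hSZ z hz), hSb β hβ, hTS w hw, hjS]
    simp
  -- `N` in the model, applied to each of the four summands
  let M : End ℝ (X × 𝔨 × Dual ℝ 𝔨 × O) := Φ.toLinearMap ∘ₗ N ∘ₗ Φ.symm.toLinearMap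
  have hMx : ∀ x, M (x, 0, 0, 0) = (0, (M (x, 0, 0, 0)).2.1, 0, 0) := by
    intro x
    obtain ⟨v, hv, rfl⟩ := h.surjective x
    rw [← hW.W_sup] at hv
    obtain ⟨w, hw, _, ⟨η, hη, rfl⟩, rfl⟩ := Submodule.mem_sup.1 hv
    obtain ⟨η', hη', e⟩ := h.N_mem_map hSN (hWK w hw)
    have hT0 : T (a η) = 0 := by
      apply h.nondegenerate_X
      intro y
      obtain ⟨u, hu, rfl⟩ := h.surjective y
      rw [h.pullback _ (ha.map_le ⟨η, hη, rfl⟩) u hu]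
      exact hu _ ⟨η, rfl⟩
    have h1 : M (T (w + a η), 0, 0, 0) = (0, ⟨η', hη'⟩, 0, 0) := by
      rw [map_add, hT0, add_zero, ← hΦW w hw]
      simp only [M, LinearMap.comp_apply, LinearEquiv.coe_coe, LinearEquiv.symm_apply_apply]
      rw [← e, ← hΦk]
    rw [h1]
  have hMη : ∀ η, M (0, η, 0, 0) = 0 := by
    intro η
    rw [← hΦk]
    simp [M, h.N_apply hSN]
  have hMτ : ∀ τ, M (0, 0, 0, τ) = 0 := by
    intro τ
    obtain ⟨w, hw, z, hz, β, hβ, e, hx, hν, rfl⟩ := hrep 0 0 0 τ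
    rw [← hΦb β hβ]
    simp [M, h.N_apply hSN]
  have hMν : ∀ ν, M (0, 0, ν, 0) = ((M (0, 0, ν, 0)).1, (M (0, 0, ν, 0)).2.1, 0, 0) := by
    intro ν
    have hmem := h.N_mem hSN (Φ.symm (0, 0, ν, 0))
    rw [← hW.W_sup] at hmem
    obtain ⟨w, hw, _, ⟨η, hη, rfl⟩, e⟩ := Submodule.mem_sup.1 hmem
    have h1 : M (0, 0, ν, 0) = (T w, ⟨η, hη⟩, 0, 0) := by
      simp only [M, LinearMap.comp_apply, LinearEquiv.coe_coe]
      rw [← e, map_add, hΦW w hw, hΦk ⟨η, hη⟩]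
      simp
    rw [h1]
  let N13 : Dual ℝ 𝔨 →ₗ[ℝ] X := LinearMap.fst ℝ _ _ ∘ₗ M ∘ₗ LinearMap.inr ℝ _ _ ∘ₗ
    LinearMap.inr ℝ _ _ ∘ₗ LinearMap.inl ℝ _ _
  let N21 : X →ₗ[ℝ] 𝔨 := LinearMap.fst ℝ _ _ ∘ₗ LinearMap.snd ℝ _ _ ∘ₗ M ∘ₗ LinearMap.inl ℝ _ _
  let N23 : Dual ℝ 𝔨 →ₗ[ℝ] 𝔨 := LinearMap.fst ℝ _ _ ∘ₗ LinearMap.snd ℝ _ _ ∘ₗ M ∘ₗ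
    LinearMap.inr ℝ _ _ ∘ₗ LinearMap.inr ℝ _ _ ∘ₗ LinearMap.inl ℝ _ _
  have hN : ∀ x η ν τ, Φ (N (Φ.symm (x, η, ν, τ))) = (N13 ν, N21 x + N23 ν, 0, 0) := by
    intro x η ν τ
    have e : ((x, η, ν, τ) : X × 𝔨 × Dual ℝ 𝔨 × O)
        = (x, 0, 0, 0) + (0, η, 0, 0) + (0, 0, ν, 0) + (0, 0, 0, τ) := by simp
    change M (x, η, ν, τ) = _
    rw [e, map_add, map_add, map_add, hMx, hMη, hMν, hMτ]
    simp [N13, N21, N23]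
    rfl
  have hN' : ∀ x η ν τ, N (Φ.symm (x, η, ν, τ)) = Φ.symm (N13 ν, N21 x + N23 ν, 0, 0) := by
    intro x η ν τ
    rw [← hN x η ν τ, LinearEquiv.symm_apply_apply]
  have hS' : ∀ x η ν τ, S (Φ.symm (x, η, ν, τ)) = Φ.symm (AX x, -Dk η, Dk.dualMap ν, DO τ) := by
    intro x η ν τ
    rw [← hS x η ν τ, LinearEquiv.symm_apply_apply]
  have hks0 : ∀ τ, ks 0 τ = 0 := by
    intro τ
    obtain ⟨ζ, rfl⟩ := hd τ
    rw [← map_zero d, hks]; simp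
  have hks0' : ∀ τ, ks τ 0 = 0 := by
    intro τ
    obtain ⟨ζ, rfl⟩ := hd τ
    rw [← map_zero d, hks]; simp
  have hNskew := (hSN.skew Ω h.nondegenerate h.skew).2
  have hcomm : ∀ v, S (N v) = N (S v) := fun v => LinearMap.congr_fun hSN.commute.eq v
  -- `S N = N S`, evaluated on the first and on the third summand
  have hc1 : ∀ x, (AX (N13 0), -Dk (N21 x + N23 0), Dk.dualMap 0, DO 0)
      = (N13 (Dk.dualMap 0), N21 (AX x) + N23 (Dk.dualMap 0), (0 : Dual ℝ 𝔨), (0 : O)) := by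
    intro x
    apply Φ.symm.injective
    have := hcomm (Φ.symm (x, 0, 0, 0))
    rwa [hN', hS', hS', hN'] at this
  have hc3 : ∀ ν, (AX (N13 ν), -Dk (N21 0 + N23 ν), Dk.dualMap 0, DO 0)
      = (N13 (Dk.dualMap ν), N21 (AX 0) + N23 (Dk.dualMap ν), (0 : Dual ℝ 𝔨), (0 : O)) := by
    intro ν
    apply Φ.symm.injective
    have := hcomm (Φ.symm (0, 0, ν, 0))
    rwa [hN', hS', hS', hN'] at this
  refine ⟨Φ, ⟨hΦW, hΦk, hΦZ, hΦb⟩, hform, hS, N13, N21, N23, hN, ?_, ?_, ?_, ?_, ?_⟩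
  · intro x ν
    have h1 := hNskew (Φ.symm (0, 0, ν, 0)) (Φ.symm (x, 0, 0, 0))
    rw [hN', hN', hform, hform] at h1
    simp [hks0] at h1
    rw [LinearMap.dualMap_apply, LinearMap.IsAlt.neg h.alt_X, h1]
  · intro ν ν'
    have h1 := hNskew (Φ.symm (0, 0, ν, 0)) (Φ.symm (0, 0, ν', 0))
    rw [hN', hN', hform, hform] at h1
    simpa [hks0] using h1
  · ext1 ν
    have := (Prod.mk.inj (hc3 ν)).1
    simpa using this
  · ext1 x
    have := (Prod.mk.inj (Prod.mk.inj (hc1 x)).2).1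
    simp only [map_zero, add_zero] at this
    rw [LinearMap.comp_apply, ← this]
    rfl
  · ext1 ν
    have := (Prod.mk.inj (Prod.mk.inj (hc3 ν)).2).1
    simp only [map_zero, zero_add] at this
    change Dk (N23 ν) = N23 (-(Dk.dualMap ν))
    rw [map_neg, ← this, neg_neg]

end IsLinearizedEquilibrium

end NormalForm

/-! ### Tangent maps in charts -/

section TangentMaps

variable {E : Type*} [NormedAddCommGroup E] [NormedSpace ℝ E]
  {M : Type*} [TopologicalSpace M] [ChartedSpace E M]
  {F : Type*} [NormedAddCommGroup F] [NormedSpace ℝ F]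
  {N : Type*} [TopologicalSpace N] [ChartedSpace F N]
  {E' : Type*} [NormedAddCommGroup E'] [NormedSpace ℝ E']
  {M' : Type*} [TopologicalSpace M'] [ChartedSpace E' M']

theorem tangentAt_comp {g : N → M'} {f : M → N} {x : M}
    (hg : MDifferentiableAt 𝓘(ℝ, F) 𝓘(ℝ, E') g (f x))
    (hf : MDifferentiableAt 𝓘(ℝ, E) 𝓘(ℝ, F) f x) :
    (tangentAt (g ∘ f) x : E →L[ℝ] E')
      = (tangentAt g (f x) : F →L[ℝ] E').comp (tangentAt f x : E →L[ℝ] F) :=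
  mfderiv_comp x hg hf

theorem tangentAt_eq_fderiv (f : E → F) (x : E) : tangentAt f x = fderiv ℝ f x :=
  mfderiv_eq_fderiv

theorem tangentAt_congr {f g : M → N} {x : M} (h : f =ᶠ[𝓝 x] g) :
    (tangentAt f x : E →L[ℝ] F) = tangentAt g x :=
  h.mfderiv_eq

theorem tangentAt_const (y : N) (x : M) : (tangentAt (fun _ : M => y) x : E →L[ℝ] F) = 0 :=
  mfderiv_const

theorem tangentAt_id (x : M) : (tangentAt (id : M → M) x : E →L[ℝ] E) = .id ℝ E :=
  mfderiv_id

variable [IsManifold 𝓘(ℝ, E) 1 M] [IsManifold 𝓘(ℝ, F) 1 N]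

theorem tangentAt_extChartAt_self (x : M) :
    (tangentAt (extChartAt 𝓘(ℝ, E) x) x : E →L[ℝ] E) = .id ℝ E :=
  mfderiv_extChartAt_self

theorem tangentAt_extChartAt_symm_self (x : M) :
    (tangentAt (extChartAt 𝓘(ℝ, E) x).symm (extChartAt 𝓘(ℝ, E) x x) : E →L[ℝ] E) = .id ℝ E := by
  have h := mfderivWithin_range_extChartAt_symm (I := 𝓘(ℝ, E)) (x := x)
  rw [modelWithCornersSelf_coe, Set.range_id, mfderivWithin_univ] at h
  exact h

theorem mdifferentiableAt_extChartAt_symm {x : M} {y : E}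
    (hy : y ∈ (extChartAt 𝓘(ℝ, E) x).target) :
    MDifferentiableAt 𝓘(ℝ, E) 𝓘(ℝ, E) (extChartAt 𝓘(ℝ, E) x).symm y := by
  have h := mdifferentiableWithinAt_extChartAt_symm hy
  rwa [modelWithCornersSelf_coe, Set.range_id, mdifferentiableWithinAt_univ] at h

theorem mdifferentiableAt_extChartAt' {x y : M} (hy : y ∈ (extChartAt 𝓘(ℝ, E) x).source) :
    MDifferentiableAt 𝓘(ℝ, E) 𝓘(ℝ, E) (extChartAt 𝓘(ℝ, E) x) y :=
  mdifferentiableAt_extChartAt (by rwa [extChartAt_source] at hy)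

theorem tangentAt_extChartAt_comp_symm {x : M} {y : E}
    (hy : y ∈ (extChartAt 𝓘(ℝ, E) x).target) :
    (tangentAt (extChartAt 𝓘(ℝ, E) x) ((extChartAt 𝓘(ℝ, E) x).symm y) : E →L[ℝ] E).comp
      (tangentAt (extChartAt 𝓘(ℝ, E) x).symm y) = .id ℝ E := by
  have h := mfderiv_extChartAt_comp_mfderivWithin_extChartAt_symm hy
  rw [modelWithCornersSelf_coe, Set.range_id, mfderivWithin_univ] at h
  exact h

theorem tangentAt_symm_comp_extChartAt {x : M} {y : E}
    (hy : y ∈ (extChartAt 𝓘(ℝ, E) x).target) :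
    (tangentAt (extChartAt 𝓘(ℝ, E) x).symm y : E →L[ℝ] E).comp
      (tangentAt (extChartAt 𝓘(ℝ, E) x) ((extChartAt 𝓘(ℝ, E) x).symm y)) = .id ℝ E := by
  have h := mfderivWithin_extChartAt_symm_comp_mfderiv_extChartAt hy
  rw [modelWithCornersSelf_coe, Set.range_id, mfderivWithin_univ] at h
  exact h

/-- The tangent map of `f` at `x` is the derivative of its expression in the preferred charts. -/
theorem tangentAt_eq_fderiv_chart {f : M → N} {x : M} {y : N} (hxy : f x = y)
    (hf : MDifferentiableAt 𝓘(ℝ, E) 𝓘(ℝ, F) f x) :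
    (tangentAt f x : E →L[ℝ] F) = fderiv ℝ
      (extChartAt 𝓘(ℝ, F) y ∘ f ∘ (extChartAt 𝓘(ℝ, E) x).symm) (extChartAt 𝓘(ℝ, E) x x) := by
  subst hxy
  have h1 : (extChartAt 𝓘(ℝ, E) x).symm (extChartAt 𝓘(ℝ, E) x x) = x := extChartAt_to_inv x
  have h2 : MDifferentiableAt 𝓘(ℝ, E) 𝓘(ℝ, E) (extChartAt 𝓘(ℝ, E) x).symm
    (extChartAt 𝓘(ℝ, E) x x) := mdifferentiableAt_extChartAt_symm (mem_extChartAt_target x)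
  have h3 : MDifferentiableAt 𝓘(ℝ, F) 𝓘(ℝ, F) (extChartAt 𝓘(ℝ, F) (f x)) (f x) :=
    mdifferentiableAt_extChartAt' (mem_extChartAt_source _)
  have h4 : MDifferentiableAt 𝓘(ℝ, E) 𝓘(ℝ, F) f
    ((extChartAt 𝓘(ℝ, E) x).symm (extChartAt 𝓘(ℝ, E) x x)) := by rwa [h1]
  rw [← tangentAt_eq_fderiv, tangentAt_comp (by simpa [h1] using h3) (h4.comp _ h2),
    tangentAt_comp h4 h2, tangentAt_extChartAt_symm_self]
  simp only [Function.comp_apply, h1]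
  rw [tangentAt_extChartAt_self]
  ext; simp

/-- The derivative of a vector-valued function, read in the preferred chart at `x`. -/
theorem fderiv_comp_extChartAt_symm {f : M → E'} {x : M} {y : E}
    (hy : y ∈ (extChartAt 𝓘(ℝ, E) x).target)
    (hf : MDifferentiableAt 𝓘(ℝ, E) 𝓘(ℝ, E') f ((extChartAt 𝓘(ℝ, E) x).symm y)) :
    fderiv ℝ (f ∘ (extChartAt 𝓘(ℝ, E) x).symm) y
      = (tangentAt f ((extChartAt 𝓘(ℝ, E) x).symm y) : E →L[ℝ] E').comp
        (tangentAt (extChartAt 𝓘(ℝ, E) x).symm y) := by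
  rw [← tangentAt_eq_fderiv, tangentAt_comp hf (mdifferentiableAt_extChartAt_symm hy)]

omit [IsManifold 𝓘(ℝ, E) 1 M] [IsManifold 𝓘(ℝ, F) 1 N] in
/-- The expression of a `C^n` map in the preferred charts is `C^n`. -/
theorem contDiffAt_chart {n : ℕ∞ω} [IsManifold 𝓘(ℝ, E) n M] [IsManifold 𝓘(ℝ, F) n N]
    {f : M → N} {x : M} {y : N} (hxy : f x = y)
    (hf : ContMDiffAt 𝓘(ℝ, E) 𝓘(ℝ, F) n f x) :
    ContDiffAt ℝ n (extChartAt 𝓘(ℝ, F) y ∘ f ∘ (extChartAt 𝓘(ℝ, E) x).symm)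
      (extChartAt 𝓘(ℝ, E) x x) := by
  subst hxy
  have h := (contMDiffAt_iff.1 hf).2
  rwa [modelWithCornersSelf_coe, Set.range_id, contDiffWithinAt_univ] at h

omit [IsManifold 𝓘(ℝ, E) 1 M] in
theorem contDiffAt_comp_extChartAt_symm {n : ℕ∞ω} [IsManifold 𝓘(ℝ, E) n M] {f : M → F} {x : M}
    {y : E} (hy : y ∈ (extChartAt 𝓘(ℝ, E) x).target)
    (hf : ContMDiffAt 𝓘(ℝ, E) 𝓘(ℝ, F) n f ((extChartAt 𝓘(ℝ, E) x).symm y)) :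
    ContDiffAt ℝ n (f ∘ (extChartAt 𝓘(ℝ, E) x).symm) y := by
  have h1 := (contMDiffOn_extChartAt_symm (I := 𝓘(ℝ, E)) (n := n) x).contMDiffAt
    ((isOpen_extChartAt_target x).mem_nhds hy)
  exact (hf.comp y h1).contDiffAt

/-- A vector-valued map is differentiable at `x` if its expression in the preferred chart is. The
derivatives agree, because the preferred chart at `x` has the identity as its derivative at `x`. -/
theorem hasMFDerivAt_of_chart {f : M → F} {x : M} {L : E →L[ℝ] F}
    (h : HasFDerivAt (f ∘ (extChartAt 𝓘(ℝ, E) x).symm) L (extChartAt 𝓘(ℝ, E) x x)) :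
    HasMFDerivAt 𝓘(ℝ, E) 𝓘(ℝ, F) f x L := by
  have h1 : HasMFDerivAt 𝓘(ℝ, E) 𝓘(ℝ, E) (extChartAt 𝓘(ℝ, E) x) x
      (ContinuousLinearMap.id ℝ E) := by
    have := (mdifferentiableAt_extChartAt' (E := E) (mem_extChartAt_source x)).hasMFDerivAt
    rwa [mfderiv_extChartAt_self] at this
  have h2 := h.hasMFDerivAt.comp x h1
  have h3 : ((f ∘ (extChartAt 𝓘(ℝ, E) x).symm) ∘ (extChartAt 𝓘(ℝ, E) x)) =ᶠ[𝓝 x] f := by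
    filter_upwards [extChartAt_source_mem_nhds (I := 𝓘(ℝ, E)) x] with y hy
    exact congrArg f ((extChartAt 𝓘(ℝ, E) x).left_inv hy)
  exact h2.congr_of_eventuallyEq h3.symm

end TangentMaps

/-! ### The adjoint action and the Lie bracket -/

section LieGroups

variable {EG : Type*} [NormedAddCommGroup EG] [NormedSpace ℝ EG]
  {G : Type*} [TopologicalSpace G] [ChartedSpace EG G] [Group G] [LieGroup 𝓘(ℝ, EG) ∞ G]

theorem two_le_infty : (2 : ℕ∞ω) ≤ ∞ := ENat.LEInfty.out

theorem one_add_one_le_infty : (1 : ℕ∞ω) + 1 ≤ ∞ := by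
  rw [one_add_one_eq_two]; exact two_le_infty

theorem mdifferentiableAt_mul_left (g h : G) :
    MDifferentiableAt 𝓘(ℝ, EG) 𝓘(ℝ, EG) (fun x : G => g * x) h :=
  (contMDiff_mul_left (I := 𝓘(ℝ, EG)) (n := ∞)).mdifferentiableAt (by simp)

theorem mdifferentiableAt_mul_right (g h : G) :
    MDifferentiableAt 𝓘(ℝ, EG) 𝓘(ℝ, EG) (fun x : G => x * g) h :=
  (contMDiff_mul_right (I := 𝓘(ℝ, EG)) (n := ∞)).mdifferentiableAt (by simp)

theorem mdifferentiableAt_conj (g h : G) :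
    MDifferentiableAt 𝓘(ℝ, EG) 𝓘(ℝ, EG) (fun x : G => g * x * g⁻¹) h :=
  (mdifferentiableAt_mul_right (EG := EG) g⁻¹ (g * h)).comp h (mdifferentiableAt_mul_left g h)

/-- Right translation carries `Ad_g` to left translation. -/
theorem tangentAt_mul_right_comp_Ad (g : G) :
    (tangentAt (fun x : G => x * g) 1 : EG →L[ℝ] EG).comp (Ad g)
      = tangentAt (fun x : G => g * x) 1 := by
  have h1 : g * 1 * g⁻¹ = 1 := by group
  have h2 : (fun x : G => g * x) = (fun x => x * g) ∘ (fun x => g * x * g⁻¹) := by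
    ext x; simp
  rw [h2, tangentAt_comp (mdifferentiableAt_mul_right _ _) (mdifferentiableAt_conj _ _)]
  simp only [h1]
  rfl

variable (G) in
/-- The multiplication of `G` read in the preferred chart at `1`. -/
noncomputable def chartMul (z : EG × EG) : EG :=
  extChartAt 𝓘(ℝ, EG) (1 : G)
    ((extChartAt 𝓘(ℝ, EG) (1 : G)).symm z.1 * (extChartAt 𝓘(ℝ, EG) (1 : G)).symm z.2)

variable (G) in
theorem contDiffAt_chartMul : ContDiffAt ℝ ∞ (chartMul (EG := EG) G)
    (extChartAt 𝓘(ℝ, EG) (1 : G) 1, extChartAt 𝓘(ℝ, EG) (1 : G) 1) := by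
  set e := extChartAt 𝓘(ℝ, EG) (1 : G) 1 with he
  have h1 : (extChartAt 𝓘(ℝ, EG) (1 : G)).symm e = 1 := extChartAt_to_inv 1
  have hs : ContMDiffAt 𝓘(ℝ, EG) 𝓘(ℝ, EG) ∞ (extChartAt 𝓘(ℝ, EG) (1 : G)).symm e :=
    (contMDiffOn_extChartAt_symm (I := 𝓘(ℝ, EG)) (n := ∞) (1 : G)).contMDiffAt
      ((isOpen_extChartAt_target _).mem_nhds (mem_extChartAt_target _))
  have hf : ContMDiffAt 𝓘(ℝ, EG × EG) 𝓘(ℝ, EG) ∞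
      (fun z : EG × EG => (extChartAt 𝓘(ℝ, EG) (1 : G)).symm z.1) (e, e) :=
    ContMDiffAt.comp (e, e) hs (contDiff_fst.contMDiff.contMDiffAt)
  have hg : ContMDiffAt 𝓘(ℝ, EG × EG) 𝓘(ℝ, EG) ∞
      (fun z : EG × EG => (extChartAt 𝓘(ℝ, EG) (1 : G)).symm z.2) (e, e) :=
    ContMDiffAt.comp (e, e) hs (contDiff_snd.contMDiff.contMDiffAt)
  have hc : ContMDiffAt 𝓘(ℝ, EG) 𝓘(ℝ, EG) ∞ (extChartAt 𝓘(ℝ, EG) (1 : G))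
      ((extChartAt 𝓘(ℝ, EG) (1 : G)).symm e * (extChartAt 𝓘(ℝ, EG) (1 : G)).symm e) := by
    rw [h1, mul_one]
    exact contMDiffAt_extChartAt
  exact (ContMDiffAt.comp (e, e) hc (hf.mul hg)).contDiffAt

/-- A map `f : G → G`, read in the chart at `1`, and the tangent map of `f` at `1`. -/
theorem fderiv_chart_one {f : G → G} (hf : MDifferentiableAt 𝓘(ℝ, EG) 𝓘(ℝ, EG) f 1)
    (h1 : f 1 ∈ (extChartAt 𝓘(ℝ, EG) (1 : G)).source) :
    fderiv ℝ (extChartAt 𝓘(ℝ, EG) (1 : G) ∘ f ∘ (extChartAt 𝓘(ℝ, EG) (1 : G)).symm)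
      (extChartAt 𝓘(ℝ, EG) (1 : G) 1)
    = (tangentAt (extChartAt 𝓘(ℝ, EG) (1 : G)) (f 1) : EG →L[ℝ] EG).comp
      (tangentAt f 1 : EG →L[ℝ] EG) := by
  have h0 : (extChartAt 𝓘(ℝ, EG) (1 : G)).symm (extChartAt 𝓘(ℝ, EG) (1 : G) 1) = 1 :=
    extChartAt_to_inv 1
  rw [← Function.comp_assoc, fderiv_comp_extChartAt_symm (mem_extChartAt_target _),
    tangentAt_extChartAt_symm_self, h0, ContinuousLinearMap.comp_id, tangentAt_comp _ hf]
  · exact mdifferentiableAt_extChartAt' h1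
  · rw [h0]
    exact (mdifferentiableAt_extChartAt' (E := EG) h1).comp _ hf

/-- The partial derivatives of the multiplication, read in the chart at `1`, are the derivatives of
the right and left translations. -/
theorem eventually_fderiv_chartMul :
    ∀ᶠ x in 𝓝 (extChartAt 𝓘(ℝ, EG) (1 : G) 1),
      (fderiv ℝ (chartMul (EG := EG) G) (extChartAt 𝓘(ℝ, EG) (1 : G) 1, x)).comp
          (ContinuousLinearMap.inl ℝ EG EG)
        = (tangentAt (extChartAt 𝓘(ℝ, EG) (1 : G)) ((extChartAt 𝓘(ℝ, EG) (1 : G)).symm x) :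
            EG →L[ℝ] EG).comp
          (tangentAt (fun y : G => y * (extChartAt 𝓘(ℝ, EG) (1 : G)).symm x) 1) ∧
      (fderiv ℝ (chartMul (EG := EG) G) (x, extChartAt 𝓘(ℝ, EG) (1 : G) 1)).comp
          (ContinuousLinearMap.inr ℝ EG EG)
        = (tangentAt (extChartAt 𝓘(ℝ, EG) (1 : G)) ((extChartAt 𝓘(ℝ, EG) (1 : G)).symm x) :
            EG →L[ℝ] EG).comp
          (tangentAt (fun y : G => (extChartAt 𝓘(ℝ, EG) (1 : G)).symm x * y) 1) := by
  set φ := extChartAt 𝓘(ℝ, EG) (1 : G) with hφ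
  set e := φ 1 with he
  have hd : ∀ᶠ z in 𝓝 (e, e), DifferentiableAt ℝ (chartMul (EG := EG) G) z :=
    ((contDiffAt_chartMul (EG := EG) G).of_le (m := 1) (by simp)).eventually (by simp) |>.mono
      fun z hz => hz.differentiableAt (by simp)
  have hl : ∀ᶠ x in 𝓝 e, DifferentiableAt ℝ (chartMul (EG := EG) G) (e, x) :=
    (Continuous.tendsto (by fun_prop : Continuous fun x : EG => (e, x)) e).eventually hd
  have hr : ∀ᶠ x in 𝓝 e, DifferentiableAt ℝ (chartMul (EG := EG) G) (x, e) :=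
    (Continuous.tendsto (by fun_prop : Continuous fun x : EG => (x, e)) e).eventually hd
  have ht : φ.target ∈ 𝓝 e :=
    (isOpen_extChartAt_target _).mem_nhds (mem_extChartAt_target _)
  filter_upwards [hl, hr, ht] with x hx hx' hxt
  have hsrc : φ.symm x ∈ φ.source := φ.map_target hxt
  constructor
  · have h1 := fderiv_chart_one (mdifferentiableAt_mul_right (EG := EG) (φ.symm x) 1)
      (by rwa [one_mul])
    rw [one_mul] at h1
    rw [← h1]
    have h2 : HasFDerivAt (fun y : EG => (y, x)) (ContinuousLinearMap.inl ℝ EG EG) e :=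
      hasFDerivAt_prodMk_left e x
    exact (hx.hasFDerivAt.comp e h2).fderiv.symm
  · have h1 := fderiv_chart_one (mdifferentiableAt_mul_left (EG := EG) (φ.symm x) 1)
      (by rwa [mul_one])
    rw [mul_one] at h1
    rw [← h1]
    have h2 : HasFDerivAt (fun y : EG => (x, y)) (ContinuousLinearMap.inr ℝ EG EG) e :=
      hasFDerivAt_prodMk_right x e
    exact (hx'.hasFDerivAt.comp e h2).fderiv.symm

/-- In the chart at `1`, the bracket is the skew part of the mixed second derivative of the
multiplication. -/
theorem bracket_eq_fderiv_chartMul [FiniteDimensional ℝ EG] (ζ η : EG) :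
    bracket G ζ η
      = fderiv ℝ (fun x => (fderiv ℝ (chartMul (EG := EG) G)
          (x, extChartAt 𝓘(ℝ, EG) (1 : G) 1)).comp (ContinuousLinearMap.inr ℝ EG EG))
          (extChartAt 𝓘(ℝ, EG) (1 : G) 1) ζ η
        - fderiv ℝ (fun x => (fderiv ℝ (chartMul (EG := EG) G)
          (x, extChartAt 𝓘(ℝ, EG) (1 : G) 1)).comp (ContinuousLinearMap.inr ℝ EG EG))
          (extChartAt 𝓘(ℝ, EG) (1 : G) 1) η ζ := by
  set φ := extChartAt 𝓘(ℝ, EG) (1 : G) with hφ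
  set e := φ 1 with he
  set R : EG → EG →L[ℝ] EG := fun x => (fderiv ℝ (chartMul (EG := EG) G) (x, e)).comp
    (ContinuousLinearMap.inr ℝ EG EG) with hR
  have hRd : DifferentiableAt ℝ R e := by
    have h1 : DifferentiableAt ℝ (fderiv ℝ (chartMul (EG := EG) G)) (e, e) :=
      ((contDiffAt_chartMul (EG := EG) G).fderiv_right (m := 1) one_add_one_le_infty).differentiableAt
        (by simp)
    have h2 : DifferentiableAt ℝ (fun x : EG => (x, e)) e := by fun_prop
    have h3 : DifferentiableAt ℝ (fun x : EG => fderiv ℝ (chartMul (EG := EG) G) (x, e)) e :=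
      DifferentiableAt.comp (g := fderiv ℝ (chartMul (EG := EG) G)) e h1 h2
    exact h3.clm_comp (differentiableAt_const _)
  have ht : φ.target ∈ 𝓝 e :=
    (isOpen_extChartAt_target _).mem_nhds (mem_extChartAt_target _)
  -- the left-invariant vector field generated by `v`, in the chart
  have key : ∀ v : EG, VectorField.mpullbackWithin 𝓘(ℝ, EG) 𝓘(ℝ, EG) φ.symm
      (mulInvariantVectorField (I := 𝓘(ℝ, EG)) (G := G) v) (Set.range 𝓘(ℝ, EG))
      =ᶠ[𝓝 e] fun x => R x v := by
    intro v
    filter_upwards [eventually_fderiv_chartMul (EG := EG) (G := G), ht] with x hx hxt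
    rw [VectorField.mpullbackWithin_apply]
    have h1 := tangentAt_extChartAt_comp_symm (E := EG) hxt
    have h2 := tangentAt_symm_comp_extChartAt (E := EG) hxt
    have h3 : (mfderiv 𝓘(ℝ, EG) 𝓘(ℝ, EG) φ.symm x).inverse
        = (mfderiv 𝓘(ℝ, EG) 𝓘(ℝ, EG) φ (φ.symm x)) :=
      ContinuousLinearMap.inverse_eq h2 h1
    rw [modelWithCornersSelf_coe, Set.range_id, mfderivWithin_univ, h3]
    exact (congrArg (fun T : EG →L[ℝ] EG => T v) hx.2).symm
  have hbr : bracket G ζ η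
      = (ContinuousLinearMap.inverse (tangentAt φ (1 : G) : EG →L[ℝ] EG) :
        EG →L[ℝ] EG) (VectorField.lieBracketWithin (E := EG) ℝ
        (VectorField.mpullbackWithin 𝓘(ℝ, EG) 𝓘(ℝ, EG) φ.symm
          (mulInvariantVectorField (I := 𝓘(ℝ, EG)) (G := G) ζ) (Set.range 𝓘(ℝ, EG)))
        (VectorField.mpullbackWithin 𝓘(ℝ, EG) 𝓘(ℝ, EG) φ.symm
          (mulInvariantVectorField (I := 𝓘(ℝ, EG)) (G := G) η) (Set.range 𝓘(ℝ, EG)))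
        (φ.symm ⁻¹' Set.univ ∩ Set.range 𝓘(ℝ, EG)) e) := rfl
  rw [hbr, (key ζ).lieBracketWithin_vectorField_eq_nhds (key η), hφ, tangentAt_extChartAt_self,
    ContinuousLinearMap.inverse_id, modelWithCornersSelf_coe, Set.range_id, Set.preimage_univ,
    Set.univ_inter, VectorField.lieBracketWithin_univ, VectorField.lieBracket_eq]
  have hfd : ∀ v w : EG, fderiv ℝ (fun x => R x v) e w = fderiv ℝ R e w v := by
    intro v w
    rw [fderiv_clm_apply hRd (differentiableAt_const v)]
    simp
  have hRe : ∀ v : EG, R e v = v := by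
    intro v
    have h1 := (eventually_fderiv_chartMul (EG := EG) (G := G)).self_of_nhds.2
    have h0 : φ.symm e = 1 := extChartAt_to_inv 1
    rw [hR]
    simp only
    rw [h1, h0]
    have h2 : (fun y : G => 1 * y) = id := by ext; simp
    rw [h2, tangentAt_id, tangentAt_extChartAt_self]
    rfl
  simp only [hfd, hRe]
  rfl

/-- `Ad` is differentiable at `1`, with derivative `ad`. In the chart at `1`, let `R x` and `L x` be
the derivatives at `1` of the left and of the right translation by the point with coordinates `x`;
then `L x ∘ Ad = R x`, and both sides are differentiated at `1`. -/
theorem exists_hasMFDerivAt_Ad [FiniteDimensional ℝ EG] :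
    ∃ D : EG →L[ℝ] EG →L[ℝ] EG,
      HasMFDerivAt 𝓘(ℝ, EG) 𝓘(ℝ, EG →L[ℝ] EG) (fun g : G => (Ad g : EG →L[ℝ] EG)) 1 D ∧
      ∀ ζ η, D ζ η = bracket G ζ η := by
  have : CompleteSpace EG := FiniteDimensional.complete ℝ EG
  set φ := extChartAt 𝓘(ℝ, EG) (1 : G) with hφ
  set e := φ 1 with he
  set m := chartMul (EG := EG) G with hm
  set R : EG → EG →L[ℝ] EG := fun x => (fderiv ℝ m (x, e)).comp
    (ContinuousLinearMap.inr ℝ EG EG) with hR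
  set L : EG → EG →L[ℝ] EG := fun x => (fderiv ℝ m (e, x)).comp
    (ContinuousLinearMap.inl ℝ EG EG) with hL
  set F : EG → EG →L[ℝ] EG := fun x => Ad (φ.symm x) with hF
  have h0 : φ.symm e = 1 := extChartAt_to_inv 1
  have hm2 : HasFDerivAt (fderiv ℝ m) (fderiv ℝ (fderiv ℝ m) (e, e)) (e, e) :=
      (((contDiffAt_chartMul (EG := EG) G).fderiv_right (m := 1) one_add_one_le_infty).differentiableAt
        (by simp)).hasFDerivAt
  have hsymm : IsSymmSndFDerivAt ℝ m (e, e) :=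
    (contDiffAt_chartMul (EG := EG) G).isSymmSndFDerivAt
      (by rw [minSmoothness_of_isRCLikeNormedField]; exact two_le_infty)
  have hR1 : HasFDerivAt (fun x : EG => fderiv ℝ m (x, e))
      ((fderiv ℝ (fderiv ℝ m) (e, e)).comp (ContinuousLinearMap.inl ℝ EG EG)) e :=
    HasFDerivAt.comp (g := fderiv ℝ m) e hm2 (hasFDerivAt_prodMk_left e e)
  have hL1 : HasFDerivAt (fun x : EG => fderiv ℝ m (e, x))
      ((fderiv ℝ (fderiv ℝ m) (e, e)).comp (ContinuousLinearMap.inr ℝ EG EG)) e :=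
    HasFDerivAt.comp (g := fderiv ℝ m) e hm2 (hasFDerivAt_prodMk_right e e)
  have hRd : DifferentiableAt ℝ R e := hR1.differentiableAt.clm_comp (differentiableAt_const _)
  have hLd : DifferentiableAt ℝ L e := hL1.differentiableAt.clm_comp (differentiableAt_const _)
  have hR' : ∀ v w, fderiv ℝ R e v w = fderiv ℝ (fderiv ℝ m) (e, e) (v, 0) (0, w) := by
    intro v w
    rw [(hR1.clm_comp (hasFDerivAt_const _ _)).fderiv]
    simp
  have hL' : ∀ v w, fderiv ℝ L e v w = fderiv ℝ (fderiv ℝ m) (e, e) (0, v) (w, 0) := by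
    intro v w
    rw [(hL1.clm_comp (hasFDerivAt_const _ _)).fderiv]
    simp
  have hLe : L e = .id ℝ EG := by
    have h1 := (eventually_fderiv_chartMul (EG := EG) (G := G)).self_of_nhds.1
    rw [hL]
    simp only
    rw [h1, h0]
    have h2 : (fun y : G => y * 1) = id := by ext; simp
    rw [h2, tangentAt_id, tangentAt_extChartAt_self]
    rfl
  -- `Ad = L⁻¹ R` near the identity
  have hLF : (fun x => (L x).comp (F x)) =ᶠ[𝓝 e] R := by
    filter_upwards [eventually_fderiv_chartMul (EG := EG) (G := G)] with x hx
    rw [hL, hR, hF]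
    simp only [hm]
    rw [hx.1, hx.2, ContinuousLinearMap.comp_assoc, tangentAt_mul_right_comp_Ad]
  have hinv : ∀ᶠ x in 𝓝 e, (L x).IsInvertible := by
    have h1 : Set.range ((↑) : (EG ≃L[ℝ] EG) → EG →L[ℝ] EG) ∈ 𝓝 (L e) := by
      rw [hLe]
      exact ContinuousLinearEquiv.nhds (ContinuousLinearEquiv.refl ℝ EG)
    exact hLd.continuousAt.eventually h1
  have hFeq : F =ᶠ[𝓝 e] fun x => (L x).inverse.comp (R x) := by
    filter_upwards [hLF, hinv] with x hx hx'
    rw [← hx, ← ContinuousLinearMap.comp_assoc, hx'.inverse_comp_self,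
      ContinuousLinearMap.id_comp]
  have hFd : DifferentiableAt ℝ F e := by
    refine DifferentiableAt.congr_of_eventuallyEq ?_ hFeq
    refine DifferentiableAt.clm_comp ?_ hRd
    have h1 : DifferentiableAt ℝ (ContinuousLinearMap.inverse : (EG →L[ℝ] EG) → EG →L[ℝ] EG)
        (L e) := by
      rw [hLe]
      exact (contDiffAt_map_inverse (n := 1) (ContinuousLinearEquiv.refl ℝ EG)).differentiableAt
        (by simp)
    exact h1.comp e hLd
  refine ⟨fderiv ℝ F e, hasMFDerivAt_of_chart hFd.hasFDerivAt, ?_⟩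
  intro ζ η
  have h1 : fderiv ℝ R e ζ = (L e).comp (fderiv ℝ F e ζ) + (fderiv ℝ L e ζ).comp (F e) := by
    rw [← hLF.fderiv_eq,
      (hLd.hasFDerivAt.clm_comp hFd.hasFDerivAt).fderiv]
    simp
  have hFe : F e = .id ℝ EG := by
    simp only [hF, h0, Ad_one]
  have h2 := congrArg (fun T : EG →L[ℝ] EG => T η) h1
  simp only [hLe, hFe, ContinuousLinearMap.id_comp, ContinuousLinearMap.comp_id,
    add_apply] at h2
  rw [bracket_eq_fderiv_chartMul]
  change _ = fderiv ℝ R e ζ η - fderiv ℝ R e η ζ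
  rw [h2, hL', hR', hsymm.eq (0, ζ) (η, 0)]
  abel

end LieGroups

/-! ### The coadjoint action and its isotropy algebras -/

section TangentMaps

variable {E : Type*} [NormedAddCommGroup E] [NormedSpace ℝ E]
  {M : Type*} [TopologicalSpace M] [ChartedSpace E M] [IsManifold 𝓘(ℝ, E) 1 M]
  {F : Type*} [NormedAddCommGroup F] [NormedSpace ℝ F]

theorem hasFDerivAt_chart {f : M → F} {x : M} {L : E →L[ℝ] F}
    (h : HasMFDerivAt 𝓘(ℝ, E) 𝓘(ℝ, F) f x L) :
    HasFDerivAt (f ∘ (extChartAt 𝓘(ℝ, E) x).symm) L (extChartAt 𝓘(ℝ, E) x x) := by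
  have h0 : (extChartAt 𝓘(ℝ, E) x).symm (extChartAt 𝓘(ℝ, E) x x) = x := extChartAt_to_inv x
  have h1 : MDifferentiableAt 𝓘(ℝ, E) 𝓘(ℝ, F) f
      ((extChartAt 𝓘(ℝ, E) x).symm (extChartAt 𝓘(ℝ, E) x x)) := by
    rw [h0]; exact h.mdifferentiableAt
  have h2 := h1.comp _ (mdifferentiableAt_extChartAt_symm (mem_extChartAt_target x))
  have h3 := h2.differentiableAt.hasFDerivAt
  rw [fderiv_comp_extChartAt_symm (mem_extChartAt_target x) h1, h0,
    tangentAt_extChartAt_symm_self, ContinuousLinearMap.comp_id] at h3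
  have h4 : (tangentAt f x : E →L[ℝ] F) = L := h.mfderiv
  rwa [h4] at h3

end TangentMaps

section LieGroups

variable {EG : Type*} [NormedAddCommGroup EG] [NormedSpace ℝ EG]
  {G : Type*} [TopologicalSpace G] [ChartedSpace EG G] [Group G]

theorem CoAd_one (μ : EG →L[ℝ] ℝ) : CoAd (1 : G) μ = μ := by
  simp [CoAd, Ad_one]

variable [LieGroup 𝓘(ℝ, EG) ∞ G]

theorem CoAd_mul (g h : G) (μ : EG →L[ℝ] ℝ) : CoAd (g * h) μ = CoAd g (CoAd h μ) := by
  simp only [CoAd]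
  rw [mul_inv_rev, Ad_mul, ContinuousLinearMap.comp_assoc]

theorem Ad_inv_comp (g : G) : (Ad g⁻¹ : EG →L[ℝ] EG).comp (Ad g) = .id ℝ EG := by
  rw [← Ad_mul, inv_mul_cancel, Ad_one]

theorem Ad_comp_inv (g : G) : (Ad g : EG →L[ℝ] EG).comp (Ad g⁻¹) = .id ℝ EG := by
  rw [← Ad_mul, mul_inv_cancel, Ad_one]

theorem mdifferentiableAt_inv (g : G) :
    MDifferentiableAt 𝓘(ℝ, EG) 𝓘(ℝ, EG) (fun x : G => x⁻¹) g :=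
  (contMDiff_inv 𝓘(ℝ, EG) ∞).mdifferentiableAt (by simp)

variable [FiniteDimensional ℝ EG]

theorem mdifferentiable_Ad :
    MDifferentiable 𝓘(ℝ, EG) 𝓘(ℝ, EG →L[ℝ] EG) (fun g : G => (Ad g : EG →L[ℝ] EG)) := by
  intro g
  obtain ⟨D, hD, -⟩ := exists_hasMFDerivAt_Ad (EG := EG) (G := G)
  have h1 : (fun h : G => (Ad h : EG →L[ℝ] EG)) =
      (fun T : EG →L[ℝ] EG => (Ad g).comp T) ∘ (fun h : G => (Ad h : EG →L[ℝ] EG)) ∘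
        (fun h => g⁻¹ * h) := by
    ext1 h
    simp only [Function.comp_apply]
    rw [← Ad_mul, mul_inv_cancel_left]
  rw [h1]
  have h2 : MDifferentiableAt 𝓘(ℝ, EG) 𝓘(ℝ, EG →L[ℝ] EG) (fun g : G => (Ad g : EG →L[ℝ] EG))
      (g⁻¹ * g) := by
    rw [inv_mul_cancel]; exact hD.mdifferentiableAt
  have h3 : Differentiable ℝ (fun T : EG →L[ℝ] EG => (Ad g : EG →L[ℝ] EG).comp T) := by
    intro T
    exact (differentiableAt_const _).clm_comp differentiableAt_id
  exact (h3.mdifferentiable _).comp g (h2.comp g (mdifferentiableAt_mul_left g⁻¹ g))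

theorem mdifferentiable_CoAd (μ : EG →L[ℝ] ℝ) :
    MDifferentiable 𝓘(ℝ, EG) 𝓘(ℝ, EG →L[ℝ] ℝ) (fun g : G => CoAd g μ) := by
  intro g
  have h3 : Differentiable ℝ (fun T : EG →L[ℝ] EG => μ.comp T) := by
    intro T
    exact (differentiableAt_const _).clm_comp differentiableAt_id
  exact (h3.mdifferentiable _).comp g
    ((mdifferentiable_Ad (g⁻¹)).comp g (mdifferentiableAt_inv g))

/-- The velocity of the coadjoint orbit of `μ` in the direction `ζ` is `coad_ζ μ = -μ ∘ ad_ζ`. -/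
theorem tangentAt_CoAd_apply (μ : EG →L[ℝ] ℝ) (ζ η : EG) :
    (tangentAt (fun g : G => CoAd g μ) 1 : EG →L[ℝ] EG →L[ℝ] ℝ) ζ η = -μ (bracket G ζ η) := by
  obtain ⟨D, hD, hDb⟩ := exists_hasMFDerivAt_Ad (EG := EG) (G := G)
  have h1 := hasFDerivAt_chart hD
  have h2 := hasFDerivAt_chart (mdifferentiable_CoAd (G := G) μ 1).hasMFDerivAt
  have h3 := h2.clm_comp h1
  -- `CoAd_g μ ∘ Ad_g` does not depend on `g`
  have h4 : (fun x => ((fun g : G => CoAd g μ) ∘ (extChartAt 𝓘(ℝ, EG) (1 : G)).symm) x ∘SL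
      ((fun g : G => (Ad g : EG →L[ℝ] EG)) ∘ (extChartAt 𝓘(ℝ, EG) (1 : G)).symm) x)
      = fun _ => μ := by
    ext1 x
    simp only [Function.comp_apply, CoAd]
    rw [ContinuousLinearMap.comp_assoc, Ad_inv_comp, ContinuousLinearMap.comp_id]
  have h0 : (extChartAt 𝓘(ℝ, EG) (1 : G)).symm (extChartAt 𝓘(ℝ, EG) (1 : G) 1) = 1 :=
    extChartAt_to_inv 1
  rw [h4] at h3
  have h5 := congrArg (fun T : EG →L[ℝ] EG →L[ℝ] ℝ => T ζ η)
    (h3.unique (hasFDerivAt_const μ _))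
  simp only [Function.comp_apply, h0, Ad_one, CoAd_one] at h5
  have h6 : μ (D ζ η) + (tangentAt (fun g : G => CoAd g μ) 1 : EG →L[ℝ] EG →L[ℝ] ℝ) ζ η = 0 := by
    simp only [add_apply, ContinuousLinearMap.comp_apply, ContinuousLinearMap.compL_apply] at h5
    exact h5
  rw [hDb] at h6
  linarith

/-- The derivative of the orbit map `h ↦ CoAd_h μ` at `g` is obtained from the one at `1` by
`CoAd_g`. -/
theorem tangentAt_CoAd_mul_left (μ : EG →L[ℝ] ℝ) (g : G) :
    (tangentAt (fun h : G => CoAd h μ) g : EG →L[ℝ] EG →L[ℝ] ℝ).comp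
        (tangentAt (fun h : G => g * h) 1 : EG →L[ℝ] EG)
      = (((ContinuousLinearMap.compL ℝ EG EG ℝ).flip (Ad g⁻¹)) :
          (EG →L[ℝ] ℝ) →L[ℝ] (EG →L[ℝ] ℝ)).comp
        (tangentAt (fun h : G => CoAd h μ) 1 : EG →L[ℝ] EG →L[ℝ] ℝ) := by
  have h1 : (fun h : G => CoAd h μ) ∘ (fun h => g * h)
      = ((ContinuousLinearMap.compL ℝ EG EG ℝ).flip (Ad g⁻¹)) ∘ (fun h : G => CoAd h μ) := by
    ext1 h
    simp only [Function.comp_apply, CoAd_mul]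
    rfl
  have h2 : MDifferentiableAt 𝓘(ℝ, EG) 𝓘(ℝ, EG →L[ℝ] ℝ) (fun h : G => CoAd h μ) (g * 1) :=
    mdifferentiable_CoAd μ _
  have h3 := tangentAt_comp h2 (mdifferentiableAt_mul_left g 1)
  have h4 := tangentAt_comp (g := ((ContinuousLinearMap.compL ℝ EG EG ℝ).flip (Ad g⁻¹)))
    (ContinuousLinearMap.mdifferentiableAt _) (mdifferentiable_CoAd (G := G) μ 1)
  rw [h1, h4, tangentAt_eq_fderiv, ContinuousLinearMap.fderiv] at h3
  simp only [mul_one] at h3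
  exact h3.symm

/-- `𝔤_μ` is the kernel of `ζ ↦ coad_ζ μ`: the integral curves of a left-invariant vector field in
the kernel stay in `G_μ`. -/
theorem mem_isotropyAlgebra_iff (μ : EG →L[ℝ] ℝ) (η : EG) :
    η ∈ isotropyAlgebra G μ ↔
      (tangentAt (fun g : G => CoAd g μ) 1 : EG →L[ℝ] EG →L[ℝ] ℝ) η = 0 := by
  have : CompleteSpace EG := FiniteDimensional.complete ℝ EG
  constructor
  · intro hη
    refine Submodule.span_induction (p := fun η _ =>
      (tangentAt (fun g : G => CoAd g μ) 1 : EG →L[ℝ] EG →L[ℝ] ℝ) η = 0) ?_ ?_ ?_ ?_ hη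
    · rintro _ ⟨γ, h0, hγ, hd, rfl⟩
      have h1 : (fun g : G => CoAd g μ) ∘ γ = fun _ => μ := funext fun t => hγ t
      have h2 := tangentAt_comp (g := fun g : G => CoAd g μ) (x := (0 : ℝ))
        (mdifferentiable_CoAd μ (γ 0)) hd
      rw [h1, tangentAt_const, h0] at h2
      exact (congrArg (fun T : ℝ →L[ℝ] EG →L[ℝ] ℝ => T 1) h2).symm
    · simp
    · intro x y _ _ hx hy
      rw [map_add, hx, hy, add_zero]
    · intro c x _ hx
      rw [map_smul, hx, smul_zero]
  · intro hη
    have hv : ContMDiffAt 𝓘(ℝ, EG) 𝓘(ℝ, EG).tangent 1 (fun g : G =>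
        (⟨g, mulInvariantVectorField (I := 𝓘(ℝ, EG)) η g⟩ : TangentBundle 𝓘(ℝ, EG) G)) 1 :=
      (contMDiffAt_mulInvariantVectorField (I := 𝓘(ℝ, EG)) (G := G) η).of_le
        (by rw [minSmoothness_of_isRCLikeNormedField]; exact one_le_two)
    obtain ⟨γ, hγ0, hγ⟩ := exists_isMIntegralCurveAt_of_contMDiffAt_boundaryless (t₀ := 0) hv
    obtain ⟨ε, hε, hγε⟩ := Metric.eventually_nhds_iff_ball.1 hγ
    have hd : ∀ t ∈ Metric.ball (0 : ℝ) ε, HasFDerivAt (fun t => CoAd (γ t) μ)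
        (0 : ℝ →L[ℝ] EG →L[ℝ] ℝ) t := by
      intro t ht
      have h1 := (mdifferentiable_CoAd (G := G) μ (γ t)).hasMFDerivAt.comp t (hγε t ht)
      have h2 := h1.hasFDerivAt
      have h3 := congrArg (fun T : EG →L[ℝ] EG →L[ℝ] ℝ => T η)
        (tangentAt_CoAd_mul_left (G := G) μ (γ t))
      simp only [ContinuousLinearMap.comp_apply] at h3
      rw [hη, map_zero] at h3
      have h4 : (tangentAt (fun h : G => CoAd h μ) (γ t) : EG →L[ℝ] EG →L[ℝ] ℝ).comp
          ((1 : ℝ →L[ℝ] ℝ).smulRight ((tangentAt (fun h : G => γ t * h) 1 : EG →L[ℝ] EG) η))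
          = 0 := by
        ext1
        simp only [ContinuousLinearMap.comp_apply, ContinuousLinearMap.smulRight_apply,
          one_apply_eq_self, one_smul]
        exact h3
      rw [← h4]
      exact h2
    have hconst : ∀ t ∈ Metric.ball (0 : ℝ) ε, γ t ∈ isotropyGroup G μ := by
      intro t ht
      have h1 := (convex_ball (0 : ℝ) ε).is_const_of_fderivWithin_eq_zero (𝕜 := ℝ)
        (f := fun t => CoAd (γ t) μ)
        (fun s hs => (hd s hs).differentiableAt.differentiableWithinAt)
        (fun s hs => by
          rw [fderivWithin_of_isOpen Metric.isOpen_ball hs, (hd s hs).fderiv])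
        ht (Metric.mem_ball_self hε)
      simp only [hγ0, CoAd_one] at h1
      exact h1
    classical
    -- off the interval on which `γ` is an integral curve, it is replaced by the constant curve `1`
    apply Submodule.subset_span
    have hcongr : (fun t => if t ∈ Metric.ball (0 : ℝ) ε then γ t else 1) =ᶠ[𝓝 0] γ := by
      filter_upwards [Metric.ball_mem_nhds (0 : ℝ) hε] with t ht
      simp only [ht, if_true]
    have h0 := (hγε 0 (Metric.mem_ball_self hε)).congr_of_eventuallyEq hcongr
    refine ⟨fun t => if t ∈ Metric.ball (0 : ℝ) ε then γ t else 1, ?_, ?_, ?_, ?_⟩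
    · simp [hε, hγ0]
    · intro t
      by_cases ht : t ∈ Metric.ball (0 : ℝ) ε
      · simp only [ht, if_true]
        exact hconst t ht
      · simp only [ht, if_false]
        exact one_mem _
    · exact h0.mdifferentiableAt
    · rw [tangentAt_congr hcongr]
      have h1 : (tangentAt γ 0 : ℝ →L[ℝ] EG) = (1 : ℝ →L[ℝ] ℝ).smulRight
        ((tangentAt (fun h : G => γ 0 * h) 1 : EG →L[ℝ] EG) η) :=
        (hγε 0 (Metric.mem_ball_self hε)).mfderiv
      rw [h1, hγ0]
      have h2 : (fun y : G => 1 * y) = id := by ext; simp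
      rw [h2, tangentAt_id]
      simp

end LieGroups

/-! ### The Lie algebra of a compact group -/

section LieAlgebra

variable {EG : Type*} [NormedAddCommGroup EG] [NormedSpace ℝ EG] [FiniteDimensional ℝ EG]
  {G : Type*} [TopologicalSpace G] [ChartedSpace EG G] [Group G] [LieGroup 𝓘(ℝ, EG) ∞ G]

theorem bracket_skew (ζ η : EG) : bracket G ζ η = -bracket G η ζ :=
  have : CompleteSpace EG := FiniteDimensional.complete ℝ EG
  (lie_skew (L := GroupLieAlgebra 𝓘(ℝ, EG) G) ζ η).symm

theorem bracket_jacobi (ζ η θ : EG) :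
    bracket G ζ (bracket G η θ) = bracket G (bracket G ζ η) θ + bracket G η (bracket G ζ θ) :=
  have : CompleteSpace EG := FiniteDimensional.complete ℝ EG
  leibniz_lie (L₁ := GroupLieAlgebra 𝓘(ℝ, EG) G) (L₂ := GroupLieAlgebra 𝓘(ℝ, EG) G)
    (M := GroupLieAlgebra 𝓘(ℝ, EG) G) ζ η θ

theorem map_bracket_eq_zero {μ : EG →L[ℝ] ℝ} {η : EG} (hη : η ∈ isotropyAlgebra G μ) (ζ : EG) :
    μ (bracket G η ζ) = 0 := by
  have h1 := tangentAt_CoAd_apply (G := G) μ η ζ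
  rw [(mem_isotropyAlgebra_iff μ η).1 hη] at h1
  simpa using h1.symm

/-- `(ad_ξ)^*` maps `coad_η μ` to `-coad_{[ξ, η]} μ` if `ξ ∈ 𝔤_μ`. -/
theorem tangentAt_CoAd_comp_ad {μ : EG →L[ℝ] ℝ} {ξ : EG} (hξ : ξ ∈ isotropyAlgebra G μ) (η : EG) :
    ((tangentAt (fun g : G => CoAd g μ) 1 : EG →L[ℝ] EG →L[ℝ] ℝ) η).comp (ad G ξ)
      = -(tangentAt (fun g : G => CoAd g μ) 1 : EG →L[ℝ] EG →L[ℝ] ℝ) (ad G ξ η) := by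
  ext ζ
  change (tangentAt (fun g : G => CoAd g μ) 1 : EG →L[ℝ] EG →L[ℝ] ℝ) η (bracket G ξ ζ)
    = -(tangentAt (fun g : G => CoAd g μ) 1 : EG →L[ℝ] EG →L[ℝ] ℝ) (bracket G ξ η) ζ
  rw [tangentAt_CoAd_apply, tangentAt_CoAd_apply]
  have h1 := congrArg μ (bracket_jacobi (G := G) ξ η ζ)
  rw [map_bracket_eq_zero hξ, map_add] at h1
  linarith

theorem comp_ad_mem_orbitTangent {μ : EG →L[ℝ] ℝ} {ξ : EG} (hξ : ξ ∈ isotropyAlgebra G μ)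
    {τ : EG →L[ℝ] ℝ} (hτ : τ ∈ orbitTangent G μ) : τ.comp (ad G ξ) ∈ orbitTangent G μ := by
  obtain ⟨η, rfl⟩ := hτ
  refine ⟨-(ad G ξ η), ?_⟩
  rw [map_neg]
  exact (tangentAt_CoAd_comp_ad hξ η).symm

/-- The Kostant–Souriau form does not depend on the choice of representatives of the tangent
vectors. -/
theorem kostantSouriau_apply {μ : EG →L[ℝ] ℝ} {τ τ' : orbitTangent G μ} {η ζ : EG}
    (hτ : (tangentAt (fun g : G => CoAd g μ) 1 : EG →L[ℝ] EG →L[ℝ] ℝ) η = τ)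
    (hτ' : (tangentAt (fun g : G => CoAd g μ) 1 : EG →L[ℝ] EG →L[ℝ] ℝ) ζ = τ') :
    kostantSouriau G μ τ τ' = μ (bracket G η ζ) := by
  have key : ∀ {η η' : EG}, (tangentAt (fun g : G => CoAd g μ) 1 : EG →L[ℝ] EG →L[ℝ] ℝ) η
      = (tangentAt (fun g : G => CoAd g μ) 1 : EG →L[ℝ] EG →L[ℝ] ℝ) η' →
      ∀ θ, μ (bracket G η θ) = μ (bracket G η' θ) := by
    intro η η' h θ
    have := congrArg (fun f : EG →L[ℝ] ℝ => f θ) h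
    simp only [tangentAt_CoAd_apply] at this
    linarith
  unfold kostantSouriau
  have h1 := (LinearMap.mem_range.1 τ.2).choose_spec
  have h2 := (LinearMap.mem_range.1 τ'.2).choose_spec
  rw [key (h1.trans hτ.symm), bracket_skew, map_neg, key (h2.trans hτ'.symm), ← map_neg,
    ← bracket_skew]

theorem Ad_mem_isotropyAlgebra {μ : EG →L[ℝ] ℝ} {g : G} (hg : g ∈ isotropyGroup G μ) {η : EG}
    (hη : η ∈ isotropyAlgebra G μ) : Ad g η ∈ isotropyAlgebra G μ := by
  rw [mem_isotropyAlgebra_iff] at hη ⊢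
  have h1 : (fun h : G => CoAd h μ) ∘ (fun x : G => g * x * g⁻¹)
      = ((ContinuousLinearMap.compL ℝ EG EG ℝ).flip (Ad g⁻¹)) ∘ (fun h : G => CoAd h μ) := by
    ext1 h
    simp only [Function.comp_apply, CoAd_mul]
    rw [show CoAd g⁻¹ μ = μ from (isotropyGroup G μ).inv_mem hg]
    rfl
  have h2 := tangentAt_comp (g := (fun h : G => CoAd h μ)) (mdifferentiable_CoAd (G := G) μ _)
    (mdifferentiableAt_conj (EG := EG) g 1)
  have h3 := tangentAt_comp (g := ((ContinuousLinearMap.compL ℝ EG EG ℝ).flip (Ad g⁻¹)))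
    (ContinuousLinearMap.mdifferentiableAt _) (mdifferentiable_CoAd (G := G) μ 1)
  rw [h1, h3] at h2
  have h4 := congrArg (fun T : EG →L[ℝ] EG →L[ℝ] ℝ => T η) h2
  simp only [ContinuousLinearMap.comp_apply, hη, map_zero, mul_one, mul_inv_cancel] at h4
  exact h4.symm

/-- An `Ad(G_μ)`-invariant subspace is invariant under `ad_ξ` for `ξ ∈ 𝔤_μ`. -/
theorem ad_mem_of_Ad_mem {μ : EG →L[ℝ] ℝ} {𝔟 : Submodule ℝ EG}
    (hb : ∀ g ∈ isotropyGroup G μ, ∀ η ∈ 𝔟, Ad g η ∈ 𝔟) {ξ : EG}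
    (hξ : ξ ∈ isotropyAlgebra G μ) {β : EG} (hβ : β ∈ 𝔟) : ad G ξ β ∈ 𝔟 := by
  obtain ⟨D, hD, hDb⟩ := exists_hasMFDerivAt_Ad (EG := EG) (G := G)
  change bracket G ξ β ∈ 𝔟
  rw [← hDb]
  refine Submodule.span_induction (p := fun ξ _ => D ξ β ∈ 𝔟) ?_ ?_ ?_ ?_ hξ
  · rintro _ ⟨γ, h0, hγ, hd, rfl⟩
    by_contra hx
    obtain ⟨f, hf, hfb⟩ := Submodule.exists_le_ker_of_notMem hx
    apply hf
    rw [← h0] at hD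
    have h1 := (hD.comp (0 : ℝ) hd.hasMFDerivAt).hasFDerivAt
    have h2 := f.toContinuousLinearMap.hasFDerivAt.comp (0 : ℝ)
      (h1.clm_apply (hasFDerivAt_const β (0 : ℝ)))
    have h3 : (f.toContinuousLinearMap ∘ fun t =>
        ((fun g : G => (Ad g : EG →L[ℝ] EG)) ∘ γ) t β) = fun _ => 0 := by
      ext1 t
      exact hfb (hb _ (hγ t) _ hβ)
    rw [h3] at h2
    have h4 := congrArg (fun T : ℝ →L[ℝ] ℝ => T 1) (h2.unique (hasFDerivAt_const 0 _))
    simp only [ContinuousLinearMap.comp_apply, add_apply, zero_apply, map_zero, zero_add] at h4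
    exact h4
  · simp
  · intro x y _ _ hx hy
    rw [map_add]
    exact 𝔟.add_mem hx hy
  · intro c x _ hx
    rw [map_smul]
    exact 𝔟.smul_mem c hx

/-- The adjoint representation of a compact group preserves an inner product: average any inner
product over the group. -/
theorem exists_Ad_invariant_form [T2Space G] [CompactSpace G] :
    ∃ B : LinearMap.BilinForm ℝ EG, (∀ u v, B u v = B v u) ∧ (∀ v, v ≠ 0 → 0 < B v v) ∧
      ∀ (g : G) u v, B (Ad g u) (Ad g v) = B u v := by
  have : IsTopologicalGroup G := topologicalGroup_of_lieGroup 𝓘(ℝ, EG) ∞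
  borelize G
  -- the inverse turns the left invariance of the Haar measure into the invariance of the form
  let f : EG → EG → G → ℝ := fun u v g =>
    inner ℝ (toEuclidean (Ad g⁻¹ u)) (toEuclidean (Ad g⁻¹ v))
  have hAd : Continuous fun g : G => (Ad g⁻¹ : EG →L[ℝ] EG) :=
    (mdifferentiable_Ad (EG := EG) (G := G)).continuous.comp continuous_inv
  have hf : ∀ u v, Continuous (f u v) := by
    intro u v
    have h1 : ∀ u : EG, Continuous fun g : G => toEuclidean (Ad g⁻¹ u : EG) := fun u =>
      toEuclidean.continuous.comp (hAd.clm_apply continuous_const)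
    exact (h1 u).inner (h1 v)
  have hint : ∀ u v, MeasureTheory.Integrable (f u v) MeasureTheory.Measure.haar := fun u v =>
    (hf u v).integrable_of_hasCompactSupport (HasCompactSupport.of_compactSpace _)
  refine ⟨LinearMap.mk₂ ℝ (fun u v => ∫ g, f u v g ∂MeasureTheory.Measure.haar) ?_ ?_ ?_ ?_,
    ?_, ?_, ?_⟩
  · intro u u' v
    rw [← MeasureTheory.integral_add (hint _ _) (hint _ _)]
    simp only [f, map_add, inner_add_left]
  · intro c u v
    rw [smul_eq_mul, ← MeasureTheory.integral_const_mul]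
    simp only [f, map_smul, real_inner_smul_left]
  · intro u v v'
    rw [← MeasureTheory.integral_add (hint _ _) (hint _ _)]
    simp only [f, map_add, inner_add_right]
  · intro c u v
    rw [smul_eq_mul, ← MeasureTheory.integral_const_mul]
    simp only [f, map_smul, real_inner_smul_right]
  · intro u v
    simp only [LinearMap.mk₂_apply, f]
    simp only [real_inner_comm]
  · intro v hv
    simp only [LinearMap.mk₂_apply]
    refine (hf v v).integral_pos_of_hasCompactSupport_nonneg_nonzero
      (HasCompactSupport.of_compactSpace _) (fun g => real_inner_self_nonneg) (x := 1) ?_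
    simp only [f, inv_one, Ad_one]
    simpa using hv
  · intro h u v
    simp only [LinearMap.mk₂_apply]
    rw [← MeasureTheory.integral_mul_left_eq_self (f u v) h⁻¹]
    congr 1
    ext1 g
    simp only [f, mul_inv_rev, inv_inv, Ad_mul, ContinuousLinearMap.comp_apply]

theorem ad_skew {B : LinearMap.BilinForm ℝ EG} (hB : ∀ (g : G) u v, B (Ad g u) (Ad g v) = B u v)
    (ξ u v : EG) : B (ad G ξ u) v = -B u (ad G ξ v) := by
  obtain ⟨D, hD, hDb⟩ := exists_hasMFDerivAt_Ad (EG := EG) (G := G)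
  have h1 := hasFDerivAt_chart hD
  have hu := h1.clm_apply (hasFDerivAt_const u _)
  have hv := h1.clm_apply (hasFDerivAt_const v _)
  have h2 := ((LinearMap.toContinuousBilinearMap B).hasFDerivAt.comp _ hu).clm_apply hv
  have h0 : (extChartAt 𝓘(ℝ, EG) (1 : G)).symm (extChartAt 𝓘(ℝ, EG) (1 : G) 1) = 1 :=
    extChartAt_to_inv 1
  have h3 : (fun x => (LinearMap.toContinuousBilinearMap B ∘ fun x =>
      ((fun g : G => (Ad g : EG →L[ℝ] EG)) ∘ (extChartAt 𝓘(ℝ, EG) (1 : G)).symm) x u) x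
      (((fun g : G => (Ad g : EG →L[ℝ] EG)) ∘ (extChartAt 𝓘(ℝ, EG) (1 : G)).symm) x v))
      = fun _ => B u v := by
    ext1 x
    exact hB _ u v
  rw [h3] at h2
  have h4 := congrArg (fun T : EG →L[ℝ] ℝ => T ξ) (h2.unique (hasFDerivAt_const _ _))
  simp only [Function.comp_apply, h0, Ad_one] at h4
  have h5 : B u (D ξ v) + B (D ξ u) v = 0 := by simpa using h4
  rw [hDb, hDb] at h5
  change B (bracket G ξ u) v = -B u (bracket G ξ v)
  linarith

/-- In the Lie algebra of a compact group, every `ad_ξ` is semisimple, as it is skew for an invariant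
inner product. -/
theorem ad_isSemisimple [T2Space G] [CompactSpace G] (ξ : EG) :
    Module.End.IsSemisimple (ad G ξ).toLinearMap := by
  obtain ⟨B, hs, hpos, hB⟩ := exists_Ad_invariant_form (EG := EG) (G := G)
  refine isSemisimple_of_skew B hs (fun v hv => ?_) _ (ad_skew hB ξ)
  by_contra h
  exact (hpos v h).ne' hv

/-- The orthogonal of `𝔤_μ` for an `Ad`-invariant inner product is an `Ad(G_μ)`-invariant
complement. -/
theorem exists_Ad_invariant_isCompl [T2Space G] [CompactSpace G] (μ : EG →L[ℝ] ℝ) :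
    ∃ 𝔟 : Submodule ℝ EG, (∀ g ∈ isotropyGroup G μ, ∀ η ∈ 𝔟, Ad g η ∈ 𝔟) ∧
      IsCompl 𝔟 (isotropyAlgebra G μ) := by
  obtain ⟨B, hs, hpos, hB⟩ := exists_Ad_invariant_form (EG := EG) (G := G)
  refine ⟨B.orthogonal (isotropyAlgebra G μ), ?_, ?_⟩
  · intro g hg β hβ η hη
    have h1 : B (Ad g⁻¹ η) β = 0 := hβ _ (Ad_mem_isotropyAlgebra (inv_mem hg) hη)
    rw [← hB g] at h1
    have h2 := congrArg (fun T : EG →L[ℝ] EG => T η) (Ad_comp_inv (EG := EG) g)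
    simp only [ContinuousLinearMap.comp_apply, ContinuousLinearMap.id_apply] at h2
    rw [h2] at h1
    exact h1
  · have hr : B.IsRefl := fun u v h => by rw [hs, h]
    refine ((LinearMap.BilinForm.isCompl_orthogonal_iff_disjoint hr).2 ?_).symm
    rw [Submodule.disjoint_def]
    intro v hv hv'
    by_contra h
    exact (hpos v h).ne' (hv' v hv)

end LieAlgebra

/-! ### Hamiltonian vector fields and Hessians -/

section Symplectic

variable {E : Type*} [NormedAddCommGroup E] [NormedSpace ℝ E]
  {M : Type*} [TopologicalSpace M] [ChartedSpace E M]

theorem SymplecticForm.skew (Ω : SymplecticForm E M) (p : M) (v w : E) :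
    Ω.form p v w = -Ω.form p w v := by
  have h := Ω.alternating p (v + w)
  simp only [map_add, add_apply, Ω.alternating, zero_add, add_zero] at h
  linarith

theorem SymplecticForm.form_injective (Ω : SymplecticForm E M) (p : M) :
    Function.Injective (Ω.form p) := by
  rw [injective_iff_map_eq_zero]
  intro v hv
  exact Ω.nondegenerate p v fun w => by rw [hv]; rfl

variable [FiniteDimensional ℝ E]

theorem SymplecticForm.form_hamVF (Ω : SymplecticForm E M) (H : M → ℝ) (p : M) :
    Ω.form p (Ω.hamVF H p) = (tangentAt H p : E →L[ℝ] ℝ) :=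
  (Ω.exists_form_eq p (tangentAt H p)).choose_spec

theorem SymplecticForm.hamVF_eq_zero (Ω : SymplecticForm E M) {H : M → ℝ} {p : M}
    (h : (tangentAt H p : E →L[ℝ] ℝ) = 0) : Ω.hamVF H p = 0 :=
  Ω.form_injective p (by rw [Ω.form_hamVF, h, map_zero])

variable [IsManifold 𝓘(ℝ, E) ∞ M]

variable (E) in
/-- The expression of a vector field in the preferred chart at `p`. -/
noncomputable def vectorFieldInChart (X : M → E) (p : M) (x : E) : E :=
  (tangentAt (extChartAt 𝓘(ℝ, E) p) ((extChartAt 𝓘(ℝ, E) p).symm x) : E →L[ℝ] E)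
    (X ((extChartAt 𝓘(ℝ, E) p).symm x))

omit [FiniteDimensional ℝ E] [IsManifold 𝓘(ℝ, E) ∞ M] in
theorem linearization_apply (X : M → E) (p : M) (u : E) :
    linearization X p u
      = fderiv ℝ (vectorFieldInChart E X p) (extChartAt 𝓘(ℝ, E) p p) u := rfl

omit [FiniteDimensional ℝ E] in
theorem vectorFieldInChart_self (X : M → E) (p : M) :
    vectorFieldInChart E X p (extChartAt 𝓘(ℝ, E) p p) = X p := by
  unfold vectorFieldInChart
  rw [extChartAt_to_inv, tangentAt_extChartAt_self]
  rfl

omit [FiniteDimensional ℝ E] in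
theorem fderiv_apply_vectorFieldInChart {f : M → ℝ} (hf : ContMDiff 𝓘(ℝ, E) 𝓘(ℝ, ℝ) ∞ f)
    (X : M → E) {p : M} {x : E} (hx : x ∈ (extChartAt 𝓘(ℝ, E) p).target) :
    fderiv ℝ (f ∘ (extChartAt 𝓘(ℝ, E) p).symm) x (vectorFieldInChart E X p x)
      = (tangentAt f ((extChartAt 𝓘(ℝ, E) p).symm x) : E →L[ℝ] ℝ)
        (X ((extChartAt 𝓘(ℝ, E) p).symm x)) := by
  rw [fderiv_comp_extChartAt_symm hx (hf.mdifferentiableAt (by simp))]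
  have h := congrArg (fun T : E →L[ℝ] E => T (X ((extChartAt 𝓘(ℝ, E) p).symm x)))
    (tangentAt_symm_comp_extChartAt (E := E) hx)
  simp only [ContinuousLinearMap.comp_apply, ContinuousLinearMap.id_apply] at h
  unfold vectorFieldInChart
  rw [ContinuousLinearMap.comp_apply, h]

theorem formInChart_hamVF (Ω : SymplecticForm E M) {H : M → ℝ}
    (hH : ContMDiff 𝓘(ℝ, E) 𝓘(ℝ, ℝ) ∞ H) {p : M} {x : E}
    (hx : x ∈ (extChartAt 𝓘(ℝ, E) p).target) :
    formInChart Ω.form p x (vectorFieldInChart E (Ω.hamVF H) p x)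
      = fderiv ℝ (H ∘ (extChartAt 𝓘(ℝ, E) p).symm) x := by
  rw [fderiv_comp_extChartAt_symm hx (hH.mdifferentiableAt (by simp)), ← Ω.form_hamVF]
  have h := congrArg (fun T : E →L[ℝ] E => T (Ω.hamVF H ((extChartAt 𝓘(ℝ, E) p).symm x)))
    (tangentAt_symm_comp_extChartAt (E := E) hx)
  simp only [ContinuousLinearMap.comp_apply, ContinuousLinearMap.id_apply] at h
  unfold vectorFieldInChart formInChart
  ext w
  rw [ContinuousLinearMap.bilinearComp_apply, h]
  rfl

omit [FiniteDimensional ℝ E] in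
theorem formInChart_self (Ω : SymplecticForm E M) (p : M) :
    formInChart Ω.form p (extChartAt 𝓘(ℝ, E) p p) = Ω.form p := by
  unfold formInChart
  rw [extChartAt_to_inv, tangentAt_extChartAt_symm_self]
  rfl

/-- In a chart, `X_H` is the inverse of the matrix of `Ω` applied to the differential of `H`, hence
differentiable. -/
theorem differentiableAt_hamVF (Ω : SymplecticForm E M) {H : M → ℝ}
    (hH : ContMDiff 𝓘(ℝ, E) 𝓘(ℝ, ℝ) ∞ H) (p : M) :
    DifferentiableAt ℝ (vectorFieldInChart E (Ω.hamVF H) p) (extChartAt 𝓘(ℝ, E) p p) := by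
  have : CompleteSpace E := FiniteDimensional.complete ℝ E
  set e := extChartAt 𝓘(ℝ, E) p p with he
  have ht : (extChartAt 𝓘(ℝ, E) p).target ∈ 𝓝 e :=
    (isOpen_extChartAt_target _).mem_nhds (mem_extChartAt_target _)
  have hΩ : DifferentiableAt ℝ (formInChart Ω.form p) e :=
    ((Ω.smooth p).contDiffAt ht).differentiableAt (by simp)
  have hdH : DifferentiableAt ℝ (fderiv ℝ (H ∘ (extChartAt 𝓘(ℝ, E) p).symm)) e :=
    ((contDiffAt_comp_extChartAt_symm (mem_extChartAt_target p)
      (hH _)).fderiv_right (m := 1) one_add_one_le_infty).differentiableAt (by simp)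
  let Ωe : E ≃L[ℝ] (E →L[ℝ] ℝ) := (LinearEquiv.ofBijective (Ω.form p).toLinearMap
    ⟨Ω.form_injective p, Ω.exists_form_eq p⟩).toContinuousLinearEquiv
  have hΩe : (Ωe : E →L[ℝ] E →L[ℝ] ℝ) = formInChart Ω.form p e := by
    rw [formInChart_self]
    rfl
  have hinv : ∀ᶠ x in 𝓝 e, (formInChart Ω.form p x).IsInvertible := by
    have h1 : Set.range ((↑) : (E ≃L[ℝ] (E →L[ℝ] ℝ)) → E →L[ℝ] E →L[ℝ] ℝ) ∈
        𝓝 (formInChart Ω.form p e) := by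
      rw [← hΩe]
      exact ContinuousLinearEquiv.nhds Ωe
    exact hΩ.continuousAt.eventually h1
  have heq : vectorFieldInChart E (Ω.hamVF H) p =ᶠ[𝓝 e] fun x =>
      (formInChart Ω.form p x).inverse (fderiv ℝ (H ∘ (extChartAt 𝓘(ℝ, E) p).symm) x) := by
    filter_upwards [hinv, ht] with x hx hxt
    rw [← formInChart_hamVF Ω hH hxt, ← ContinuousLinearMap.comp_apply, hx.inverse_comp_self]
    rfl
  refine DifferentiableAt.congr_of_eventuallyEq ?_ heq
  refine DifferentiableAt.clm_apply ?_ hdH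
  have h1 := (contDiffAt_map_inverse (n := 1) Ωe).differentiableAt (by simp)
  rw [hΩe] at h1
  exact h1.comp e hΩ

/-- At a critical point, the linearization of `X_H` is the Hamiltonian matrix of the Hessian. -/
theorem form_linearization (Ω : SymplecticForm E M) {H : M → ℝ}
    (hH : ContMDiff 𝓘(ℝ, E) 𝓘(ℝ, ℝ) ∞ H) {p : M} (h0 : (tangentAt H p : E →L[ℝ] ℝ) = 0)
    (u v : E) :
    Ω.form p (linearization (Ω.hamVF H) p u) v = (hessian H p : E →L[ℝ] E →L[ℝ] ℝ) u v := by
  set e := extChartAt 𝓘(ℝ, E) p p with he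
  have ht : (extChartAt 𝓘(ℝ, E) p).target ∈ 𝓝 e :=
    (isOpen_extChartAt_target _).mem_nhds (mem_extChartAt_target _)
  have hΩ : DifferentiableAt ℝ (formInChart Ω.form p) e :=
    ((Ω.smooth p).contDiffAt ht).differentiableAt (by simp)
  have h1 := hΩ.hasFDerivAt.clm_apply (differentiableAt_hamVF Ω hH p).hasFDerivAt
  have h2 : (fun x => formInChart Ω.form p x (vectorFieldInChart E (Ω.hamVF H) p x))
      =ᶠ[𝓝 e] fderiv ℝ (H ∘ (extChartAt 𝓘(ℝ, E) p).symm) := by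
    filter_upwards [ht] with x hx using formInChart_hamVF Ω hH hx
  have h3 := (h1.congr_of_eventuallyEq h2.symm).fderiv
  unfold hessian
  rw [h3, vectorFieldInChart_self, Ω.hamVF_eq_zero h0, formInChart_self]
  simp [linearization_apply]

omit [FiniteDimensional ℝ E] in
theorem hessian_symm {H : M → ℝ} (hH : ContMDiff 𝓘(ℝ, E) 𝓘(ℝ, ℝ) ∞ H) (p : M) (u v : E) :
    (hessian H p : E →L[ℝ] E →L[ℝ] ℝ) u v = (hessian H p : E →L[ℝ] E →L[ℝ] ℝ) v u :=
  ((contDiffAt_comp_extChartAt_symm (mem_extChartAt_target p) (hH _)).isSymmSndFDerivAt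
    (by rw [minSmoothness_of_isRCLikeNormedField]; exact two_le_infty)).eq u v

theorem form_linearization_skew (Ω : SymplecticForm E M) {H : M → ℝ}
    (hH : ContMDiff 𝓘(ℝ, E) 𝓘(ℝ, ℝ) ∞ H) {p : M} (h0 : (tangentAt H p : E →L[ℝ] ℝ) = 0)
    (u v : E) :
    Ω.form p (linearization (Ω.hamVF H) p u) v
      = -Ω.form p u (linearization (Ω.hamVF H) p v) := by
  rw [form_linearization Ω hH h0, Ω.skew p u, form_linearization Ω hH h0, hessian_symm hH, neg_neg]

/-- At a critical point with definite Hessian, the linearization of `X_H` preserves the definite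
form `d²H(p)`, hence is semisimple. -/
theorem linearization_isSemisimple (Ω : SymplecticForm E M) {H : M → ℝ}
    (hH : ContMDiff 𝓘(ℝ, E) 𝓘(ℝ, ℝ) ∞ H) {p : M} (h0 : (tangentAt H p : E →L[ℝ] ℝ) = 0)
    (hdef : IsDefinite (hessian H p : E →L[ℝ] E →L[ℝ] ℝ)) :
    Module.End.IsSemisimple (linearization (Ω.hamVF H) p) := by
  refine isSemisimple_of_skew (ContinuousLinearMap.toBilinForm (hessian H p))
    (hessian_symm hH p) ?_ _ ?_
  · intro v hv
    by_contra hv0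
    rcases hdef with h | h
    · exact (h v hv0).ne' hv
    · exact (h v hv0).ne hv
  · intro u v
    change (hessian H p : E →L[ℝ] E →L[ℝ] ℝ) _ v = -(hessian H p : E →L[ℝ] E →L[ℝ] ℝ) u _
    rw [hessian_symm hH, ← form_linearization Ω hH h0, ← form_linearization Ω hH h0, Ω.skew]

end Symplectic

section Calculus

variable {E : Type*} [NormedAddCommGroup E] [NormedSpace ℝ E] [FiniteDimensional ℝ E]
  {F : Type*} [NormedAddCommGroup F] [NormedSpace ℝ F]

omit [FiniteDimensional ℝ E] in
/-- The second derivative of a composition at a critical point of the outer function. -/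
theorem fderiv_fderiv_comp_of_fderiv_eq_zero {h : F → ℝ} {q : E → F} {e : E}
    (hh : ContDiffAt ℝ 2 h (q e)) (hq : ContDiffAt ℝ 2 q e) (h0 : fderiv ℝ h (q e) = 0) (u v : E) :
    fderiv ℝ (fderiv ℝ (h ∘ q)) e u v
      = fderiv ℝ (fderiv ℝ h) (q e) (fderiv ℝ q e u) (fderiv ℝ q e v) := by
  have h1 : fderiv ℝ (h ∘ q) =ᶠ[𝓝 e] fun x => (fderiv ℝ h (q x)).comp (fderiv ℝ q x) := by
    have hd : ∀ᶠ y in 𝓝 (q e), DifferentiableAt ℝ h y :=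
      (hh.eventually (by simp)).mono fun y hy => hy.differentiableAt (by simp)
    have hdq : ∀ᶠ x in 𝓝 e, DifferentiableAt ℝ q x :=
      (hq.eventually (by simp)).mono fun y hy => hy.differentiableAt (by simp)
    filter_upwards [hq.continuousAt.eventually hd, hdq] with x hx hx'
    exact fderiv_comp x hx hx'
  have h2 : DifferentiableAt ℝ (fderiv ℝ h) (q e) :=
    (hh.fderiv_right (m := 1) (by norm_num)).differentiableAt (by simp)
  have h3 : DifferentiableAt ℝ (fderiv ℝ q) e :=
    (hq.fderiv_right (m := 1) (by norm_num)).differentiableAt (by simp)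
  have h4 := (h2.hasFDerivAt.comp e
    (hq.differentiableAt (by simp)).hasFDerivAt).clm_comp h3.hasFDerivAt
  rw [(h4.congr_of_eventuallyEq h1).fderiv]
  simp [h0]

/-- A regular level set of `j` is parametrized near `e` by the kernel of the derivative of `j`. -/
theorem exists_levelSet_parametrization {j : E → F} {e : E} (hj : ContDiffAt ℝ 2 j e)
    (hs : Function.Surjective (fderiv ℝ j e)) :
    ∃ σ : LinearMap.ker (fderiv ℝ j e).toLinearMap → E, ContDiffAt ℝ 2 σ 0 ∧ σ 0 = e ∧
      (∀ᶠ y in 𝓝 0, j (σ y) = j e) ∧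
      fderiv ℝ σ 0 = (LinearMap.ker (fderiv ℝ j e).toLinearMap).subtypeL := by
  have : CompleteSpace E := FiniteDimensional.complete ℝ E
  set K := LinearMap.ker (fderiv ℝ j e).toLinearMap with hK
  obtain ⟨R₀, hR₀⟩ := LinearMap.exists_leftInverse_of_injective K.subtype (Submodule.ker_subtype K)
  let R : E →L[ℝ] K := R₀.toContinuousLinearMap
  have hR : ∀ u : K, R u = u := fun u => LinearMap.congr_fun hR₀ u
  -- complete `j` by a projection onto `K` to a local diffeomorphism
  let Ψ : E → F × K := fun x => (j x, R x - R e)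
  have hΨ : ContDiffAt ℝ 2 Ψ e := hj.prodMk (R.contDiff.contDiffAt.sub contDiffAt_const)
  have hΨd : HasFDerivAt Ψ ((fderiv ℝ j e).prod R) e :=
    (hj.differentiableAt (by simp)).hasFDerivAt.prodMk (R.hasFDerivAt.sub_const _)
  have hinj : Function.Injective ((fderiv ℝ j e).prod R) := by
    rw [injective_iff_map_eq_zero]
    intro u hu
    have h1 := congrArg Prod.fst hu
    have h2 := congrArg Prod.snd hu
    have h3 := hR ⟨u, h1⟩
    change R u = 0 at h2
    change R u = _ at h3
    rw [h2] at h3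
    exact (congrArg Subtype.val h3).symm
  have hsurj : Function.Surjective ((fderiv ℝ j e).prod R) := by
    rintro ⟨f, k⟩
    obtain ⟨u, hu⟩ := hs f
    refine ⟨u - (R u : E) + k, ?_⟩
    have h1 : ∀ k : K, fderiv ℝ j e k = 0 := fun k => k.2
    simp [h1, hu, hR]
  let L : E ≃L[ℝ] F × K := (LinearEquiv.ofBijective ((fderiv ℝ j e).prod R).toLinearMap
    ⟨hinj, hsurj⟩).toContinuousLinearEquiv
  have hL : (L : E →L[ℝ] F × K) = (fderiv ℝ j e).prod R := rfl
  rw [← hL] at hΨd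
  have hΨe : Ψ e = (j e, 0) := by simp [Ψ]
  set τ := hΨ.localInverse hΨd (by simp) with hτ
  have hτc : ContDiffAt ℝ 2 τ (Ψ e) := hΨ.to_localInverse hΨd (by simp)
  have hst := hΨ.hasStrictFDerivAt' hΨd (by simp)
  have hτd : HasFDerivAt τ (L.symm : F × K →L[ℝ] E) (Ψ e) := hst.to_localInverse.hasFDerivAt
  have hτe : τ (Ψ e) = e := hst.localInverse_apply_image
  have hτr : ∀ᶠ y in 𝓝 (Ψ e), Ψ (τ y) = y := hst.eventually_right_inverse
  rw [hΨe] at hτc hτd hτe hτr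
  have hc : ContDiffAt ℝ 2 (fun y : K => (j e, y)) 0 := contDiffAt_const.prodMk contDiffAt_id
  refine ⟨fun y => τ (j e, y), hτc.comp (0 : K) hc, hτe, ?_, ?_⟩
  · filter_upwards [hc.continuousAt.eventually hτr] with y hy
    exact congrArg Prod.fst hy
  · have h1 := (hτd.comp (0 : K) (hasFDerivAt_prodMk_right (𝕜 := ℝ) (j e) (0 : K))).fderiv
    refine h1.trans ?_
    ext1 u
    change L.symm (0, u) = u
    rw [ContinuousLinearEquiv.symm_apply_eq]
    change (0, u) = (fderiv ℝ j e u, R u)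
    rw [hR, show fderiv ℝ j e u = 0 from u.2]

/-- If `g` is constant on a regular level set of `j`, its derivative vanishes on the tangent space of
the level set. -/
theorem fderiv_eq_zero_of_const_on_levelSet {j : E → F} {g : E → ℝ} {e : E}
    (hj : ContDiffAt ℝ 2 j e) (hs : Function.Surjective (fderiv ℝ j e)) (hg : ContDiffAt ℝ 2 g e)
    (hconst : ∀ᶠ x in 𝓝 e, j x = j e → g x = g e) {u : E} (hu : fderiv ℝ j e u = 0) :
    fderiv ℝ g e u = 0 := by
  obtain ⟨σ, hσ, hσ0, hσj, hσd⟩ := exists_levelSet_parametrization hj hs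
  have h1 : g ∘ σ =ᶠ[𝓝 0] fun _ => g e := by
    rw [← hσ0] at hconst
    filter_upwards [hσj, hσ.continuousAt.eventually hconst] with y hy hy'
    rw [hσ0] at hy'
    exact hy' hy
  have h2 : fderiv ℝ (g ∘ σ) 0 = 0 := by rw [h1.fderiv_eq, fderiv_fun_const]; rfl
  rw [fderiv_comp _ (by rw [hσ0]; exact hg.differentiableAt (by simp))
    (hσ.differentiableAt (by simp)), hσ0, hσd] at h2
  exact congrArg (fun T : _ →L[ℝ] ℝ => T ⟨u, hu⟩) h2

/-- If moreover `e` is a critical point of `g`, the Hessian vanishes on the tangent space of the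
level set; the curvature of the level set does not enter. -/
theorem fderiv_fderiv_eq_zero_of_const_on_levelSet {j : E → F} {g : E → ℝ} {e : E}
    (hj : ContDiffAt ℝ 2 j e) (hs : Function.Surjective (fderiv ℝ j e)) (hg : ContDiffAt ℝ 2 g e)
    (hconst : ∀ᶠ x in 𝓝 e, j x = j e → g x = g e) (h0 : fderiv ℝ g e = 0) {u v : E}
    (hu : fderiv ℝ j e u = 0) (hv : fderiv ℝ j e v = 0) :
    fderiv ℝ (fderiv ℝ g) e u v = 0 := by
  obtain ⟨σ, hσ, hσ0, hσj, hσd⟩ := exists_levelSet_parametrization hj hs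
  have h1 : g ∘ σ =ᶠ[𝓝 0] fun _ => g e := by
    rw [← hσ0] at hconst
    filter_upwards [hσj, hσ.continuousAt.eventually hconst] with y hy hy'
    rw [hσ0] at hy'
    exact hy' hy
  have h2 := fderiv_fderiv_comp_of_fderiv_eq_zero (h := g) (q := σ) (e := 0) (by rwa [hσ0]) hσ
    (by rwa [hσ0]) ⟨u, hu⟩ ⟨v, hv⟩
  rw [hσ0, hσd] at h2
  have h3 : fderiv ℝ (g ∘ σ) =ᶠ[𝓝 0] 0 := by
    have := h1.fderiv (𝕜 := ℝ)
    simpa using this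
  rw [h3.fderiv_eq] at h2
  simpa using h2.symm

end Calculus

/-! ### Momentum maps and relative equilibria -/

section Actions

variable {EP : Type*} [NormedAddCommGroup EP] [NormedSpace ℝ EP]
  {P : Type*} [TopologicalSpace P] [ChartedSpace EP P]
  {EG : Type*} [NormedAddCommGroup EG] [NormedSpace ℝ EG]
  {G : Type*} [TopologicalSpace G] [ChartedSpace EG G] [Group G] [MulAction G P]
  {Ω : SymplecticForm EP P} {J : P → EG →L[ℝ] ℝ} {H : P → ℝ}

theorem mdifferentiableAt_smul_left [ContMDiffSMul 𝓘(ℝ, EG) 𝓘(ℝ, EP) ∞ G P] (g : G) (x : P) :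
    MDifferentiableAt 𝓘(ℝ, EG) 𝓘(ℝ, EP) (fun g : G => g • x) g := by
  have h : ContMDiff 𝓘(ℝ, EG) 𝓘(ℝ, EP) ∞ (fun g : G => g • x) := contMDiff_id.smul contMDiff_const
  exact h.mdifferentiableAt (by simp)

theorem tangentAt_comp_infGen {F : Type*} [NormedAddCommGroup F] [NormedSpace ℝ F]
    [ContMDiffSMul 𝓘(ℝ, EG) 𝓘(ℝ, EP) ∞ G P] {f : P → F} {x : P}
    (hf : MDifferentiableAt 𝓘(ℝ, EP) 𝓘(ℝ, F) f x) :
    (tangentAt f x : EP →L[ℝ] F).comp (infGen G x : EG →L[ℝ] EP)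
      = tangentAt (fun g : G => f (g • x)) 1 := by
  have h1 : MDifferentiableAt 𝓘(ℝ, EP) 𝓘(ℝ, F) f ((1 : G) • x) := by rwa [one_smul]
  have h2 := tangentAt_comp (f := fun g : G => g • x) h1
    (mdifferentiableAt_smul_left (EG := EG) (1 : G) x)
  simp only [one_smul] at h2
  exact h2.symm

theorem tangentAt_infGen_of_invariant [ContMDiffSMul 𝓘(ℝ, EG) 𝓘(ℝ, EP) ∞ G P]
    (hH : ContMDiff 𝓘(ℝ, EP) 𝓘(ℝ, ℝ) ∞ H) (hHinv : ∀ (g : G) (x : P), H (g • x) = H x)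
    (x : P) (η : EG) :
    (tangentAt H x : EP →L[ℝ] ℝ) (infGen G x η) = 0 := by
  have h := tangentAt_comp_infGen (EG := EG) (G := G) (hH.mdifferentiableAt (x := x) (by simp))
  simp only [hHinv, tangentAt_const] at h
  exact congrArg (fun T : EG →L[ℝ] ℝ => T η) h

theorem IsMomentumMap.tangentAt_infGen [ContMDiffSMul 𝓘(ℝ, EG) 𝓘(ℝ, EP) ∞ G P]
    (hJ : IsMomentumMap G Ω J) (x : P) (η : EG) :
    (tangentAt J x : EP →L[ℝ] EG →L[ℝ] ℝ) (infGen G x η)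
      = (tangentAt (fun g : G => CoAd g (J x)) 1 : EG →L[ℝ] EG →L[ℝ] ℝ) η := by
  have h := tangentAt_comp_infGen (EG := EG) (G := G)
    (hJ.smooth.mdifferentiableAt (x := x) (by simp))
  simp only [hJ.equivariant] at h
  exact congrArg (fun T : EG →L[ℝ] EG →L[ℝ] ℝ => T η) h

theorem IsMomentumMap.contMDiff_apply (hJ : IsMomentumMap G Ω J) (η : EG) :
    ContMDiff 𝓘(ℝ, EP) 𝓘(ℝ, ℝ) ∞ (fun x => J x η) :=
  (ContinuousLinearMap.apply ℝ ℝ η).contMDiff.comp hJ.smooth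

theorem IsMomentumMap.tangentAt_apply (hJ : IsMomentumMap G Ω J) (η : EG) (x : P) (v : EP) :
    (tangentAt (fun x => J x η) x : EP →L[ℝ] ℝ) v
      = (tangentAt J x : EP →L[ℝ] EG →L[ℝ] ℝ) v η := by
  have h := tangentAt_comp (g := ContinuousLinearMap.apply ℝ ℝ η)
    (ContinuousLinearMap.apply ℝ ℝ η).mdifferentiableAt
    (hJ.smooth.mdifferentiableAt (x := x) (by simp))
  rw [tangentAt_eq_fderiv, ContinuousLinearMap.fderiv] at h
  exact congrArg (fun T : EP →L[ℝ] ℝ => T v) h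

theorem IsMomentumMap.contMDiff_augmentedHam (hJ : IsMomentumMap G Ω J)
    (hH : ContMDiff 𝓘(ℝ, EP) 𝓘(ℝ, ℝ) ∞ H) (ξ : EG) :
    ContMDiff 𝓘(ℝ, EP) 𝓘(ℝ, ℝ) ∞ (augmentedHam H J ξ) :=
  hH.sub (hJ.contMDiff_apply ξ)

theorem IsMomentumMap.tangentAt_augmentedHam (hJ : IsMomentumMap G Ω J)
    (hH : ContMDiff 𝓘(ℝ, EP) 𝓘(ℝ, ℝ) ∞ H) (ξ : EG) (x : P) (v : EP) :
    (tangentAt (augmentedHam H J ξ) x : EP →L[ℝ] ℝ) v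
      = (tangentAt H x : EP →L[ℝ] ℝ) v - (tangentAt J x : EP →L[ℝ] EG →L[ℝ] ℝ) v ξ := by
  rw [← hJ.tangentAt_apply]
  have h : (tangentAt (augmentedHam H J ξ) x : EP →L[ℝ] ℝ)
      = (tangentAt H x : EP →L[ℝ] ℝ) - (tangentAt (fun x => J x ξ) x : EP →L[ℝ] ℝ) :=
    mfderiv_sub (hH.mdifferentiableAt (by simp))
      ((hJ.contMDiff_apply ξ).mdifferentiableAt (by simp))
  rw [h]
  rfl

variable [FiniteDimensional ℝ EP]

theorem IsMomentumMap.infGen_eq_hamVF (hJ : IsMomentumMap G Ω J) (η : EG) (x : P) :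
    infGen G x η = Ω.hamVF (fun x => J x η) x := by
  apply Ω.form_injective x
  ext v
  rw [hJ.generates, Ω.form_hamVF, hJ.tangentAt_apply]

/-- A relative equilibrium is a critical point of the augmented Hamiltonian. -/
theorem IsRelativeEquilibrium.tangentAt_augmentedHam [ContMDiffSMul 𝓘(ℝ, EG) 𝓘(ℝ, EP) ∞ G P]
    (hJ : IsMomentumMap G Ω J) (hH : ContMDiff 𝓘(ℝ, EP) 𝓘(ℝ, ℝ) ∞ H) {p : P} {ξ : EG}
    (hp : IsRelativeEquilibrium (G := G) Ω H p ξ) :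
    (tangentAt (augmentedHam H J ξ) p : EP →L[ℝ] ℝ) = 0 := by
  obtain ⟨γ, ⟨hγ, hγs, hγξ⟩, hint⟩ := hp
  have h0 : γ 0 = 1 := by
    have := hγ 0 0
    rw [add_zero] at this
    exact mul_eq_left.1 this.symm
  have h1 := tangentAt_comp (g := fun g : G => g • p) (f := γ) (x := (0 : ℝ))
    (mdifferentiableAt_smul_left (EG := EG) (EP := EP) (γ 0) p)
    (hγs.mdifferentiableAt (by simp))
  have h2 : (tangentAt (fun t => γ t • p) (0 : ℝ) : ℝ →L[ℝ] EP)
      = (1 : ℝ →L[ℝ] ℝ).smulRight (Ω.hamVF H (γ 0 • p)) := (hint 0).mfderiv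
  have h3 : Ω.hamVF H p = infGen G p ξ := by
    have h4 := congrArg (fun T : ℝ →L[ℝ] EP => T 1) (h2.symm.trans h1)
    simp only [h0, one_smul, ContinuousLinearMap.comp_apply, hγξ,
      ContinuousLinearMap.smulRight_apply, one_apply_eq_self] at h4
    exact h4
  ext v
  rw [hJ.tangentAt_augmentedHam hH, ← hJ.generates, ← h3, Ω.form_hamVF]
  simp

/-- The momentum is constant along a relative equilibrium, so the generator lies in `𝔤_μ`. This
follows from `dH_ξ(p) = 0` and the invariance of `H`, which give `⟨J p, [η, ξ]⟩ = 0` for all `η`. -/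
theorem IsRelativeEquilibrium.mem_isotropyAlgebra [FiniteDimensional ℝ EG]
    [LieGroup 𝓘(ℝ, EG) ∞ G] [ContMDiffSMul 𝓘(ℝ, EG) 𝓘(ℝ, EP) ∞ G P]
    (hJ : IsMomentumMap G Ω J) (hH : ContMDiff 𝓘(ℝ, EP) 𝓘(ℝ, ℝ) ∞ H)
    (hHinv : ∀ (g : G) (x : P), H (g • x) = H x) {p : P} {ξ : EG}
    (hp : IsRelativeEquilibrium (G := G) Ω H p ξ) : ξ ∈ isotropyAlgebra G (J p) := by
  rw [mem_isotropyAlgebra_iff]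
  ext η
  have h1 := hJ.tangentAt_augmentedHam hH ξ p (infGen G p η)
  rw [hp.tangentAt_augmentedHam hJ hH, tangentAt_infGen_of_invariant hH hHinv,
    hJ.tangentAt_infGen, tangentAt_CoAd_apply, bracket_skew, map_neg] at h1
  rw [tangentAt_CoAd_apply]
  simp only [zero_apply] at h1 ⊢
  linarith

/-- The linearized flow acts on the tangent space of the group orbit through `-ad_ξ`. -/
theorem IsRelativeEquilibrium.linearization_infGen [IsManifold 𝓘(ℝ, EP) ∞ P]
    [FiniteDimensional ℝ EG]
    [LieGroup 𝓘(ℝ, EG) ∞ G] [ContMDiffSMul 𝓘(ℝ, EG) 𝓘(ℝ, EP) ∞ G P]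
    (hJ : IsMomentumMap G Ω J) (hH : ContMDiff 𝓘(ℝ, EP) 𝓘(ℝ, ℝ) ∞ H)
    (hHinv : ∀ (g : G) (x : P), H (g • x) = H x) {p : P} {ξ : EG}
    (hp : IsRelativeEquilibrium (G := G) Ω H p ξ) (η : EG) :
    linearization (Ω.hamVF (augmentedHam H J ξ)) p (infGen G p η) = -infGen G p (ad G ξ η) := by
  have hHξ := hJ.contMDiff_augmentedHam hH ξ
  have hcrit := hp.tangentAt_augmentedHam hJ hH
  set e := extChartAt 𝓘(ℝ, EP) p p with he
  have ht : (extChartAt 𝓘(ℝ, EP) p).target ∈ 𝓝 e :=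
    (isOpen_extChartAt_target _).mem_nhds (mem_extChartAt_target _)
  have h0 : (extChartAt 𝓘(ℝ, EP) p).symm e = p := extChartAt_to_inv p
  -- `dH_ξ(x) (η x) = ⟨J x, [η, ξ]⟩` for all `x`; this identity is differentiated at `p`
  have h1 : (fun x => fderiv ℝ (augmentedHam H J ξ ∘ (extChartAt 𝓘(ℝ, EP) p).symm) x
      (vectorFieldInChart EP (Ω.hamVF fun x => J x η) p x)) =ᶠ[𝓝 e]
      (fun x => J x (bracket G η ξ)) ∘ (extChartAt 𝓘(ℝ, EP) p).symm := by
    filter_upwards [ht] with x hx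
    rw [fderiv_apply_vectorFieldInChart hHξ _ hx, ← hJ.infGen_eq_hamVF,
      hJ.tangentAt_augmentedHam hH, tangentAt_infGen_of_invariant hH hHinv, hJ.tangentAt_infGen,
      tangentAt_CoAd_apply]
    simp
  have hd : DifferentiableAt ℝ
      (fderiv ℝ (augmentedHam H J ξ ∘ (extChartAt 𝓘(ℝ, EP) p).symm)) e :=
    ((contDiffAt_comp_extChartAt_symm (mem_extChartAt_target p)
      (hHξ _)).fderiv_right (m := 1) one_add_one_le_infty).differentiableAt (by simp)
  have h2 := hd.hasFDerivAt.clm_apply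
    (differentiableAt_hamVF Ω (hJ.contMDiff_apply η) p).hasFDerivAt
  have h3 := (h2.congr_of_eventuallyEq h1.symm).fderiv
  rw [fderiv_comp_extChartAt_symm (mem_extChartAt_target p)
    ((hJ.contMDiff_apply _).mdifferentiableAt (by simp)), h0, vectorFieldInChart_self,
    fderiv_comp_extChartAt_symm (mem_extChartAt_target p) (hHξ.mdifferentiableAt (by simp)), h0,
    hcrit, tangentAt_extChartAt_symm_self, ← hJ.infGen_eq_hamVF] at h3
  apply Ω.form_injective p
  ext u
  have h4 := congrArg (fun T : EP →L[ℝ] ℝ => T u) h3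
  simp only [ContinuousLinearMap.comp_id, ContinuousLinearMap.zero_comp,
    ContinuousLinearMap.flip_apply, zero_add] at h4
  rw [hJ.tangentAt_apply, ← hJ.generates, bracket_skew, map_neg, map_neg] at h4
  rw [form_linearization Ω hHξ hcrit, hessian_symm hHξ, map_neg]
  exact h4.symm

end Actions

section Reduction

variable {EP : Type*} [NormedAddCommGroup EP] [NormedSpace ℝ EP] [FiniteDimensional ℝ EP]
  {P : Type*} [TopologicalSpace P] [ChartedSpace EP P] [IsManifold 𝓘(ℝ, EP) ∞ P]
  {EG : Type*} [NormedAddCommGroup EG] [NormedSpace ℝ EG] [FiniteDimensional ℝ EG]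
  {G : Type*} [TopologicalSpace G] [ChartedSpace EG G] [Group G] [MulAction G P]
  {EQ : Type*} [NormedAddCommGroup EQ] [NormedSpace ℝ EQ]
  {Q : Type*} [TopologicalSpace Q] [ChartedSpace EQ Q]
  {Ω : SymplecticForm EP P} {J : P → EG →L[ℝ] ℝ} {H : P → ℝ} {p : P} {ξ : EG}
  {ΩQ : SymplecticForm EQ Q} {U : Set P} {π : P → Q} {HQ : Q → ℝ}

omit [FiniteDimensional ℝ EP] [IsManifold 𝓘(ℝ, EP) ∞ P] in
/-- The momentum map is a submersion at a regular point. -/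
theorem IsMomentumMap.surjective_tangentAt (hJ : IsMomentumMap G Ω J)
    (hreg : IsRegularPoint (EG := EG) (EP := EP) G p) :
    Function.Surjective (tangentAt J p : EP →L[ℝ] EG →L[ℝ] ℝ) := by
  rw [← ContinuousLinearMap.coe_coe, ← LinearMap.range_eq_top]
  by_contra hne
  obtain ⟨f, hf, hfr⟩ := Submodule.exists_le_ker_of_lt_top _ (lt_top_iff_ne_top.2 hne)
  -- a functional on `𝔤*` is the evaluation at some `η`
  obtain ⟨η, hη⟩ := (Module.evalEquiv ℝ EG).surjective
    (f ∘ₗ (LinearMap.toContinuousLinearMap : (EG →ₗ[ℝ] ℝ) ≃ₗ[ℝ] (EG →L[ℝ] ℝ)).toLinearMap)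
  have hfη : ∀ α : EG →L[ℝ] ℝ, f α = α η := by
    intro α
    have := LinearMap.congr_fun hη α.toLinearMap
    exact this.symm
  have hη0 : η = 0 := by
    by_contra h
    refine hreg η h (Ω.nondegenerate p _ fun v => ?_)
    rw [hJ.generates, ← hfη]
    exact hfr ⟨v, rfl⟩
  apply hf
  ext α
  rw [hfη, hη0, map_zero]
  rfl

variable [IsManifold 𝓘(ℝ, EQ) ∞ Q] [LieGroup 𝓘(ℝ, EG) ∞ G]

omit [FiniteDimensional ℝ EP] [FiniteDimensional ℝ EG] [IsManifold 𝓘(ℝ, EP) ∞ P]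
  [IsManifold 𝓘(ℝ, EQ) ∞ Q] in
theorem IsReducedSpaceNear.contMDiffAt (hQ : IsReducedSpaceNear G Ω J p ΩQ U π) :
    ContMDiffAt 𝓘(ℝ, EP) 𝓘(ℝ, EQ) ∞ π p :=
  hQ.smooth.contMDiffAt (hQ.isOpen.mem_nhds hQ.mem)

/-- The reduced Hamiltonian has a critical point at the image of `p`, and its Hessian there pulls
back to the Hessian of `H_ξ` on `ker dJ(p)`: on the level set of `J`, the functions `H_ξ` and
`H_μ ∘ π` differ by a constant, and the level set is a manifold. -/
theorem IsReducedSpaceNear.hessian_eq (hQ : IsReducedSpaceNear G Ω J p ΩQ U π)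
    (hJ : IsMomentumMap G Ω J) (hreg : IsRegularPoint (EG := EG) (EP := EP) G p)
    (hH : ContMDiff 𝓘(ℝ, EP) 𝓘(ℝ, ℝ) ∞ H)
    (hcrit : (tangentAt (augmentedHam H J ξ) p : EP →L[ℝ] ℝ) = 0)
    (hHQ : ContMDiff 𝓘(ℝ, EQ) 𝓘(ℝ, ℝ) ∞ HQ)
    (hHQH : ∀ x ∈ U, J x = J p → HQ (π x) = H x) :
    (tangentAt HQ (π p) : EQ →L[ℝ] ℝ) = 0 ∧
    ∀ u v : EP, (tangentAt J p : EP →L[ℝ] EG →L[ℝ] ℝ) u = 0 →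
      (tangentAt J p : EP →L[ℝ] EG →L[ℝ] ℝ) v = 0 →
      (hessian (augmentedHam H J ξ) p : EP →L[ℝ] EP →L[ℝ] ℝ) u v
        = (hessian HQ (π p) : EQ →L[ℝ] EQ →L[ℝ] ℝ) (tangentAt π p u) (tangentAt π p v) := by
  have hHξ := hJ.contMDiff_augmentedHam hH ξ
  set φ := extChartAt 𝓘(ℝ, EP) p with hφ
  set ψ := extChartAt 𝓘(ℝ, EQ) (π p) with hψ
  set e := φ p with he
  have h0 : φ.symm e = p := extChartAt_to_inv p
  have hsymm : ContinuousAt φ.symm e := continuousAt_extChartAt_symm p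
  -- the expressions in charts of the functions involved
  set j : EP → EG →L[ℝ] ℝ := J ∘ φ.symm with hj
  set fP : EP → ℝ := augmentedHam H J ξ ∘ φ.symm with hfP
  set fQ : EQ → ℝ := HQ ∘ ψ.symm with hfQ
  set q : EP → EQ := ψ ∘ π ∘ φ.symm with hq
  have hqe : q e = ψ (π p) := by simp [hq, h0]
  have hjc : ContDiffAt ℝ ∞ j e :=
    contDiffAt_comp_extChartAt_symm (mem_extChartAt_target p) (hJ.smooth _)
  have hfPc : ContDiffAt ℝ ∞ fP e :=
    contDiffAt_comp_extChartAt_symm (mem_extChartAt_target p) (hHξ _)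
  have hfQc : ContDiffAt ℝ ∞ fQ (q e) := by
    rw [hqe]
    exact contDiffAt_comp_extChartAt_symm (mem_extChartAt_target (π p)) (hHQ _)
  have hqc : ContDiffAt ℝ ∞ q e := contDiffAt_chart rfl hQ.contMDiffAt
  have hdj : fderiv ℝ j e = (tangentAt J p : EP →L[ℝ] EG →L[ℝ] ℝ) := by
    rw [hj, fderiv_comp_extChartAt_symm (mem_extChartAt_target p)
      (hJ.smooth.mdifferentiableAt (by simp)), h0, tangentAt_extChartAt_symm_self]
    rfl
  have hdfP : fderiv ℝ fP e = 0 := by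
    rw [hfP, fderiv_comp_extChartAt_symm (mem_extChartAt_target p)
      (hHξ.mdifferentiableAt (by simp)), h0, hcrit, ContinuousLinearMap.zero_comp]
  have hdq : fderiv ℝ q e = (tangentAt π p : EP →L[ℝ] EQ) :=
    (tangentAt_eq_fderiv_chart rfl (hQ.contMDiffAt.mdifferentiableAt (by simp))).symm
  have hdfQ : fderiv ℝ fQ (q e) = (tangentAt HQ (π p) : EQ →L[ℝ] ℝ) := by
    rw [hqe, hfQ, fderiv_comp_extChartAt_symm (mem_extChartAt_target (π p))
      (hHQ.mdifferentiableAt (by simp)), extChartAt_to_inv, tangentAt_extChartAt_symm_self]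
    rfl
  have hs : Function.Surjective (fderiv ℝ j e) := by
    rw [hdj]
    exact hJ.surjective_tangentAt hreg
  have hcomp : ContDiffAt ℝ ∞ (fQ ∘ q) e := hfQc.comp e hqc
  have hconst : ∀ᶠ x in 𝓝 e, j x = j e → (fP - fQ ∘ q) x = (fP - fQ ∘ q) e := by
    have hU : ∀ᶠ x in 𝓝 e, φ.symm x ∈ U :=
      hsymm.eventually (by rw [h0]; exact hQ.isOpen.mem_nhds hQ.mem)
    have hψs : ∀ᶠ x in 𝓝 e, π (φ.symm x) ∈ ψ.source := by
      have h1 : ContinuousAt π (φ.symm e) := by rw [h0]; exact hQ.contMDiffAt.continuousAt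
      refine (h1.comp hsymm).eventually ?_
      simp only [Function.comp_apply, h0]
      exact extChartAt_source_mem_nhds (π p)
    have hval : ∀ x, φ.symm x ∈ U → π (φ.symm x) ∈ ψ.source → J (φ.symm x) = J p →
        (fP - fQ ∘ q) x = -J p ξ := by
      intro x hx hx' hJx
      simp only [hfP, hfQ, hq, Pi.sub_apply, Function.comp_apply, augmentedHam]
      rw [ψ.left_inv hx', hHQH _ hx hJx, hJx]
      ring
    filter_upwards [hU, hψs] with x hx hx' hjx
    have hJx : J (φ.symm x) = J p := by
      simp only [hj, Function.comp_apply, h0] at hjx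
      exact hjx
    rw [hval x hx hx' hJx, hval e hU.self_of_nhds hψs.self_of_nhds (by rw [h0])]
  have hg : ContDiffAt ℝ 2 (fP - fQ ∘ q) e := (hfPc.sub hcomp).of_le two_le_infty
  have hj2 : ContDiffAt ℝ 2 j e := hjc.of_le two_le_infty
  have hdg : fderiv ℝ (fP - fQ ∘ q) e
      = -(tangentAt HQ (π p) : EQ →L[ℝ] ℝ).comp (tangentAt π p : EP →L[ℝ] EQ) := by
    rw [fderiv_sub (hfPc.differentiableAt (by simp)) (hcomp.differentiableAt (by simp)), hdfP,
      fderiv_comp e (hfQc.differentiableAt (by simp)) (hqc.differentiableAt (by simp)), hdfQ, hdq,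
      zero_sub]
  have hQcrit : (tangentAt HQ (π p) : EQ →L[ℝ] ℝ) = 0 := by
    ext y
    obtain ⟨u, hu, rfl⟩ := hQ.submersion p hQ.mem rfl y
    have h1 := fderiv_eq_zero_of_const_on_levelSet hj2 hs hg hconst (u := u) (by rw [hdj]; exact hu)
    rw [hdg] at h1
    exact neg_eq_zero.1 h1
  refine ⟨hQcrit, fun u v hu hv => ?_⟩
  have h1 := fderiv_fderiv_eq_zero_of_const_on_levelSet hj2 hs hg hconst
    (by rw [hdg, hQcrit, ContinuousLinearMap.zero_comp, neg_zero])
    (u := u) (v := v) (by rw [hdj]; exact hu) (by rw [hdj]; exact hv)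
  have h2 : fderiv ℝ (fP - fQ ∘ q) =ᶠ[𝓝 e] fderiv ℝ fP - fderiv ℝ (fQ ∘ q) := by
    filter_upwards [((hfPc.of_le two_le_infty).eventually (by simp)),
      ((hcomp.of_le two_le_infty).eventually (by simp))] with x hx hx'
    exact fderiv_sub (hx.differentiableAt (by simp)) (hx'.differentiableAt (by simp))
  rw [h2.fderiv_eq, fderiv_sub
    ((hfPc.fderiv_right (m := 1) one_add_one_le_infty).differentiableAt (by simp))
    ((hcomp.fderiv_right (m := 1) one_add_one_le_infty).differentiableAt (by simp)),
    sub_apply, sub_apply, fderiv_fderiv_comp_of_fderiv_eq_zero (hfQc.of_le two_le_infty)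
      (hqc.of_le two_le_infty) (by rw [hdfQ, hQcrit]), hdq, hqe, sub_eq_zero] at h1
  exact h1

end Reduction

/-! ### The linear-algebraic setting at a relative equilibrium -/

section RelativeEquilibria

variable {EP : Type*} [NormedAddCommGroup EP] [NormedSpace ℝ EP]
  {P : Type*} [TopologicalSpace P] [ChartedSpace EP P]
  {EG : Type*} [NormedAddCommGroup EG] [NormedSpace ℝ EG]
  {G : Type*} [TopologicalSpace G] [ChartedSpace EG G] [Group G] [MulAction G P]
  {EQ : Type*} [NormedAddCommGroup EQ] [NormedSpace ℝ EQ]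
  {Q : Type*} [TopologicalSpace Q] [ChartedSpace EQ Q]
  {Ω : SymplecticForm EP P} {J : P → EG →L[ℝ] ℝ} {H : P → ℝ} {p : P} {ξ : EG}
  {ΩQ : SymplecticForm EQ Q} {U : Set P} {π : P → Q} {HQ : Q → ℝ}

/-- The symplectic form at `p`, as a bilinear form. -/
noncomputable abbrev SymplecticForm.bilinForm (Ω : SymplecticForm EP P) (p : P) :
    LinearMap.BilinForm ℝ EP :=
  ContinuousLinearMap.toBilinForm (Ω.form p)

theorem SymplecticForm.bilinForm_isAlt (Ω : SymplecticForm EP P) (p : P) :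
    (Ω.bilinForm p).IsAlt := Ω.alternating p

theorem SymplecticForm.perp_eq_orthogonal (Ω : SymplecticForm EP P) (p : P)
    (V : Submodule ℝ EP) : Ω.perp p V = (Ω.bilinForm p).orthogonal V := by
  ext v
  have h : ∀ w, Ω.form p v w = 0 ↔ Ω.form p w v = 0 := fun w => by rw [Ω.skew p v, neg_eq_zero]
  change (∀ w ∈ V, Ω.form p v w = 0) ↔ ∀ w ∈ V, Ω.form p w v = 0
  simp only [h]

theorem SymplecticForm.bilinForm_nondegenerate (Ω : SymplecticForm EP P) (p : P) :
    (Ω.bilinForm p).Nondegenerate := by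
  refine ⟨Ω.nondegenerate p, fun v hv => Ω.nondegenerate p v fun w => ?_⟩
  rw [Ω.skew, neg_eq_zero]
  exact hv w

theorem IsMomentumMap.orthogonal_range (hJ : IsMomentumMap G Ω J) (p : P) :
    (Ω.bilinForm p).orthogonal (LinearMap.range (infGen G p : EG →L[ℝ] EP).toLinearMap)
      = LinearMap.ker (tangentAt J p : EP →L[ℝ] EG →L[ℝ] ℝ).toLinearMap := by
  ext v
  constructor
  · intro hv
    refine ContinuousLinearMap.ext fun η => ?_
    have h1 : Ω.form p (infGen G p η) v = 0 := hv _ ⟨η, rfl⟩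
    rw [hJ.generates] at h1
    exact h1
  · rintro hv _ ⟨η, rfl⟩
    change Ω.form p (infGen G p η) v = 0
    rw [hJ.generates]
    exact congrArg (fun f : EG →L[ℝ] ℝ => f η) hv

variable [LieGroup 𝓘(ℝ, EG) ∞ G]

theorem IsMoncriefSplitting.isWittSplitting (hJ : IsMomentumMap G Ω J) {S : EP →ₗ[ℝ] EP}
    {W Z : Submodule ℝ EP} {𝔟 : Submodule ℝ EG} (h : IsMoncriefSplitting G Ω J p S W 𝔟 Z) :
    IsWittSplitting (Ω.bilinForm p) (infGen G p : EG →L[ℝ] EP).toLinearMap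
      (isotropyAlgebra G (J p)) W 𝔟 Z where
  W_disjoint := h.W_disjoint
  W_sup := by rw [hJ.orthogonal_range]; exact h.W_sup
  b_isCompl := h.b_isCompl
  Z_isotropic := by
    intro z hz z' hz'
    rw [h.Z_lagrangian] at hz
    exact hz.1 z' hz'
  Z_disjoint := h.Z_disjoint
  Z_sup := by rw [h.Z_sup, Ω.perp_eq_orthogonal]

variable [FiniteDimensional ℝ EG]

theorem IsMomentumMap.isInfinitesimalAction [ContMDiffSMul 𝓘(ℝ, EG) 𝓘(ℝ, EP) ∞ G P]
    (hJ : IsMomentumMap G Ω J) (hreg : IsRegularPoint (EG := EG) (EP := EP) G p) :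
    IsInfinitesimalAction (Ω.bilinForm p) (infGen G p : EG →L[ℝ] EP).toLinearMap
      (isotropyAlgebra G (J p)) where
  nondegenerate := Ω.bilinForm_nondegenerate p
  alt := Ω.bilinForm_isAlt p
  injective := by
    rw [injective_iff_map_eq_zero]
    intro η hη
    by_contra h
    exact hreg η h hη
  mem_iff := by
    intro η
    rw [mem_isotropyAlgebra_iff, ← hJ.tangentAt_infGen, ContinuousLinearMap.ext_iff]
    exact forall_congr' fun ζ => by
      rw [← hJ.generates]
      rfl

variable [FiniteDimensional ℝ EP]

/-- A complement of the Lagrangian subspace `𝔤_μ p` that is isotropic is Lagrangian, i.e. equal to its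
own orthogonal. -/
theorem IsWittSplitting.isMoncriefSplitting [ContMDiffSMul 𝓘(ℝ, EG) 𝓘(ℝ, EP) ∞ G P]
    (hJ : IsMomentumMap G Ω J) (hreg : IsRegularPoint (EG := EG) (EP := EP) G p)
    {S : EP →ₗ[ℝ] EP} {W Z : Submodule ℝ EP} {𝔟 : Submodule ℝ EG}
    (h : IsWittSplitting (Ω.bilinForm p) (infGen G p : EG →L[ℝ] EP).toLinearMap
      (isotropyAlgebra G (J p)) W 𝔟 Z) (hSW : ∀ w ∈ W, S w ∈ W) (hSZ : ∀ z ∈ Z, S z ∈ Z)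
    (hb : ∀ g ∈ isotropyGroup G (J p), ∀ η ∈ 𝔟, Ad g η ∈ 𝔟) :
    IsMoncriefSplitting G Ω J p S W 𝔟 Z where
  W_invariant := hSW
  W_disjoint := h.W_disjoint
  W_sup := by rw [h.W_sup, hJ.orthogonal_range]
  b_invariant := hb
  b_isCompl := h.b_isCompl
  Z_invariant := hSZ
  Z_lagrangian := by
    have ha := hJ.isInfinitesimalAction hreg
    have hZ : Z ≤ (Ω.bilinForm p).orthogonal
        (W ⊔ 𝔟.map (infGen G p : EG →L[ℝ] EP).toLinearMap) := h.Z_sup ▸ le_sup_left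
    rw [Ω.perp_eq_orthogonal, Ω.perp_eq_orthogonal]
    refine le_antisymm (fun z hz => ⟨fun z' hz' => h.Z_isotropic z' hz' z hz, hZ hz⟩) ?_
    rintro v ⟨hv, hv'⟩
    -- the component of `v` in `𝔤_μ p` is orthogonal to all four summands
    rw [← h.Z_sup] at hv'
    obtain ⟨z, hz, _, ⟨η, hη, rfl⟩, rfl⟩ := Submodule.mem_sup.1 hv'
    set l := (infGen G p : EG →L[ℝ] EP).toLinearMap η with hl
    have hl0 : l = 0 := by
      apply Ω.nondegenerate p
      intro u
      obtain ⟨w, hw, η', hη', z', hz', β, hβ, rfl⟩ := h.exists_add_eq ha u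
      have h1 : Ω.bilinForm p w l = 0 := ha.map_le_orthogonal (𝔟 := 𝔟) h.W_sup ⟨η, hη, rfl⟩ w
        (Submodule.mem_sup_left hw)
      have h2 : Ω.bilinForm p ((infGen G p : EG →L[ℝ] EP).toLinearMap η') l = 0 :=
        (ha.mem_iff η).1 hη η'
      have h3 : Ω.bilinForm p ((infGen G p : EG →L[ℝ] EP).toLinearMap β) l = 0 :=
        (ha.mem_iff η).1 hη β
      have h4 : Ω.bilinForm p z' (z + l) = 0 := hv z' hz'
      rw [map_add, h.Z_isotropic z' hz' z hz, zero_add] at h4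
      rw [Ω.skew, neg_eq_zero]
      change Ω.bilinForm p _ l = 0
      rw [map_add, map_add, map_add, LinearMap.add_apply, LinearMap.add_apply,
        LinearMap.add_apply, h1, h2, h3, h4]
      simp
    rw [hl0, add_zero]
    exact hz
  Z_disjoint := h.Z_disjoint
  Z_sup := by rw [h.Z_sup, Ω.perp_eq_orthogonal]

/-- The linearization at a formally stable regular relative equilibrium of a compact group fits the
linear-algebraic setting. -/
theorem IsReducedSpaceNear.isLinearizedEquilibrium
    [IsManifold 𝓘(ℝ, EP) ∞ P] [T2Space G] [CompactSpace G]
    [ContMDiffSMul 𝓘(ℝ, EG) 𝓘(ℝ, EP) ∞ G P] [FiniteDimensional ℝ EQ] [IsManifold 𝓘(ℝ, EQ) ∞ Q]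
    (hQ : IsReducedSpaceNear G Ω J p ΩQ U π)
    (hJ : IsMomentumMap G Ω J) (hH : ContMDiff 𝓘(ℝ, EP) 𝓘(ℝ, ℝ) ∞ H)
    (hHinv : ∀ (g : G) (x : P), H (g • x) = H x)
    (hp : IsRelativeEquilibrium (G := G) Ω H p ξ)
    (hreg : IsRegularPoint (EG := EG) (EP := EP) G p)
    (hHQ : ContMDiff 𝓘(ℝ, EQ) 𝓘(ℝ, ℝ) ∞ HQ) (hHQH : ∀ x ∈ U, J x = J p → HQ (π x) = H x)
    (hstable : IsDefinite (hessian HQ (π p) : EQ →L[ℝ] EQ →L[ℝ] ℝ)) :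
    IsLinearizedEquilibrium (Ω.bilinForm p) (infGen G p : EG →L[ℝ] EP).toLinearMap
      (isotropyAlgebra G (J p)) (linearization (Ω.hamVF (augmentedHam H J ξ)) p)
      (ad G ξ).toLinearMap (tangentAt π p : EP →L[ℝ] EQ).toLinearMap (ΩQ.bilinForm (π p))
      (linearization (ΩQ.hamVF HQ) (π p)) := by
  have hHξ := hJ.contMDiff_augmentedHam hH ξ
  have hcrit := hp.tangentAt_augmentedHam hJ hH
  obtain ⟨hQcrit, hhess⟩ := hQ.hessian_eq hJ hreg hH hcrit hHQ hHQH
  have hsurj : ∀ x, ∃ v ∈ LinearMap.ker (tangentAt J p : EP →L[ℝ] EG →L[ℝ] ℝ).toLinearMap,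
      (tangentAt π p : EP →L[ℝ] EQ) v = x := hQ.submersion p hQ.mem rfl
  have hskew := form_linearization_skew Ω hHξ hcrit
  have hA := hp.linearization_infGen hJ hH hHinv
  have hAK : ∀ v, (tangentAt J p : EP →L[ℝ] EG →L[ℝ] ℝ) v = 0 →
      (tangentAt J p : EP →L[ℝ] EG →L[ℝ] ℝ)
        (linearization (Ω.hamVF (augmentedHam H J ξ)) p v) = 0 := by
    intro v hv
    ext η
    have h1 := hskew (infGen G p η) v
    rw [hA, map_neg, neg_apply, hJ.generates, hJ.generates, hv] at h1
    simpa using h1.symm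
  have hpull := hQ.pullback p hQ.mem rfl
  refine
    { toIsInfinitesimalAction := hJ.isInfinitesimalAction hreg
      skew := hskew
      A_apply := hA
      D_semisimple := ad_isSemisimple ξ
      nondegenerate_X := ΩQ.nondegenerate _
      alt_X := ΩQ.bilinForm_isAlt _
      pullback := ?_
      surjective := ?_
      T_A := ?_
      AX_semisimple := linearization_isSemisimple ΩQ hHQ hQcrit hstable }
  · rw [hJ.orthogonal_range]
    exact fun u hu v hv => hpull u v hu hv
  · rw [hJ.orthogonal_range]
    exact hsurj
  · rw [hJ.orthogonal_range]
    intro v hv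
    apply ΩQ.form_injective (π p)
    ext y
    obtain ⟨w, hw, rfl⟩ := hsurj y
    rw [form_linearization ΩQ hHQ hQcrit]
    change ΩQ.form (π p) ((tangentAt π p : EP →L[ℝ] EQ) _) _
      = (hessian HQ (π p) : EQ →L[ℝ] EQ →L[ℝ] ℝ) ((tangentAt π p : EP →L[ℝ] EQ) v) _
    rw [hpull _ _ (hAK v hv) hw, ← hhess v w hv hw, form_linearization Ω hHξ hcrit]

end RelativeEquilibria

end HamMech

theorem mainTheorem1
    -- a smooth symplectic manifold
    {EP : Type*} [NormedAddCommGroup EP] [NormedSpace ℝ EP] [FiniteDimensional ℝ EP]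
    {P : Type*} [TopologicalSpace P] [T2Space P] [ChartedSpace EP P] [IsManifold 𝓘(ℝ, EP) ∞ P]
    (Ω : SymplecticForm EP P)
    -- a compact Lie group acting symplectically on it, with a momentum mapping
    {EG : Type*} [NormedAddCommGroup EG] [NormedSpace ℝ EG] [FiniteDimensional ℝ EG]
    {G : Type*} [TopologicalSpace G] [T2Space G] [CompactSpace G] [ChartedSpace EG G] [Group G]
    [LieGroup 𝓘(ℝ, EG) ∞ G] [MulAction G P] [ContMDiffSMul 𝓘(ℝ, EG) 𝓘(ℝ, EP) ∞ G P]
    (hsymp : IsSymplecticAction G Ω)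
    (J : P → EG →L[ℝ] ℝ) (hJ : IsMomentumMap G Ω J)
    -- an invariant Hamiltonian
    (H : P → ℝ) (hH : ContMDiff 𝓘(ℝ, EP) 𝓘(ℝ, ℝ) ∞ H) (hHinv : ∀ (g : G) (x : P), H (g • x) = H x)
    -- a regular relative equilibrium
    (p : P) (ξ : EG) (hp : IsRelativeEquilibrium (G := G) Ω H p ξ) (hreg : IsRegularPoint (EG := EG) (EP := EP) G p)
    -- the reduced system
    {EQ : Type*} [NormedAddCommGroup EQ] [NormedSpace ℝ EQ] [FiniteDimensional ℝ EQ]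
    {Q : Type*} [TopologicalSpace Q] [T2Space Q] [ChartedSpace EQ Q] [IsManifold 𝓘(ℝ, EQ) ∞ Q]
    (ΩQ : SymplecticForm EQ Q) (U : Set P) (π : P → Q)
    (hQ : IsReducedSpaceNear G Ω J p ΩQ U π)
    (HQ : Q → ℝ) (hHQ : ContMDiff 𝓘(ℝ, EQ) 𝓘(ℝ, ℝ) ∞ HQ)
    (hHQH : ∀ x ∈ U, J x = J p → HQ (π x) = H x)
    -- formal stability
    (hstable : IsDefinite (hessian HQ (π p) : EQ →L[ℝ] EQ →L[ℝ] ℝ))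
    -- the Jordan decomposition of the linearization
    (S N : EP →ₗ[ℝ] EP)
    (hSN : IsJordanDecomposition (linearization (Ω.hamVF (augmentedHam H J ξ)) p) S N) :
    -- invariant splittings exist
    (∃ (W : Submodule ℝ EP) (𝔟 : Submodule ℝ EG) (Z : Submodule ℝ EP),
      IsMoncriefSplitting G Ω J p S W 𝔟 Z) ∧
    -- and each of them has the asserted properties
    ∀ (W : Submodule ℝ EP) (𝔟 : Submodule ℝ EG) (Z : Submodule ℝ EP),
      IsMoncriefSplitting G Ω J p S W 𝔟 Z →
      DirectSum.IsInternal (![W, (isotropyAlgebra G (J p)).map (infGen G p).toLinearMap, Z,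
        𝔟.map (infGen G p).toLinearMap] : Fin 4 → Submodule ℝ EP) ∧
      ∃ Φ : EP ≃ₗ[ℝ] Model EQ G (J p), IsSplittingIdentification G J p π W 𝔟 Z Φ ∧
      -- block form of the symplectic form
      (∀ a b : Model EQ G (J p), Ω.form p (Φ.symm a) (Φ.symm b) =
        ΩQ.form (π p) a.1 b.1 + b.2.2.1 a.2.1 - a.2.2.1 b.2.1
          + kostantSouriau G (J p) a.2.2.2 b.2.2.2) ∧
      -- `ad_ξ` acts on `𝔤_μ`, and `(ad_ξ)^*` acts on `T_μ(Gμ)`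
      ∃ (adμ : isotropyAlgebra G (J p) →ₗ[ℝ] isotropyAlgebra G (J p))
        (adStar : orbitTangent G (J p) →ₗ[ℝ] orbitTangent G (J p)),
      (∀ η, (adμ η : EG) = ad G ξ η) ∧
      (∀ τ, (adStar τ : EG →L[ℝ] ℝ) = (τ : EG →L[ℝ] ℝ).comp (ad G ξ)) ∧
      -- block form of the semisimple part
      (∀ (x : EQ) (η : isotropyAlgebra G (J p)) (ν : Module.Dual ℝ (isotropyAlgebra G (J p)))
        (τ : orbitTangent G (J p)), Φ (S (Φ.symm (x, η, ν, τ))) =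
          (linearization (ΩQ.hamVF HQ) (π p) x, -adμ η, adμ.dualMap ν, adStar τ)) ∧
      -- block form of the nilpotent part
      N ^ 3 = 0 ∧
      ∃ (N13 : Module.Dual ℝ (isotropyAlgebra G (J p)) →ₗ[ℝ] EQ)
        (N21 : EQ →ₗ[ℝ] isotropyAlgebra G (J p))
        (N23 : Module.Dual ℝ (isotropyAlgebra G (J p)) →ₗ[ℝ] isotropyAlgebra G (J p)),
      (∀ (x : EQ) (η : isotropyAlgebra G (J p)) (ν : Module.Dual ℝ (isotropyAlgebra G (J p)))
        (τ : orbitTangent G (J p)), Φ (N (Φ.symm (x, η, ν, τ))) =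
          (N13 ν, N21 x + N23 ν, 0, 0)) ∧
      -- `N21 = -(N13)^* Ω^♭`, and `N23` is symmetric
      (∀ (x : EQ) (ν : Module.Dual ℝ (isotropyAlgebra G (J p))),
        ν (N21 x) = -(N13.dualMap (ΩQ.form (π p) x).toLinearMap) ν) ∧
      (∀ ν ν' : Module.Dual ℝ (isotropyAlgebra G (J p)), ν' (N23 ν) = ν (N23 ν')) ∧
      -- the intertwining relations, where `coad_ξ = -(ad_ξ)^*`
      linearization (ΩQ.hamVF HQ) (π p) ∘ₗ N13 = -(N13 ∘ₗ (-adμ.dualMap)) ∧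
      N21 ∘ₗ linearization (ΩQ.hamVF HQ) (π p) = -(adμ ∘ₗ N21) ∧
      adμ ∘ₗ N23 = N23 ∘ₗ (-adμ.dualMap) := by
  have hlin := hQ.isLinearizedEquilibrium hJ hH hHinv hp hreg hHQ hHQH hstable
  have ha := hJ.isInfinitesimalAction hreg
  have hξ := hp.mem_isotropyAlgebra hJ hH hHinv
  constructor
  · obtain ⟨𝔟, hb, hbc⟩ := exists_Ad_invariant_isCompl (EG := EG) (G := G) (J p)
    obtain ⟨W, Z, hW, hSW, hSZ⟩ := hlin.exists_wittSplitting hSN hbc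
      fun β hβ => ad_mem_of_Ad_mem hb hξ hβ
    exact ⟨W, 𝔟, Z, hW.isMoncriefSplitting hJ hreg hSW hSZ hb⟩
  · intro W 𝔟 Z hM
    have hW := hM.isWittSplitting hJ
    refine ⟨hW.isInternal ha, ?_⟩
    -- the block operators of the model
    let d : EG →ₗ[ℝ] orbitTangent G (J p) :=
      (tangentAt (fun g : G => CoAd g (J p)) 1 : EG →L[ℝ] EG →L[ℝ] ℝ).toLinearMap.rangeRestrict
    let jk : EP →ₗ[ℝ] Module.Dual ℝ (isotropyAlgebra G (J p)) :=
      { toFun := fun v => ((tangentAt J p : EP →L[ℝ] EG →L[ℝ] ℝ) v).toLinearMap.domRestrict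
          (isotropyAlgebra G (J p))
        map_add' := fun u v => by ext; simp
        map_smul' := fun c v => by ext; simp }
    let adμ : isotropyAlgebra G (J p) →ₗ[ℝ] isotropyAlgebra G (J p) :=
      (ad G ξ).toLinearMap.restrict fun η hη => hlin.D_mem hη
    let adStar : orbitTangent G (J p) →ₗ[ℝ] orbitTangent G (J p) :=
      LinearMap.restrict
        ((ContinuousLinearMap.compL ℝ EG EG ℝ).flip (ad G ξ)).toLinearMap
        fun τ hτ => comp_ad_mem_orbitTangent hξ hτ
    have hks : ∀ η ζ, kostantSouriau G (J p) (d η) (d ζ)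
        = Ω.bilinForm p (infGen G p η) (infGen G p ζ) := by
      intro η ζ
      rw [kostantSouriau_apply (η := η) (ζ := ζ) rfl rfl]
      change _ = Ω.form p (infGen G p η) (infGen G p ζ)
      rw [hJ.generates, hJ.tangentAt_infGen, tangentAt_CoAd_apply, bracket_skew, map_neg]
    have hdk : ∀ η, d η = 0 ↔ η ∈ isotropyAlgebra G (J p) := by
      intro η
      rw [mem_isotropyAlgebra_iff]
      exact Subtype.ext_iff
    have hDO : ∀ η, adStar (d η) = -d (ad G ξ η) := by
      intro η
      apply Subtype.ext
      exact tangentAt_CoAd_comp_ad hξ η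
    have hDk : ∀ η : isotropyAlgebra G (J p), (adμ η : EG) = ad G ξ η := fun η => rfl
    have hbD : ∀ β ∈ 𝔟, ad G ξ β ∈ 𝔟 := fun β hβ => ad_mem_of_Ad_mem hM.b_invariant hξ hβ
    have hds : Function.Surjective d := LinearMap.surjective_rangeRestrict _
    have hjk : ∀ v (η : isotropyAlgebra G (J p)), jk v η = Ω.bilinForm p (infGen G p (η : EG)) v :=
      fun v η => (hJ.generates p η v).symm
    have key := hlin.normal_form (O := orbitTangent G (J p)) hSN hW hM.W_invariant hM.Z_invariant
      hbD d hds hdk jk hjk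
    have key' := key (kostantSouriau G (J p)) hks
    obtain ⟨Φ, ⟨hΦW, hΦk, hΦZ, hΦb⟩, hform, hS, N13, N21, N23, hrest⟩ :=
      key' adμ hDk adStar hDO
    have hτ : ∀ τ, (adStar τ : EG →L[ℝ] ℝ) = (τ : EG →L[ℝ] ℝ).comp (ad G ξ) := fun τ => rfl
    have hΦ : IsSplittingIdentification G J p π W 𝔟 Z Φ :=
      ⟨hΦW, hΦk, hΦZ, fun η hη => ⟨d η, (hJ.tangentAt_infGen p η).symm, hΦb η hη⟩⟩
    have hN := hlin.N_pow_three hSN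
    exact ⟨Φ, hΦ, hform, adμ, adStar, hDk, hτ, hS, hN, N13, N21, N23, hrest⟩
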